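/- Throughout, $k$ is a field, $\otimes=\otimes_k$, $\mathsf{tw}$ is the flip of tensor factors, $f^{21}=\mathsf{tw}f\mathsf{tw}$, and $f^{13}$ denotes a map acting as $f$ on the first and third tensor factors. For an idempotent, non-degenerate $k$-algebra $A$ (possibly without unit; multiplication $\mu$), $\mathbb M(A)$ is its multiplier algebra: its elements $w$ are pairs of linear maps $a\mapsto wa$, $a\mapsto aw$ on $A$ with $a(wb)=(aw)b$. **Weak multiplier bialgebras.** A *weak multiplier bialgebra* is such an algebra $A$ with an idempotent $E\in\mathbb M(A\otimes A)$, a multiplicative linear map $\Delta:A\to\mathbb M(A\otimes A)$ and a linear map $\epsilon:A\to k$ such that: $T_1(a\otimes b):=\Delta(a)(1\otimes b)$ and $T_2(a\otimes b):=(a\otimes1)\Delta(b)$ lie in $A\otimes A$; $(T_2\otimes A)(A\otimes T_1)=(A\otimes T_1)(T_2\otimes A)$; $(\epsilon\otimes A)T_1=\mu=(A\otimes\epsilon)T_2$; $\langle E(a\otimes b)\rangle=\langle\Delta(a)(b\otimes c)\rangle$ and $\langle(a\otimes b)E\rangle=\langle(b\otimes c)\Delta(a)\rangle$ (linear spans over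 all elements of $A$); $(E\otimes1)(1\otimes E)=(1\otimes E)(E\otimes 1)$ is the image of $E$ under the canonical extension of $\Delta\otimes A$ to $\mathbb M(A\otimes A)$; and $(\epsilon\otimes A)((1\otimes a)E(b\otimes c))=(\epsilon\otimes A)(\Delta(a)(b\otimes c))$, $(\epsilon\otimes A)((a\otimes b)E(1\otimes c))=(\epsilon\otimes A)((a\otimes b)\Delta(c))$ for all $a,b,c\in A$. Put $E_1=E(-)$ and $E_2=(-)E$ on $A\otimes A$. It is *regular* if also $(1\otimes b)\Delta(a)$ and $\Delta(b)(a\otimes1)$ lie in $A\otimes A$ for all $a,b$. Its comultiplication is *right full* if the elements $(A\otimes\omega)T_1(a\otimes b)$, with $a,b\in A$ and $\omega\in\mathsf{Lin}(A,k)$, span $A$. Write $\overline\sqcap^R(a)=(\mathbb M(A)\otimes\epsilon)[E(1\otimes a)]$, $\sqcap^R(a)=(\mathbb M(A)\otimes\epsilon)[(1\otimes a)E]$, $\overline\sqcap^L(a)=(\epsilon\otimes\mathbb M(A))[(a\otimes1)E]$. If $A$ is regular and right full, then $R:=\sqcap^R(A)=\overline\sqcap^R(A)$ is the base algebra, and $\tau:R\to\mathbb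 M(A)$ is the map $\sqcap^R(a)\mapsto\overline\sqcap^L(a)$. **Modules.** $\mathsf M_{(A)}$ is the category of idempotent ($V\cdot A$ spans $V$) and non-degenerate ($v\cdot a=0$ for all $a$ implies $v=0$) right $A$-modules. They are $R$-bimodules via $(v\cdot a)r=v\cdot(ar)$, $r(v\cdot a)=v\cdot(a\tau(r))$. For $V,W\in\mathsf M_{(A)}$ put $E_2^{V,W}(v\cdot a\otimes w\cdot b)=(v\cdot(-)\otimes w\cdot(-))[(a\otimes b)E]$ and define the diagonal action on $V\otimes W$ by $(v\cdot a\otimes w\cdot b)\Delta(c)=(v\cdot(-)\otimes w\cdot(-))[(a\otimes b)\Delta(c)]$; put $(v\otimes w)\Delta^{\mathsf{op}}(c)=\mathsf{tw}[(w\otimes v)\Delta(c)]$. $\mathsf M_{(A)}$ is monoidal via $V\otimes_RW$ with the action induced by the diagonal one, and unit $R$ with action $r\cdot a=\sqcap^R(ra)$. **Comodules.** A *right $A$-comodule* is a vector space $M$ with linear maps $\lambda,\varrho:M\otimes A\to M\otimes A$ such that $(1\otimes a)\lambda(m\otimes b)=\varrho(m\otimes a)(1\otimes b)$, $(\lambda\otimes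 A)\lambda^{13}(M\otimes T_1)=(M\otimes T_1)(\lambda\otimes A)$ and $(\lambda\otimes A)\lambda^{13}(M\otimes E_1)=(\lambda\otimes A)\lambda^{13}$. It is *full* if the elements $(M\otimes\omega)\lambda(m\otimes a)$ (equivalently, $(M\otimes\omega)\varrho(m\otimes a)$) with $m\in M$, $a\in A$, $\omega\in\mathsf{Lin}(A,k)$ span $M$. Morphisms are linear maps $f$ with $(f\otimes A)\lambda=\lambda'(f\otimes A)$. Full comodules form the category $\mathsf M^{(A)}$; they are $R$-bimodules via $m\,\overline\sqcap^R(a)=(M\otimes\epsilon)\lambda(m\otimes a)$, $\sqcap^R(a)\,m=(M\otimes\epsilon)\varrho(m\otimes a)$. $\mathsf M^{(A)}$ is monoidal via $M\otimes_RN$, with $\lambda$ and $\varrho$ induced by $\lambda_M^{13}(M\otimes\lambda_N)$ and $(M\otimes\varrho_N)\varrho_M^{13}$, and unit $R$ with $\lambda(r\otimes a)=E(1\otimes ra)$, $\varrho(r\otimes a)=(1\otimes ar)E$ (elements of $R\otimes A\subset \mathbb M(A\otimes A)$). **The maps $\widehat\varphi$.** For $V\in\mathsf M_{(A)}$ and $M\in\mathsf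 M^{(A)}$, the map $\widehat\varphi_{V,M}:V\otimes_RM\to M\otimes_RV$ is induced by $\varphi_{V,M}:V\otimes M\to M\otimes V$, $v\cdot a\otimes m\mapsto(M\otimes v\cdot(-))\varrho(m\otimes a)$. **Weak centers.** An object of the *left weak center* of a monoidal category $(\mathsf C,\otimes,I)$ is an object $Q$ with a natural family of morphisms $\vartheta_M:Q\otimes M\to M\otimes Q$ in $\mathsf C$ (not required to be invertible) such that, up to coherence isomorphisms, $\vartheta_I=\mathrm{id}_Q$ and $\vartheta_{M\otimes N}=(M\otimes\vartheta_N)(\vartheta_M\otimes N)$. An object of the *right weak center* is an object $P$ with a natural family of morphisms $\sigma_V:V\otimes P\to P\otimes V$ such that, up to coherence isomorphisms, $\sigma_I=\mathrm{id}_P$ and $\sigma_{V\otimes W}=(\sigma_V\otimes W)(V\otimes\sigma_W)$. **Theorem.** Let $A$ be a regular weak multiplier bialgebra with right full comultiplication, and let $X$ be a vector space carrying both a structure of idempotent non-degenerate right $A$-module $(X,\cdot)$ and a structure of full right $A$-comodule $(X,\lambda,\varrho)$. Regard $A$ as a right $A$-module via multiplication and assume that $$E_2^{X,A}\varrho=\varrho=\varrho\,(E_2^{A,X})^{21}$$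 (this means precisely that the two $R$-bimodule structures of $X$, coming from the module and from the comodule structure, coincide). Then the following assertions are equivalent. (a) For any full right $A$-comodule $M$, $\widehat\varphi_{X,M}:X\otimes_RM\to M\otimes_RX$ is a morphism of $A$-comodules. (b) $((X,\lambda,\varrho),\widehat\varphi_{X,-})$ is an object of the left weak center of $\mathsf M^{(A)}$. (c) For any idempotent non-degenerate right $A$-module $V$, $\widehat\varphi_{V,X}:V\otimes_RX\to X\otimes_RV$ is a morphism of $A$-modules. (d) $((X,\cdot),\widehat\varphi_{-,X})$ is an object of the right weak center of $\mathsf M_{(A)}$. (e) For all $x\in X$ and $a,b\in A$, $\varrho[(x\otimes a)\Delta^{\mathsf{op}}(b)]=\varrho(x\otimes a)\Delta(b)$. -/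

import Mathlib

open scoped TensorProduct

universe v u

namespace WMB

/-! ### Linear algebra -/

section Linear

variable {k : Type v} [Field k]
variable {P : Type*} [AddCommGroup P] [Module k P] {Q : Type*} [AddCommGroup Q] [Module k Q]
  {S : Type*} [AddCommGroup S] [Module k S]

open Classical in
/-- The linear map `f : Q → S` given on the elements `p x` by the formula `f (p x) = g x`.
It is only used for `p` surjective; then it is unique, and it exists if and only if the formula
is consistent, that is, `g` vanishes on the kernel of `p`. (The value is `0` otherwise.) -/
noncomputable def descend (p : P →ₗ[k] Q) (g : P →ₗ[k] S) : Q →ₗ[k] S :=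
  if h : ∃ f : Q →ₗ[k] S, f ∘ₗ p = g then h.choose else 0

open Classical in
/-- The linear map `g : P → S`, regarded as a map to `Q` along an injection `i : Q → S`
whose range contains the range of `g`. (The value is `0` if the range of `g` is not contained in
that of `i`.) -/
noncomputable def corestrict (i : Q →ₗ[k] S) (g : P →ₗ[k] S) : P →ₗ[k] Q :=
  if h : ∃ f : P →ₗ[k] Q, i ∘ₗ f = g then h.choose else 0

theorem descend_comp {p : P →ₗ[k] Q} {g : P →ₗ[k] S} (h : LinearMap.ker p ≤ LinearMap.ker g) :
    descend p g ∘ₗ p = g := by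
  have hex : ∃ f : Q →ₗ[k] S, f ∘ₗ p = g := by
    obtain ⟨f, hf⟩ := ((LinearMap.ker p).liftQ g h ∘ₗ
      p.quotKerEquivRange.symm.toLinearMap).exists_extend
    refine ⟨f, LinearMap.ext fun x => ?_⟩
    have h1 := LinearMap.congr_fun hf (p.rangeRestrict x)
    have h2 : p.quotKerEquivRange.symm (p.rangeRestrict x) = (LinearMap.ker p).mkQ x := by
      rw [LinearEquiv.symm_apply_eq]
      exact Subtype.ext rfl
    simp only [LinearMap.comp_apply, LinearEquiv.coe_coe, h2] at h1
    simpa using h1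
  unfold descend
  rw [dif_pos hex]
  exact hex.choose_spec

theorem corestrict_comp {i : Q →ₗ[k] S} {g : P →ₗ[k] S}
    (h : LinearMap.range g ≤ LinearMap.range i) : i ∘ₗ corestrict i g = g := by
  have hex : ∃ f : P →ₗ[k] Q, i ∘ₗ f = g := by
    obtain ⟨j, hj⟩ := i.rangeRestrict.exists_rightInverse_of_surjective i.range_rangeRestrict
    refine ⟨j ∘ₗ g.codRestrict _ fun x => h ⟨x, rfl⟩, LinearMap.ext fun x => ?_⟩
    exact congrArg Subtype.val (LinearMap.congr_fun hj ⟨g x, h ⟨x, rfl⟩⟩)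
  unfold corestrict
  rw [dif_pos hex]
  exact hex.choose_spec

variable {M : Type*} [AddCommGroup M] [Module k M] {B : Type*} [AddCommGroup B] [Module k B]
  {A : Type*} [AddCommGroup A] [Module k A]

/-- `f ↦ f¹³`: the map acting as `f` on the first and third legs of `M ⊗ B ⊗ A`. -/
noncomputable def leg13 (B : Type*) [AddCommGroup B] [Module k B]
    (f : M ⊗[k] A →ₗ[k] M ⊗[k] A) :
    (M ⊗[k] B) ⊗[k] A →ₗ[k] (M ⊗[k] B) ⊗[k] A :=
  (TensorProduct.rightComm k M A B).toLinearMap ∘ₗ f.rTensor B ∘ₗ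
    (TensorProduct.rightComm k M B A).toLinearMap

/-- `f ↦ M ⊗ f`: the map acting as `f` on the last two legs of `M ⊗ B ⊗ A`. -/
noncomputable def leg23 (M : Type*) [AddCommGroup M] [Module k M]
    (f : B ⊗[k] A →ₗ[k] B ⊗[k] A) :
    (M ⊗[k] B) ⊗[k] A →ₗ[k] (M ⊗[k] B) ⊗[k] A :=
  (TensorProduct.assoc k M B A).symm.toLinearMap ∘ₗ f.lTensor M ∘ₗ
    (TensorProduct.assoc k M B A).toLinearMap

/-- `M ⊗ ω : M ⊗ A → M` for a linear functional `ω`. -/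
noncomputable def sliceR (M : Type*) [AddCommGroup M] [Module k M] (ω : A →ₗ[k] k) :
    M ⊗[k] A →ₗ[k] M :=
  (TensorProduct.rid k M).toLinearMap ∘ₗ ω.lTensor M

/-- `ω ⊗ M : A ⊗ M → M` for a linear functional `ω`. -/
noncomputable def sliceL (M : Type*) [AddCommGroup M] [Module k M] (ω : A →ₗ[k] k) :
    A ⊗[k] M →ₗ[k] M :=
  (TensorProduct.lid k M).toLinearMap ∘ₗ ω.rTensor M

/-- The flip map. -/
noncomputable def tw (P Q : Type*) [AddCommGroup P] [Module k P] [AddCommGroup Q] [Module k Q] :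
    P ⊗[k] Q →ₗ[k] Q ⊗[k] P :=
  (TensorProduct.comm k P Q).toLinearMap

end Linear

/-! ### Multipliers -/

section Multipliers

variable (k : Type v) [Field k] (A : Type u) [NonUnitalRing A] [Module k A]
  [IsScalarTower k A A] [SMulCommClass k A A]

/-- The pairs of linear maps `a ↦ w a` and `a ↦ a w` such that `a (w b) = (a w) b`. -/
def multiplierSubmodule : Submodule k ((A →ₗ[k] A) × (A →ₗ[k] A)) where
  carrier := {w | ∀ a b : A, a * w.1 b = w.2 a * b}
  add_mem' := by
    intro w w' h h' a b
    simp [mul_add, add_mul, h a b, h' a b]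
  zero_mem' := by
    intro a b
    simp
  smul_mem' := by
    intro c w h a b
    simp [mul_smul_comm, smul_mul_assoc, h a b]

/-- The multiplier algebra `𝕄(A)` of an idempotent non-degenerate algebra: a multiplier `w` is a
pair consisting of the linear maps `a ↦ w a` and `a ↦ a w`, such that `a (w b) = (a w) b`. -/
def Multiplier : Type u := ↥(multiplierSubmodule k A)

instance : AddCommGroup (Multiplier k A) :=
  inferInstanceAs (AddCommGroup ↥(multiplierSubmodule k A))

instance : Module k (Multiplier k A) :=
  inferInstanceAs (Module k ↥(multiplierSubmodule k A))

variable {k A}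

/-- `w.left a = w a`. -/
def Multiplier.left (w : Multiplier k A) : A →ₗ[k] A := w.1.1

/-- `w.right a = a w`. -/
def Multiplier.right (w : Multiplier k A) : A →ₗ[k] A := w.1.2

/-- The product of `𝕄(A)`: `(w w') a = w (w' a)` and `a (w w') = (a w) w'`. -/
instance : Mul (Multiplier k A) where
  mul w w' := ⟨(w.left ∘ₗ w'.left, w'.right ∘ₗ w.right), fun a b => by
    change a * w.left (w'.left b) = w'.right (w.right a) * b
    have h1 : a * w.left (w'.left b) = w.right a * w'.left b := w.2 a (w'.left b)
    have h2 : w.right a * w'.left b = w'.right (w.right a) * b := w'.2 (w.right a) b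
    rw [h1, h2]⟩

variable (k A)

/-- `w ↦ (a ↦ w a)`, as a linear map. -/
noncomputable def leftPart : Multiplier k A →ₗ[k] (A →ₗ[k] A) :=
  LinearMap.fst k _ _ ∘ₗ (multiplierSubmodule k A).subtype

/-- `w ↦ (a ↦ a w)`, as a linear map. -/
noncomputable def rightPart : Multiplier k A →ₗ[k] (A →ₗ[k] A) :=
  LinearMap.snd k _ _ ∘ₗ (multiplierSubmodule k A).subtype

end Multipliers

/-! ### Regular weak multiplier bialgebras -/

/-- A weak multiplier bialgebra: an idempotent non-degenerate algebra `A` with an idempotent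
multiplier `E` on `A ⊗ A`, a multiplicative comultiplication `Δ : A → 𝕄(A ⊗ A)` and a counit `ε`.
The maps `T₁, T₂` are determined by `Δ`. -/
structure WeakMultiplierBialgebra (k : Type v) [Field k] (A : Type u) [NonUnitalRing A]
    [Module k A] [IsScalarTower k A A] [SMulCommClass k A A] where
  /-- the idempotent multiplier `E` -/
  E : Multiplier k (A ⊗[k] A)
  /-- the comultiplication -/
  Δ : A →ₗ[k] Multiplier k (A ⊗[k] A)
  /-- `T₁ (a ⊗ b) = Δ(a)(1 ⊗ b)` -/
  T₁ : A ⊗[k] A →ₗ[k] A ⊗[k] A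
  /-- `T₂ (a ⊗ b) = (a ⊗ 1)Δ(b)` -/
  T₂ : A ⊗[k] A →ₗ[k] A ⊗[k] A
  /-- the counit -/
  ε : A →ₗ[k] k
  /-- `A` is idempotent -/
  idempotent : Function.Surjective (LinearMap.mul' k A)
  /-- `A` is non-degenerate -/
  nondegenerate_left : ∀ a : A, (∀ b : A, a * b = 0) → a = 0
  /-- `A` is non-degenerate -/
  nondegenerate_right : ∀ a : A, (∀ b : A, b * a = 0) → a = 0
  /-- `E` is idempotent -/
  E_mul_E : E * E = E
  /-- `Δ` is multiplicative -/
  Δ_mul : ∀ a b : A, Δ (a * b) = Δ a * Δ b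
  /-- `Δ(a)(1 ⊗ b)` is the element `T₁ (a ⊗ b)` of `A ⊗ A` -/
  T₁_spec : ∀ a b c d : A, (Δ a).left (c ⊗ₜ[k] (b * d)) = T₁ (a ⊗ₜ[k] b) * (c ⊗ₜ[k] d)
  /-- `(a ⊗ 1)Δ(b)` is the element `T₂ (a ⊗ b)` of `A ⊗ A` -/
  T₂_spec : ∀ a b c d : A, (Δ b).right ((c * a) ⊗ₜ[k] d) = (c ⊗ₜ[k] d) * T₂ (a ⊗ₜ[k] b)
  /-- coassociativity: `(T₂ ⊗ A)(A ⊗ T₁) = (A ⊗ T₁)(T₂ ⊗ A)` -/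
  coassoc : T₂.rTensor A ∘ₗ leg23 A T₁ = leg23 A T₁ ∘ₗ T₂.rTensor A
  /-- counitality: `(ε ⊗ A) T₁ = μ` -/
  counit_left : sliceL A ε ∘ₗ T₁ = LinearMap.mul' k A
  /-- counitality: `(A ⊗ ε) T₂ = μ` -/
  counit_right : sliceR A ε ∘ₗ T₂ = LinearMap.mul' k A
  /-- `⟨E (a ⊗ b)⟩ = ⟨Δ(a)(b ⊗ c)⟩` -/
  range_left : LinearMap.range E.left =
    Submodule.span k {x | ∃ a b c : A, x = (Δ a).left (b ⊗ₜ[k] c)}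
  /-- `⟨(a ⊗ b) E⟩ = ⟨(b ⊗ c)Δ(a)⟩` -/
  range_right : LinearMap.range E.right =
    Submodule.span k {x | ∃ a b c : A, x = (Δ a).right (b ⊗ₜ[k] c)}
  /-- `(E ⊗ 1)(1 ⊗ E) = (1 ⊗ E)(E ⊗ 1)` (left multiplications) -/
  E_comm_left : E.left.rTensor A ∘ₗ leg23 A E.left = leg23 A E.left ∘ₗ E.left.rTensor A
  /-- `(E ⊗ 1)(1 ⊗ E) = (1 ⊗ E)(E ⊗ 1)` (right multiplications) -/
  E_comm_right : E.right.rTensor A ∘ₗ leg23 A E.right = leg23 A E.right ∘ₗ E.right.rTensor A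
  /-- `(1 ⊗ E)(E ⊗ 1)` is the image of `E` under the canonical extension of `Δ ⊗ A` to `𝕄(A ⊗ A)`,
  that is, `(1 ⊗ E)(Δ(a)(b ⊗ c) ⊗ d) = ((Δ ⊗ A)(E (a ⊗ d)))(b ⊗ c ⊗ 1)` -/
  E_three_left : ∀ a b c d : A,
    leg23 A E.left ((Δ a).left (b ⊗ₜ[k] c) ⊗ₜ[k] d) =
      (((LinearMap.applyₗ (R := k) (b ⊗ₜ[k] c) ∘ₗ leftPart k (A ⊗[k] A)) ∘ₗ Δ).rTensor A)
        (E.left (a ⊗ₜ[k] d))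
  /-- the same for right multiplications:
  `((b ⊗ c)Δ(a) ⊗ d)(1 ⊗ E) = (b ⊗ c ⊗ 1)((Δ ⊗ A)((a ⊗ d) E))` -/
  E_three_right : ∀ a b c d : A,
    leg23 A E.right ((Δ a).right (b ⊗ₜ[k] c) ⊗ₜ[k] d) =
      (((LinearMap.applyₗ (R := k) (b ⊗ₜ[k] c) ∘ₗ rightPart k (A ⊗[k] A)) ∘ₗ Δ).rTensor A)
        (E.right (a ⊗ₜ[k] d))
  /-- `(ε ⊗ A)((1 ⊗ a) E (b ⊗ c)) = (ε ⊗ A)(Δ(a)(b ⊗ c))` -/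
  counit_mul_left : ∀ a b c : A,
    a * sliceL A ε (E.left (b ⊗ₜ[k] c)) = sliceL A ε ((Δ a).left (b ⊗ₜ[k] c))
  /-- `(ε ⊗ A)((a ⊗ b) E (1 ⊗ c)) = (ε ⊗ A)((a ⊗ b)Δ(c))` -/
  counit_mul_right : ∀ a b c : A,
    sliceL A ε (E.right (a ⊗ₜ[k] b)) * c = sliceL A ε ((Δ c).right (a ⊗ₜ[k] b))

/-- A regular weak multiplier bialgebra: also `(1 ⊗ b)Δ(a)` and `Δ(b)(a ⊗ 1)` belong to
`A ⊗ A`; equivalently, the opposite algebra is a weak multiplier bialgebra too. -/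
structure RegularWMB (k : Type v) [Field k] (A : Type u) [NonUnitalRing A]
    [Module k A] [IsScalarTower k A A] [SMulCommClass k A A] extends
    WeakMultiplierBialgebra k A where
  /-- `T₃ (a ⊗ b) = (1 ⊗ b)Δ(a)` -/
  T₃ : A ⊗[k] A →ₗ[k] A ⊗[k] A
  /-- `T₄ (a ⊗ b) = Δ(b)(a ⊗ 1)` -/
  T₄ : A ⊗[k] A →ₗ[k] A ⊗[k] A
  /-- `(1 ⊗ b)Δ(a)` is the element `T₃ (a ⊗ b)` of `A ⊗ A` -/
  T₃_spec : ∀ a b c d : A, (Δ a).right (c ⊗ₜ[k] (d * b)) = (c ⊗ₜ[k] d) * T₃ (a ⊗ₜ[k] b)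
  /-- `Δ(b)(a ⊗ 1)` is the element `T₄ (a ⊗ b)` of `A ⊗ A` -/
  T₄_spec : ∀ a b c d : A, (Δ b).left ((a * c) ⊗ₜ[k] d) = T₄ (a ⊗ₜ[k] b) * (c ⊗ₜ[k] d)

namespace RegularWMB

variable {k : Type v} [Field k] {A : Type u} [NonUnitalRing A]
    [Module k A] [IsScalarTower k A A] [SMulCommClass k A A] (H : RegularWMB k A)

/-- The comultiplication is right full: `⟨(A ⊗ ω) T₁ (a ⊗ b)⟩ = A`. -/
def RightFull : Prop :=
  Submodule.span k {x | ∃ (ω : A →ₗ[k] k) (a b : A), x = sliceR A ω (H.T₁ (a ⊗ₜ[k] b))} = ⊤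

/-- `⊓̄ᴿ(a) = (𝕄(A) ⊗ ε)[E(1 ⊗ a)]`, the multiplier with `⊓̄ᴿ(a) b = (A ⊗ ε)(E(b ⊗ a))`. -/
noncomputable def piBarR : A →ₗ[k] Multiplier k A :=
  corestrict (leftPart k A) (TensorProduct.curry (sliceR A H.ε ∘ₗ H.E.left)).flip

/-- `⊓ᴿ(a) = (𝕄(A) ⊗ ε)[(1 ⊗ a)E]`, the multiplier with `b ⊓ᴿ(a) = (A ⊗ ε)((b ⊗ a)E)`. -/
noncomputable def piR : A →ₗ[k] Multiplier k A :=
  corestrict (rightPart k A) (TensorProduct.curry (sliceR A H.ε ∘ₗ H.E.right)).flip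

/-- `⊓̄ᴸ(a) = (ε ⊗ 𝕄(A))[(a ⊗ 1)E]`, the multiplier with `b ⊓̄ᴸ(a) = (ε ⊗ A)((a ⊗ b)E)`. -/
noncomputable def piBarL : A →ₗ[k] Multiplier k A :=
  corestrict (rightPart k A) (TensorProduct.curry (sliceL A H.ε ∘ₗ H.E.right))

/-- The base algebra `R`, the range of `⊓ᴿ`. It is equal to the range of `⊓̄ᴿ` if the
comultiplication is right full. -/
noncomputable def base : Submodule k (Multiplier k A) := LinearMap.range H.piR

/-- `⊓ᴿ` as a map onto `R`. -/
noncomputable def piR' : A →ₗ[k] H.base := H.piR.rangeRestrict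

/-- `⊓̄ᴿ` as a map onto `R`. -/
noncomputable def piBarR' : A →ₗ[k] H.base := corestrict H.base.subtype H.piBarR

/-- `τ : R → 𝕄(A)`, `⊓ᴿ(a) ↦ ⊓̄ᴸ(a)`. -/
noncomputable def tau : H.base →ₗ[k] Multiplier k A := descend H.piR' H.piBarL

/-! ### Left and right actions of the base algebra, and the tensor product over it -/

/-- A right and a left action of the vector space `R` on a vector space. -/
structure BaseAction (V : Type u) [AddCommGroup V] [Module k V] where
  /-- `v ⊗ r ↦ v r` -/
  right : V ⊗[k] H.base →ₗ[k] V
  /-- `r ⊗ v ↦ r v` -/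
  left : H.base ⊗[k] V →ₗ[k] V

variable {H}
variable {V : Type u} [AddCommGroup V] [Module k V] {W : Type u} [AddCommGroup W] [Module k W]
  {V' : Type u} [AddCommGroup V'] [Module k V'] {W' : Type u} [AddCommGroup W'] [Module k W']
  {Z : Type u} [AddCommGroup Z] [Module k Z]
  {M : Type u} [AddCommGroup M] [Module k M] {N : Type u} [AddCommGroup N] [Module k N]

/-- The subspace of `V ⊗ W` spanned by the elements `v r ⊗ w - v ⊗ r w`. -/
def balancing (bV : H.BaseAction V) (bW : H.BaseAction W) : Submodule k (V ⊗[k] W) :=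
  Submodule.span k {x | ∃ (v : V) (r : H.base) (w : W),
    x = bV.right (v ⊗ₜ[k] r) ⊗ₜ[k] w - v ⊗ₜ[k] bW.left (r ⊗ₜ[k] w)}

/-- The tensor product `V ⊗_R W`. -/
abbrev TensorR (bV : H.BaseAction V) (bW : H.BaseAction W) : Type u :=
  (V ⊗[k] W) ⧸ balancing bV bW

/-- The canonical epimorphism `π : V ⊗ W → V ⊗_R W`. -/
noncomputable def proj (bV : H.BaseAction V) (bW : H.BaseAction W) :
    V ⊗[k] W →ₗ[k] TensorR bV bW :=
  (balancing bV bW).mkQ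

/-- `f ⊗_R g`, given by `v ⊗_R w ↦ f v ⊗_R g w`. -/
noncomputable def mapR (bV : H.BaseAction V) (bW : H.BaseAction W)
    (bV' : H.BaseAction V') (bW' : H.BaseAction W') (f : V →ₗ[k] V') (g : W →ₗ[k] W') :
    TensorR bV bW →ₗ[k] TensorR bV' bW' :=
  descend (proj bV bW) (proj bV' bW' ∘ₗ TensorProduct.map f g)

/-- The associativity constraint `(V ⊗_R W) ⊗_R Z → V ⊗_R (W ⊗_R Z)`. -/
noncomputable def assocR (bV : H.BaseAction V) (bW : H.BaseAction W) (bZ : H.BaseAction Z)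
    (bVW : H.BaseAction (TensorR bV bW)) (bWZ : H.BaseAction (TensorR bW bZ)) :
    TensorR bVW bZ →ₗ[k] TensorR bV bWZ :=
  descend (proj bVW bZ ∘ₗ (proj bV bW).rTensor Z)
    (proj bV bWZ ∘ₗ (proj bW bZ).lTensor V ∘ₗ (TensorProduct.assoc k V W Z).toLinearMap)

/-- The inverse associativity constraint `V ⊗_R (W ⊗_R Z) → (V ⊗_R W) ⊗_R Z`. -/
noncomputable def assocRInv (bV : H.BaseAction V) (bW : H.BaseAction W) (bZ : H.BaseAction Z)
    (bVW : H.BaseAction (TensorR bV bW)) (bWZ : H.BaseAction (TensorR bW bZ)) :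
    TensorR bV bWZ →ₗ[k] TensorR bVW bZ :=
  descend (proj bV bWZ ∘ₗ (proj bW bZ).lTensor V)
    (proj bVW bZ ∘ₗ (proj bV bW).rTensor Z ∘ₗ (TensorProduct.assoc k V W Z).symm.toLinearMap)

end RegularWMB

/-! ### Modules -/

section Modules

variable {k : Type v} [Field k] {A : Type u} [NonUnitalRing A]
    [Module k A] [IsScalarTower k A A] [SMulCommClass k A A]
  {V : Type u} [AddCommGroup V] [Module k V] {W : Type u} [AddCommGroup W] [Module k W]

/-- `act : V ⊗ A → V` makes `V` an idempotent non-degenerate (associative) right `A`-module. -/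
structure IsIdempotentNondegenerateModule (act : V ⊗[k] A →ₗ[k] V) : Prop where
  assoc : ∀ (v : V) (a b : A), act (v ⊗ₜ[k] (a * b)) = act (act (v ⊗ₜ[k] a) ⊗ₜ[k] b)
  idempotent : Function.Surjective act
  nondegenerate : ∀ v : V, (∀ a : A, act (v ⊗ₜ[k] a) = 0) → v = 0

/-- Morphisms of right `A`-modules. -/
def IsModuleMap (actV : V ⊗[k] A →ₗ[k] V) (actW : W ⊗[k] A →ₗ[k] W) (f : V →ₗ[k] W) : Prop :=
  ∀ (v : V) (a : A), f (actV (v ⊗ₜ[k] a)) = actW (f v ⊗ₜ[k] a)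

/-- The action of multipliers on an idempotent non-degenerate right module over the algebra `A`,
given by `(v·a)·w = v·(a w)`. -/
noncomputable def multiplierAction (act : V ⊗[k] A →ₗ[k] V) :
    V ⊗[k] Multiplier k A →ₗ[k] V :=
  descend (act.rTensor (Multiplier k A))
    (act ∘ₗ (TensorProduct.lift (rightPart k A).flip).lTensor V ∘ₗ
      (TensorProduct.assoc k V A (Multiplier k A)).toLinearMap)

/-- `V ⊗ W` as a right `A ⊗ A`-module, `(v ⊗ w)·(a ⊗ b) = v·a ⊗ w·b`. -/
noncomputable def externalAction (actV : V ⊗[k] A →ₗ[k] V) (actW : W ⊗[k] A →ₗ[k] W) :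
    (V ⊗[k] W) ⊗[k] (A ⊗[k] A) →ₗ[k] V ⊗[k] W :=
  TensorProduct.map actV actW ∘ₗ (TensorProduct.tensorTensorTensorComm k V W A A).toLinearMap

end Modules

namespace RegularWMB

section ModuleConstructions

variable {k : Type v} [Field k] {A : Type u} [NonUnitalRing A]
    [Module k A] [IsScalarTower k A A] [SMulCommClass k A A] (H : RegularWMB k A)
  {V : Type u} [AddCommGroup V] [Module k V] {W : Type u} [AddCommGroup W] [Module k W]

/-- The `R`-actions on a module: `(v·a) r = v·(a r)` and `r (v·a) = v·(a τ(r))`. -/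
noncomputable def moduleBaseAction (act : V ⊗[k] A →ₗ[k] V) : H.BaseAction V where
  right := multiplierAction act ∘ₗ H.base.subtype.lTensor V
  left := multiplierAction act ∘ₗ H.tau.lTensor V ∘ₗ tw H.base V

/-- `E₂^{V,W} : V ⊗ W → V ⊗ W`, `v·a ⊗ w·b ↦ (v·(-) ⊗ w·(-))[(a ⊗ b)E]`. -/
noncomputable def E₂ (actV : V ⊗[k] A →ₗ[k] V) (actW : W ⊗[k] A →ₗ[k] W) :
    V ⊗[k] W →ₗ[k] V ⊗[k] W :=
  multiplierAction (externalAction actV actW) ∘ₗ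
    (TensorProduct.mk k (V ⊗[k] W) (Multiplier k (A ⊗[k] A))).flip H.E

/-- The diagonal action `(v·a ⊗ w·b)·c = (v·(-) ⊗ w·(-))[(a ⊗ b)Δ(c)]` on `V ⊗ W`; also
written as `(v ⊗ w)Δ(c)`. -/
noncomputable def diagonalAction (actV : V ⊗[k] A →ₗ[k] V) (actW : W ⊗[k] A →ₗ[k] W) :
    (V ⊗[k] W) ⊗[k] A →ₗ[k] V ⊗[k] W :=
  multiplierAction (externalAction actV actW) ∘ₗ H.Δ.lTensor (V ⊗[k] W)

/-- `(v ⊗ w)Δᵒᵖ(c) = tw[(w ⊗ v)·c]`. -/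
noncomputable def diagonalActionOp (actV : V ⊗[k] A →ₗ[k] V) (actW : W ⊗[k] A →ₗ[k] W) :
    (V ⊗[k] W) ⊗[k] A →ₗ[k] V ⊗[k] W :=
  tw W V ∘ₗ H.diagonalAction actW actV ∘ₗ (tw V W).rTensor A

variable {H}

/-- The right `A`-action on `V ⊗_R W`, induced by the diagonal action. -/
noncomputable def tensorAct (bV : H.BaseAction V) (bW : H.BaseAction W)
    (actV : V ⊗[k] A →ₗ[k] V) (actW : W ⊗[k] A →ₗ[k] W) :
    TensorR bV bW ⊗[k] A →ₗ[k] TensorR bV bW :=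
  descend ((proj bV bW).rTensor A) (proj bV bW ∘ₗ H.diagonalAction actV actW)

variable (H)

/-- The right `A`-action `r·a = ⊓ᴿ(r a)` on `R`. -/
noncomputable def baseAct : H.base ⊗[k] A →ₗ[k] H.base :=
  H.piR' ∘ₗ TensorProduct.lift (leftPart k A ∘ₗ H.base.subtype)

end ModuleConstructions

/-! ### Comodules -/

section Comodules

variable {k : Type v} [Field k] {A : Type u} [NonUnitalRing A]
    [Module k A] [IsScalarTower k A A] [SMulCommClass k A A] (H : RegularWMB k A)
  {M : Type u} [AddCommGroup M] [Module k M] {N : Type u} [AddCommGroup N] [Module k N]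

/-- `(M, lam, rho)` is a right `A`-comodule which is full. -/
structure IsFullComodule (lam rho : M ⊗[k] A →ₗ[k] M ⊗[k] A) : Prop where
  /-- `(1 ⊗ a) λ(m ⊗ b) = ϱ(m ⊗ a)(1 ⊗ b)` -/
  compat : ∀ (m : M) (a b : A),
    (LinearMap.mulLeft k a).lTensor M (lam (m ⊗ₜ[k] b)) =
      (LinearMap.mulRight k b).lTensor M (rho (m ⊗ₜ[k] a))
  /-- `(λ ⊗ A) λ¹³ (M ⊗ T₁) = (M ⊗ T₁)(λ ⊗ A)` -/
  coassoc : lam.rTensor A ∘ₗ leg13 A lam ∘ₗ leg23 M H.T₁ = leg23 M H.T₁ ∘ₗ lam.rTensor A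
  /-- `(λ ⊗ A) λ¹³ (M ⊗ E₁) = (λ ⊗ A) λ¹³` -/
  normalized : lam.rTensor A ∘ₗ leg13 A lam ∘ₗ leg23 M H.E.left = lam.rTensor A ∘ₗ leg13 A lam
  /-- `⟨(M ⊗ ω) λ(m ⊗ a)⟩ = M` or (equivalently) `⟨(M ⊗ ω) ϱ(m ⊗ a)⟩ = M` -/
  full :
    Submodule.span k {x | ∃ (ω : A →ₗ[k] k) (m : M) (a : A),
      x = sliceR M ω (lam (m ⊗ₜ[k] a))} = ⊤ ∨
    Submodule.span k {x | ∃ (ω : A →ₗ[k] k) (m : M) (a : A),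
      x = sliceR M ω (rho (m ⊗ₜ[k] a))} = ⊤

/-- Morphisms of comodules: `(f ⊗ A) λ = λ' (f ⊗ A)`. -/
def IsComoduleMap (lamM : M ⊗[k] A →ₗ[k] M ⊗[k] A) (lamN : N ⊗[k] A →ₗ[k] N ⊗[k] A)
    (f : M →ₗ[k] N) : Prop :=
  f.rTensor A ∘ₗ lamM = lamN ∘ₗ f.rTensor A

/-- The `R`-actions on a full comodule:
`m ⊓̄ᴿ(a) = (M ⊗ ε) λ(m ⊗ a)` and `⊓ᴿ(a) m = (M ⊗ ε) ϱ(m ⊗ a)`. -/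
noncomputable def comoduleBaseAction (lam rho : M ⊗[k] A →ₗ[k] M ⊗[k] A) : H.BaseAction M where
  right := descend (H.piBarR'.lTensor M) (sliceR M H.ε ∘ₗ lam)
  left := descend (H.piR'.rTensor M) (sliceR M H.ε ∘ₗ rho ∘ₗ tw A M)

variable {H}

/-- `λ` on `M ⊗_R N`, induced by `λ_M¹³ (M ⊗ λ_N)`. -/
noncomputable def tensorLam (bM : H.BaseAction M) (bN : H.BaseAction N)
    (lamM : M ⊗[k] A →ₗ[k] M ⊗[k] A) (lamN : N ⊗[k] A →ₗ[k] N ⊗[k] A) :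
    TensorR bM bN ⊗[k] A →ₗ[k] TensorR bM bN ⊗[k] A :=
  descend ((proj bM bN).rTensor A) ((proj bM bN).rTensor A ∘ₗ leg13 N lamM ∘ₗ leg23 M lamN)

/-- `ϱ` on `M ⊗_R N`, induced by `(M ⊗ ϱ_N) ϱ_M¹³`. -/
noncomputable def tensorRho (bM : H.BaseAction M) (bN : H.BaseAction N)
    (rhoM : M ⊗[k] A →ₗ[k] M ⊗[k] A) (rhoN : N ⊗[k] A →ₗ[k] N ⊗[k] A) :
    TensorR bM bN ⊗[k] A →ₗ[k] TensorR bM bN ⊗[k] A :=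
  descend ((proj bM bN).rTensor A) ((proj bM bN).rTensor A ∘ₗ leg23 M rhoN ∘ₗ leg13 N rhoM)

variable (H)

/-- The injection of `R ⊗ A` to `Lin(A, A ⊗ A)`, sending `r ⊗ a` to `c ↦ r c ⊗ a`. -/
noncomputable def evalLeft : H.base ⊗[k] A →ₗ[k] (A →ₗ[k] A ⊗[k] A) :=
  TensorProduct.lift (LinearMap.mk₂ k
    (fun (r : H.base) (a : A) => (TensorProduct.mk k A A).flip a ∘ₗ leftPart k A r.1)
    (fun r s a => by ext c; simp)
    (fun t r a => by ext c; simp [TensorProduct.smul_tmul'])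
    (fun r a b => by ext c; simp)
    (fun t r a => by ext c; simp))

/-- The injection of `R ⊗ A` to `Lin(A, A ⊗ A)`, sending `r ⊗ a` to `c ↦ c r ⊗ a`. -/
noncomputable def evalRight : H.base ⊗[k] A →ₗ[k] (A →ₗ[k] A ⊗[k] A) :=
  TensorProduct.lift (LinearMap.mk₂ k
    (fun (r : H.base) (a : A) => (TensorProduct.mk k A A).flip a ∘ₗ rightPart k A r.1)
    (fun r s a => by ext c; simp)
    (fun t r a => by ext c; simp [TensorProduct.smul_tmul'])
    (fun r a b => by ext c; simp)
    (fun t r a => by ext c; simp))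

/-- `λ` on `R`: the element `λ(r ⊗ a) = E(1 ⊗ r a)` of `R ⊗ A`. -/
noncomputable def baseLam : H.base ⊗[k] A →ₗ[k] H.base ⊗[k] A :=
  corestrict H.evalLeft ((TensorProduct.curry H.E.left).flip ∘ₗ
    TensorProduct.lift (leftPart k A ∘ₗ H.base.subtype))

/-- `ϱ` on `R`: the element `ϱ(r ⊗ a) = (1 ⊗ a r)E` of `R ⊗ A`. -/
noncomputable def baseRho : H.base ⊗[k] A →ₗ[k] H.base ⊗[k] A :=
  corestrict H.evalRight ((TensorProduct.curry H.E.right).flip ∘ₗ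
    TensorProduct.lift (rightPart k A ∘ₗ H.base.subtype))

end Comodules

/-! ### The maps `φ` and `φ̂` -/

section Phi

variable {k : Type v} [Field k] {A : Type u} [NonUnitalRing A]
    [Module k A] [IsScalarTower k A A] [SMulCommClass k A A] {H : RegularWMB k A}
  {V : Type u} [AddCommGroup V] [Module k V] {M : Type u} [AddCommGroup M] [Module k M]

/-- `φ_{V,M} : V ⊗ M → M ⊗ V`, `v·a ⊗ m ↦ (M ⊗ v·(-)) ϱ(m ⊗ a)`. -/
noncomputable def phi (act : V ⊗[k] A →ₗ[k] V) (rho : M ⊗[k] A →ₗ[k] M ⊗[k] A) :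
    V ⊗[k] M →ₗ[k] M ⊗[k] V :=
  descend (act.rTensor M)
    (act.lTensor M ∘ₗ (TensorProduct.leftComm k V M A).toLinearMap ∘ₗ
      rho.lTensor V ∘ₗ (tw A M).lTensor V ∘ₗ (TensorProduct.assoc k V A M).toLinearMap)

/-- `φ̂_{V,M} : V ⊗_R M → M ⊗_R V`, the map with `φ̂_{V,M} π_{V,M} = π_{M,V} φ_{V,M}`. -/
noncomputable def phiHat (act : V ⊗[k] A →ₗ[k] V) (rho : M ⊗[k] A →ₗ[k] M ⊗[k] A)
    (bV : H.BaseAction V) (bM : H.BaseAction M) : TensorR bV bM →ₗ[k] TensorR bM bV :=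
  descend (proj bV bM) (proj bM bV ∘ₗ phi act rho)

end Phi

end RegularWMB

/-! ### The monoidal categories of modules and of comodules, and their weak centers -/

section Centers

/-- A vector space with a linear map `V ⊗ A → V`. -/
structure ModuleData (k : Type v) [Field k] (A : Type u) [NonUnitalRing A] [Module k A] where
  carrier : Type u
  [addCommGroup : AddCommGroup carrier]
  [module : Module k carrier]
  act : carrier ⊗[k] A →ₗ[k] carrier

/-- A vector space with two linear maps `M ⊗ A → M ⊗ A`. -/
structure ComoduleData (k : Type v) [Field k] (A : Type u) [NonUnitalRing A] [Module k A] where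
  carrier : Type u
  [addCommGroup : AddCommGroup carrier]
  [module : Module k carrier]
  lam : carrier ⊗[k] A →ₗ[k] carrier ⊗[k] A
  rho : carrier ⊗[k] A →ₗ[k] carrier ⊗[k] A

attribute [instance] ModuleData.addCommGroup ModuleData.module
attribute [instance] ComoduleData.addCommGroup ComoduleData.module

variable {k : Type v} [Field k] {A : Type u} [NonUnitalRing A]
    [Module k A] [IsScalarTower k A A] [SMulCommClass k A A] (H : RegularWMB k A)

/-- The objects of the category `𝖬_(A)`: idempotent non-degenerate right `A`-modules. -/
def ModuleData.IsObject (V : ModuleData k A) : Prop := IsIdempotentNondegenerateModule V.act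

/-- The `R`-actions on a module. -/
noncomputable abbrev ModuleData.base (V : ModuleData k A) : H.BaseAction V.carrier :=
  H.moduleBaseAction V.act

/-- The monoidal product of `𝖬_(A)`. -/
noncomputable abbrev ModuleData.tensor (V W : ModuleData k A) : ModuleData k A where
  carrier := RegularWMB.TensorR (V.base H) (W.base H)
  act := RegularWMB.tensorAct (V.base H) (W.base H) V.act W.act

/-- The monoidal unit of `𝖬_(A)`. -/
noncomputable abbrev ModuleData.unit : ModuleData k A where
  carrier := H.base
  act := H.baseAct

/-- The objects of the category `𝖬^(A)`: full right `A`-comodules. -/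
def ComoduleData.IsObject (M : ComoduleData k A) : Prop := H.IsFullComodule M.lam M.rho

/-- The `R`-actions on a comodule. -/
noncomputable abbrev ComoduleData.base (M : ComoduleData k A) : H.BaseAction M.carrier :=
  H.comoduleBaseAction M.lam M.rho

/-- The monoidal product of `𝖬^(A)`. -/
noncomputable abbrev ComoduleData.tensor (M N : ComoduleData k A) : ComoduleData k A where
  carrier := RegularWMB.TensorR (M.base H) (N.base H)
  lam := RegularWMB.tensorLam (M.base H) (N.base H) M.lam N.lam
  rho := RegularWMB.tensorRho (M.base H) (N.base H) M.rho N.rho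

/-- The monoidal unit of `𝖬^(A)`. -/
noncomputable abbrev ComoduleData.unit : ComoduleData k A where
  carrier := H.base
  lam := H.baseLam
  rho := H.baseRho

/-- `(Q, θ)` is an object of the left weak center of `𝖬^(A)`: `Q` is an object of `𝖬^(A)` and
`θ_M : Q ⊗_R M → M ⊗_R Q` is a natural family of morphisms in `𝖬^(A)`, compatible with the
monoidal structure. (Only the values of `θ` on objects of `𝖬^(A)` matter.) -/
structure IsLeftWeakCenterObject (Q : ComoduleData k A)
    (θ : ∀ M : ComoduleData k A, (Q.tensor H M).carrier →ₗ[k] (M.tensor H Q).carrier) : Prop where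
  isObject : Q.IsObject H
  /-- `θ_M` is a comodule map -/
  isMap : ∀ M : ComoduleData k A, M.IsObject H →
    RegularWMB.IsComoduleMap (Q.tensor H M).lam (M.tensor H Q).lam (θ M)
  /-- `θ_N (Q ⊗_R f) = (f ⊗_R Q) θ_M` -/
  natural : ∀ M N : ComoduleData k A, M.IsObject H → N.IsObject H →
    ∀ f : M.carrier →ₗ[k] N.carrier, RegularWMB.IsComoduleMap M.lam N.lam f →
      θ N ∘ₗ RegularWMB.mapR (Q.base H) (M.base H) (Q.base H) (N.base H) LinearMap.id f =
        RegularWMB.mapR (M.base H) (Q.base H) (N.base H) (Q.base H) f LinearMap.id ∘ₗ θ M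
  /-- `θ_R (s q ⊗_R r) = s ⊗_R q r` -/
  unit : ∀ (q : Q.carrier) (r s : H.base),
    θ (ComoduleData.unit H) (RegularWMB.proj (Q.base H) ((ComoduleData.unit H).base H)
        ((Q.base H).left (s ⊗ₜ[k] q) ⊗ₜ[k] r)) =
      RegularWMB.proj ((ComoduleData.unit H).base H) (Q.base H)
        (s ⊗ₜ[k] (Q.base H).right (q ⊗ₜ[k] r))
  /-- `θ_{M ⊗_R N} = (M ⊗_R θ_N)(θ_M ⊗_R N)`, up to the associativity constraints -/
  tensor : ∀ M N : ComoduleData k A, M.IsObject H → N.IsObject H →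
    θ (M.tensor H N) =
      RegularWMB.assocRInv (M.base H) (N.base H) (Q.base H)
          ((M.tensor H N).base H) ((N.tensor H Q).base H) ∘ₗ
        RegularWMB.mapR (M.base H) ((Q.tensor H N).base H) (M.base H) ((N.tensor H Q).base H)
          LinearMap.id (θ N) ∘ₗ
        RegularWMB.assocR (M.base H) (Q.base H) (N.base H)
          ((M.tensor H Q).base H) ((Q.tensor H N).base H) ∘ₗ
        RegularWMB.mapR ((Q.tensor H M).base H) (N.base H) ((M.tensor H Q).base H) (N.base H)
          (θ M) LinearMap.id ∘ₗ
        RegularWMB.assocRInv (Q.base H) (M.base H) (N.base H)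
          ((Q.tensor H M).base H) ((M.tensor H N).base H)

/-- `(P, σ)` is an object of the right weak center of `𝖬_(A)`: `P` is an object of `𝖬_(A)` and
`σ_V : V ⊗_R P → P ⊗_R V` is a natural family of morphisms in `𝖬_(A)`, compatible with the
monoidal structure. (Only the values of `σ` on objects of `𝖬_(A)` matter.) -/
structure IsRightWeakCenterObject (P : ModuleData k A)
    (σ : ∀ V : ModuleData k A, (V.tensor H P).carrier →ₗ[k] (P.tensor H V).carrier) : Prop where
  isObject : P.IsObject
  /-- `σ_V` is a module map -/
  isMap : ∀ V : ModuleData k A, V.IsObject →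
    IsModuleMap (V.tensor H P).act (P.tensor H V).act (σ V)
  /-- `σ_W (g ⊗_R P) = (P ⊗_R g) σ_V` -/
  natural : ∀ V W : ModuleData k A, V.IsObject → W.IsObject →
    ∀ g : V.carrier →ₗ[k] W.carrier, IsModuleMap V.act W.act g →
      σ W ∘ₗ RegularWMB.mapR (V.base H) (P.base H) (W.base H) (P.base H) g LinearMap.id =
        RegularWMB.mapR (P.base H) (V.base H) (P.base H) (W.base H) LinearMap.id g ∘ₗ σ V
  /-- `σ_R (r ⊗_R p s) = r p ⊗_R s` -/
  unit : ∀ (p : P.carrier) (r s : H.base),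
    σ (ModuleData.unit H) (RegularWMB.proj ((ModuleData.unit H).base H) (P.base H)
        (r ⊗ₜ[k] (P.base H).right (p ⊗ₜ[k] s))) =
      RegularWMB.proj (P.base H) ((ModuleData.unit H).base H)
        ((P.base H).left (r ⊗ₜ[k] p) ⊗ₜ[k] s)
  /-- `σ_{V ⊗_R W} = (σ_V ⊗_R W)(V ⊗_R σ_W)`, up to the associativity constraints -/
  tensor : ∀ V W : ModuleData k A, V.IsObject → W.IsObject →
    σ (V.tensor H W) =
      RegularWMB.assocR (P.base H) (V.base H) (W.base H)
          ((P.tensor H V).base H) ((V.tensor H W).base H) ∘ₗ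
        RegularWMB.mapR ((V.tensor H P).base H) (W.base H) ((P.tensor H V).base H) (W.base H)
          (σ V) LinearMap.id ∘ₗ
        RegularWMB.assocRInv (V.base H) (P.base H) (W.base H)
          ((V.tensor H P).base H) ((P.tensor H W).base H) ∘ₗ
        RegularWMB.mapR (V.base H) ((W.tensor H P).base H) (V.base H) ((P.tensor H W).base H)
          LinearMap.id (σ W) ∘ₗ
        RegularWMB.assocR (V.base H) (W.base H) (P.base H)
          ((V.tensor H W).base H) ((W.tensor H P).base H)

end Centers

end WMB

/-!
Sweedler notation is used for the coactions, `λ(m ⊗ a) = m₀ ⊗ m₁ a` and `ϱ(m ⊗ a) = m₀ ⊗ a m₁`, and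
for the comultiplication. The iterated map `(λ ⊗ A)λ¹³` then sends `m ⊗ y` to `m₀ ⊗ Δ(m₁)y`.

The theorem rests on one computation. Let `φ₂ : (V ⊗ W) ⊗ M → M ⊗ (V ⊗ W)` be the composite of
`V ⊗ φ_{W,M}` and `φ_{V,M} ⊗ W`. The characterization `φ_{V,M}(v ⊗ m)·b = m₀ ⊗ v·(m₁ b)`
(`actBy_phi`) gives `φ₂(z ⊗ m)·y = m₀ ⊗ z·(Δ(m₁)y)`, and hence `φ₂(z·Δ(g) ⊗ m) = m₀ ⊗ z·Δ(g m₁)`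
and `φ₂(E₂ z ⊗ m) = φ₂(z ⊗ m)` (`phi₂_diagonalAction`, `phi₂_E₂`).

* By `mulLeft_phi_lamAt` and `mulLeft_lamAt_phi`, the map `φ̂_{X,M}` is a comodule map if and only if
  `φ₂(ϱ(x ⊗ c) ⊗ m)` and `(M ⊗ ϱ)φ₂(c ⊗ x ⊗ m)` agree modulo the balancing relations
  (`isComoduleMap_phiHat_iff`). If `ϱ` is compatible with the diagonal actions, both are
  `m₀ ⊗ ϱ(z)Δ(g m₁)` on the elements `zΔ(g)`, and `ϱ = ϱ E₂²¹` reduces everything to such elements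
  (`phi₂_rho`). Conversely, for `M = A`, applying `b ⊗_R x ↦ ⊓ᴿ(b)x` to the first two legs recovers
  the compatibility of `ϱ`, as this map sends `φ̂_{X,A}(x ⊗ a)` to `x·a` (`rho_diagonalActionOp`).
* Since `φ_{A,X}` is `ϱ` up to the flip, the compatibility of `ϱ` says that `φ_{A,X}` preserves the
  diagonal actions. By the naturality of `φ` along the module maps `a ↦ v·a` it passes to all `V`
  (`phi_diagonalAction`). In the converse direction nothing is lost by passing to `A ⊗_R X` and
  `X ⊗_R A`, because `V ⊗_R W` is the range of `E₂` (`proj_eq_zero_iff`) and `E₂ϱ = ϱ`.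
* The families `φ̂` are always natural and compatible with the monoidal structures
  (`phiHat_tensorRho`, `phiHat_tensorAct`, `proj_phi_baseRho`, `proj_phi_baseAct`), so membership in
  the weak centers amounts to the maps being morphisms.

The weak multiplier bialgebra enters through properties of `E`: the presentations
`E(1 ⊗ a b) = ⊓̄ᴿ(a₁) ⊗ a₂ b` and `(1 ⊗ b a)E = ⊓ᴿ(a₁) ⊗ b a₂` (`rTensor_piBarRl_T₁`,
`rTensor_piRr_T₃`), which also show that `⊓ᴿ` and `⊓̄ᴿ` have the same range, the relation
`(r ⊗ 1)E = (1 ⊗ τ(r))E` (`E_right_right`), and the local units in `⊓ᴸ(A)`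
(`exists_forall_piLl_eq_self`), by which the elements of a full comodule are determined by their
coaction (`IsFullComodule.eq_of_lam`). Most identities come in pairs interchanging left and right;
the second one is the first one for the opposite algebra (`op`).
-/

set_option linter.unusedSectionVars false

namespace WMB

/-! ### Linear algebra -/

section LinearAlgebra

variable {k : Type v} [Field k]
variable {P : Type*} [AddCommGroup P] [Module k P] {Q : Type*} [AddCommGroup Q] [Module k Q]
  {S : Type*} [AddCommGroup S] [Module k S]

theorem descend_apply {p : P →ₗ[k] Q} {g : P →ₗ[k] S} (h : LinearMap.ker p ≤ LinearMap.ker g)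
    (x : P) : descend p g (p x) = g x :=
  LinearMap.congr_fun (descend_comp h) x

theorem corestrict_eq_of_comp {i : Q →ₗ[k] S} {g : P →ₗ[k] S} (hi : Function.Injective i)
    {f : P →ₗ[k] Q} (h : i ∘ₗ f = g) : corestrict i g = f := by
  have hr : LinearMap.range g ≤ LinearMap.range i := by
    rw [← h]
    exact LinearMap.range_comp_le_range _ _
  refine LinearMap.ext fun y => hi ?_
  rw [← LinearMap.comp_apply, corestrict_comp hr, ← h, LinearMap.comp_apply]

variable {M : Type*} [AddCommGroup M] [Module k M] {B : Type*} [AddCommGroup B] [Module k B]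
  {A : Type*} [AddCommGroup A] [Module k A] {N : Type*} [AddCommGroup N] [Module k N]

@[simp] theorem sliceR_tmul (ω : A →ₗ[k] k) (m : M) (a : A) :
    sliceR M ω (m ⊗ₜ[k] a) = ω a • m := by
  simp [sliceR]

@[simp] theorem sliceL_tmul (ω : A →ₗ[k] k) (a : A) (m : M) :
    sliceL M ω (a ⊗ₜ[k] m) = ω a • m := by
  simp [sliceL]

@[simp] theorem tw_tmul (p : P) (q : Q) : tw (k := k) P Q (p ⊗ₜ[k] q) = q ⊗ₜ[k] p := by
  simp [tw]

theorem tw_tw (z : P ⊗[k] Q) : tw Q P (tw P Q z) = z := by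
  induction z with
  | zero => simp
  | tmul x y => simp
  | add x y hx hy => simp [hx, hy]

/-- Over a field, a family of maps separating the elements of `N` also separates the elements of
`M ⊗ N`. -/
theorem eq_zero_of_lTensor {ι : Sort*} {N' : Type*} [AddCommGroup N'] [Module k N']
    (f : ι → N →ₗ[k] N') (hf : ∀ n, (∀ i, f i n = 0) → n = 0) (z : M ⊗[k] N)
    (hz : ∀ i, (f i).lTensor M z = 0) : z = 0 := by
  classical
  let b := Module.Basis.ofVectorSpace k M
  have key : ∀ (i : ι) (y : M ⊗[k] N) (j),
      TensorProduct.equivFinsuppOfBasisLeft (N := N') b ((f i).lTensor M y) j =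
        f i (TensorProduct.equivFinsuppOfBasisLeft (N := N) b y j) := by
    intro i y j
    induction y with
    | zero => simp
    | tmul x y => simp
    | add x y hx hy => simp only [map_add, Finsupp.add_apply, hx, hy]
  apply (TensorProduct.equivFinsuppOfBasisLeft (N := N) b).injective
  rw [map_zero]
  ext j
  refine hf _ fun i => ?_
  rw [← key, hz, map_zero, Finsupp.zero_apply]

theorem eq_of_lTensor {ι : Sort*} {N' : Type*} [AddCommGroup N'] [Module k N']
    (f : ι → N →ₗ[k] N') (hf : ∀ n, (∀ i, f i n = 0) → n = 0) {z z' : M ⊗[k] N}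
    (hz : ∀ i, (f i).lTensor M z = (f i).lTensor M z') : z = z' := by
  rw [← sub_eq_zero]
  refine eq_zero_of_lTensor f hf _ fun i => ?_
  rw [map_sub, hz, sub_self]

theorem eq_zero_of_rTensor {ι : Sort*} {N' : Type*} [AddCommGroup N'] [Module k N']
    (f : ι → N →ₗ[k] N') (hf : ∀ n, (∀ i, f i n = 0) → n = 0) (z : N ⊗[k] M)
    (hz : ∀ i, (f i).rTensor M z = 0) : z = 0 := by
  have : TensorProduct.comm k N M z = 0 := by
    refine eq_zero_of_lTensor f hf _ fun i => ?_
    have h : (f i).lTensor M (TensorProduct.comm k N M z) =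
        TensorProduct.comm k N' M ((f i).rTensor M z) := by
      clear hz
      induction z with
      | zero => simp
      | tmul x y => simp
      | add x y hx hy => simp only [map_add, hx, hy]
    rw [h, hz, map_zero]
  simpa using this

theorem eq_of_rTensor {ι : Sort*} {N' : Type*} [AddCommGroup N'] [Module k N']
    (f : ι → N →ₗ[k] N') (hf : ∀ n, (∀ i, f i n = 0) → n = 0) {z z' : N ⊗[k] M}
    (hz : ∀ i, (f i).rTensor M z = (f i).rTensor M z') : z = z' := by
  rw [← sub_eq_zero]
  refine eq_zero_of_rTensor f hf _ fun i => ?_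
  rw [map_sub, hz, sub_self]

/-- Over a field, the kernel of `f ⊗ M` is `ker f ⊗ M`. -/
theorem ker_rTensor_le {f : P →ₗ[k] Q} {g : P ⊗[k] M →ₗ[k] S}
    (h : ∀ x, f x = 0 → ∀ m, g (x ⊗ₜ[k] m) = 0) :
    LinearMap.ker (f.rTensor M) ≤ LinearMap.ker g := by
  intro z hz
  have hex : Function.Exact (LinearMap.ker f).subtype f :=
    fun x => by simp [LinearMap.mem_ker]
  obtain ⟨y, rfl⟩ := (Module.Flat.rTensor_exact M hex z).1 hz
  rw [LinearMap.mem_ker]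
  clear hz
  induction y with
  | zero => simp
  | tmul x m => simpa using h _ x.2 m
  | add x y hx hy => simp only [map_add, hx, hy, add_zero]

theorem ker_lTensor_le {f : P →ₗ[k] Q} {g : M ⊗[k] P →ₗ[k] S}
    (h : ∀ x, f x = 0 → ∀ m, g (m ⊗ₜ[k] x) = 0) :
    LinearMap.ker (f.lTensor M) ≤ LinearMap.ker g := by
  intro z hz
  have hex : Function.Exact (LinearMap.ker f).subtype f :=
    fun x => by simp [LinearMap.mem_ker]
  obtain ⟨y, rfl⟩ := (Module.Flat.lTensor_exact M hex z).1 hz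
  rw [LinearMap.mem_ker]
  clear hz
  induction y with
  | zero => simp
  | tmul m x => simpa using h _ x.2 m
  | add x y hx hy => simp only [map_add, hx, hy, add_zero]

/-! ### Naturality of slices and of the associator -/

theorem sliceR_rTensor (ω : A →ₗ[k] k) (f : M →ₗ[k] N) (z : M ⊗[k] A) :
    sliceR N ω (f.rTensor A z) = f (sliceR M ω z) := by
  induction z with
  | zero => simp
  | tmul x y => simp
  | add x y hx hy => simp only [map_add, hx, hy]

theorem sliceR_lTensor {A' : Type*} [AddCommGroup A'] [Module k A'] (ω : A' →ₗ[k] k)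
    (g : A →ₗ[k] A') (z : M ⊗[k] A) : sliceR M ω (g.lTensor M z) = sliceR M (ω ∘ₗ g) z := by
  induction z with
  | zero => simp
  | tmul x y => simp
  | add x y hx hy => simp only [map_add, hx, hy]

theorem sliceL_rTensor {A' : Type*} [AddCommGroup A'] [Module k A'] (ω : A' →ₗ[k] k)
    (g : A →ₗ[k] A') (z : A ⊗[k] M) : sliceL M ω (g.rTensor M z) = sliceL M (ω ∘ₗ g) z := by
  induction z with
  | zero => simp
  | tmul x y => simp
  | add x y hx hy => simp only [map_add, hx, hy]

theorem apply_sliceL_eq_apply_sliceR (ω : A →ₗ[k] k) (z : A ⊗[k] A) :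
    ω (sliceL A ω z) = ω (sliceR A ω z) := by
  induction z with
  | zero => simp
  | tmul x y => simp [mul_comm]
  | add x y hx hy => simp only [map_add, hx, hy]

theorem sliceL_lTensor (ω : A →ₗ[k] k) (f : M →ₗ[k] N) (z : A ⊗[k] M) :
    sliceL N ω (f.lTensor A z) = f (sliceL M ω z) := by
  induction z with
  | zero => simp
  | tmul x y => simp
  | add x y hx hy => simp only [map_add, hx, hy]

theorem rTensor_lTensor (f : P →ₗ[k] Q) (g : M →ₗ[k] N) (z : P ⊗[k] M) :
    f.rTensor N (g.lTensor P z) = g.lTensor Q (f.rTensor M z) := by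
  induction z with
  | zero => simp
  | tmul x y => simp
  | add x y hx hy => simp only [map_add, hx, hy]

/-- The map `M ⊗ A → M ⊗ (P ⊗ B)` applying `f` to the first leg and `g` to the last one. -/
noncomputable def assocMap (f : M →ₗ[k] N ⊗[k] P) (g : A →ₗ[k] B) :
    M ⊗[k] A →ₗ[k] N ⊗[k] (P ⊗[k] B) :=
  (TensorProduct.assoc k N P B).toLinearMap ∘ₗ TensorProduct.map f g

@[simp] theorem assocMap_tmul (f : M →ₗ[k] N ⊗[k] P) (g : A →ₗ[k] B) (m : M) (a : A) :
    assocMap f g (m ⊗ₜ[k] a) = TensorProduct.assoc k N P B (f m ⊗ₜ[k] g a) := rfl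

theorem map_assoc {N' P' B' : Type*} [AddCommGroup N'] [Module k N'] [AddCommGroup P']
    [Module k P'] [AddCommGroup B'] [Module k B'] (e : N →ₗ[k] N') (f : P →ₗ[k] P')
    (g : B →ₗ[k] B') (z : N ⊗[k] P) (b : B) :
    TensorProduct.map e (TensorProduct.map f g) (TensorProduct.assoc k N P B (z ⊗ₜ[k] b)) =
      TensorProduct.assoc k N' P' B' (TensorProduct.map e f z ⊗ₜ[k] g b) := by
  induction z with
  | zero => simp
  | tmul x y => simp
  | add x y hx hy => simp only [map_add, TensorProduct.add_tmul, hx, hy]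

theorem map_assocMap {N' P' B' : Type*} [AddCommGroup N'] [Module k N'] [AddCommGroup P']
    [Module k P'] [AddCommGroup B'] [Module k B'] (e : N →ₗ[k] N') (f' : P →ₗ[k] P')
    (g' : B →ₗ[k] B') (f : M →ₗ[k] N ⊗[k] P) (g : A →ₗ[k] B) (y : M ⊗[k] A) :
    TensorProduct.map e (TensorProduct.map f' g') (assocMap f g y) =
      assocMap (TensorProduct.map e f' ∘ₗ f) (g' ∘ₗ g) y := by
  induction y with
  | zero => simp
  | tmul x y => simp only [assocMap_tmul, map_assoc, LinearMap.comp_apply]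
  | add x y hx hy => simp only [map_add, hx, hy]

theorem lTensor_map_assocMap {P' B' : Type*} [AddCommGroup P']
    [Module k P'] [AddCommGroup B'] [Module k B'] (f' : P →ₗ[k] P')
    (g' : B →ₗ[k] B') (f : M →ₗ[k] N ⊗[k] P) (g : A →ₗ[k] B) (y : M ⊗[k] A) :
    (TensorProduct.map f' g').lTensor N (assocMap f g y) =
      assocMap (f'.lTensor N ∘ₗ f) (g' ∘ₗ g) y :=
  map_assocMap LinearMap.id f' g' f g y

theorem assocMap_map {M' A' : Type*} [AddCommGroup M'] [Module k M'] [AddCommGroup A']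
    [Module k A'] (f : M →ₗ[k] N ⊗[k] P) (g : A →ₗ[k] B) (f' : M' →ₗ[k] M) (g' : A' →ₗ[k] A)
    (y : M' ⊗[k] A') :
    assocMap f g (TensorProduct.map f' g' y) = assocMap (f ∘ₗ f') (g ∘ₗ g') y := by
  induction y with
  | zero => simp
  | tmul x y => simp
  | add x y hx hy => simp only [map_add, hx, hy]

theorem rTensor_assocMap {N' : Type*} [AddCommGroup N'] [Module k N'] (e : N →ₗ[k] N')
    (f : M →ₗ[k] N ⊗[k] P) (g : A →ₗ[k] B) (y : M ⊗[k] A) :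
    e.rTensor (P ⊗[k] B) (assocMap f g y) = assocMap (e.rTensor P ∘ₗ f) g y := by
  have h := map_assocMap e (LinearMap.id : P →ₗ[k] P) (LinearMap.id : B →ₗ[k] B) f g y
  rwa [TensorProduct.map_id] at h

theorem lTensor_lTensor_assocMap {B' : Type*} [AddCommGroup B'] [Module k B'] (g' : B →ₗ[k] B')
    (f : M →ₗ[k] N ⊗[k] P) (g : A →ₗ[k] B) (y : M ⊗[k] A) :
    (g'.lTensor P).lTensor N (assocMap f g y) = assocMap f (g' ∘ₗ g) y := by
  have h := map_assocMap (LinearMap.id : N →ₗ[k] N) (LinearMap.id : P →ₗ[k] P) g' f g y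
  rwa [TensorProduct.map_id] at h

theorem assocMap_eq_lTensor (f : M →ₗ[k] N ⊗[k] P) (g : A →ₗ[k] B) (y : M ⊗[k] A) :
    assocMap f g y = assocMap f LinearMap.id (g.lTensor M y) :=
  (assocMap_map f LinearMap.id LinearMap.id g y).symm

theorem sliceR_assocMap (ω : B →ₗ[k] k) (f : M →ₗ[k] N ⊗[k] P) (g : A →ₗ[k] B)
    (y : M ⊗[k] A) :
    (sliceR P ω).lTensor N (assocMap f g y) = f (sliceR M (ω ∘ₗ g) y) := by
  induction y with
  | zero => simp
  | tmul x a =>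
    rw [assocMap_tmul, sliceR_tmul, map_smul, LinearMap.comp_apply]
    generalize f x = z
    induction z with
    | zero => simp
    | tmul x y => simp
    | add x y hx hy => simp only [map_add, TensorProduct.add_tmul, hx, hy, smul_add]
  | add x y hx hy => simp only [map_add, hx, hy]

theorem sliceL_assocMap_left (ω : N →ₗ[k] k) (f : M →ₗ[k] N ⊗[k] P) (g : A →ₗ[k] B)
    (y : M ⊗[k] A) :
    sliceL (P ⊗[k] B) ω (assocMap f g y) = TensorProduct.map (sliceL P ω ∘ₗ f) g y := by
  induction y with
  | zero => simp
  | tmul x a =>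
    rw [assocMap_tmul, TensorProduct.map_tmul, LinearMap.comp_apply]
    generalize f x = z
    induction z with
    | zero => simp
    | tmul x y => simp [TensorProduct.smul_tmul']
    | add x y hx hy => simp only [map_add, TensorProduct.add_tmul, hx, hy]
  | add x y hx hy => simp only [map_add, hx, hy]

theorem sliceL_assocMap (ω : P →ₗ[k] k) (f : M →ₗ[k] N ⊗[k] P) (g : A →ₗ[k] B)
    (y : M ⊗[k] A) :
    (sliceL B ω).lTensor N (assocMap f g y) = TensorProduct.map (sliceR N ω ∘ₗ f) g y := by
  induction y with
  | zero => simp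
  | tmul x a =>
    rw [assocMap_tmul, TensorProduct.map_tmul, LinearMap.comp_apply]
    generalize f x = z
    induction z with
    | zero => simp
    | tmul x y => simp [TensorProduct.smul_tmul]
    | add x y hx hy => simp only [map_add, TensorProduct.add_tmul, hx, hy]
  | add x y hx hy => simp only [map_add, hx, hy]

end LinearAlgebra

end WMB

namespace WMB

/-! ### Multipliers of non-degenerate algebras -/

section MultiplierLemmas

variable {k : Type v} [Field k] {B : Type u} [NonUnitalRing B] [Module k B]
  [IsScalarTower k B B] [SMulCommClass k B B]

/-- Non-degeneracy of an algebra on both sides. -/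
structure IsNondegenerateAlgebra (B : Type u) [NonUnitalRing B] : Prop where
  left : ∀ a : B, (∀ b : B, a * b = 0) → a = 0
  right : ∀ a : B, (∀ b : B, b * a = 0) → a = 0

theorem IsNondegenerateAlgebra.eq_of_mul_right (hB : IsNondegenerateAlgebra B) {a a' : B}
    (h : ∀ b, a * b = a' * b) : a = a' := by
  rw [← sub_eq_zero]
  exact hB.left _ fun b => by rw [sub_mul, h, sub_self]

theorem IsNondegenerateAlgebra.eq_of_mul_left (hB : IsNondegenerateAlgebra B) {a a' : B}
    (h : ∀ b, b * a = b * a') : a = a' := by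
  rw [← sub_eq_zero]
  exact hB.right _ fun b => by rw [mul_sub, h, sub_self]

theorem Multiplier.compat (w : Multiplier k B) (a b : B) : a * w.left b = w.right a * b :=
  w.2 a b

theorem Multiplier.left_mul (hB : IsNondegenerateAlgebra B) (w : Multiplier k B) (a b : B) :
    w.left (a * b) = w.left a * b :=
  hB.eq_of_mul_left fun c => by rw [w.compat, ← mul_assoc, ← mul_assoc, w.compat]

theorem Multiplier.right_mul (hB : IsNondegenerateAlgebra B) (w : Multiplier k B) (a b : B) :
    w.right (a * b) = a * w.right b :=
  hB.eq_of_mul_right fun c => by rw [← w.compat, mul_assoc, mul_assoc, ← w.compat]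

theorem Multiplier.ext' {w w' : Multiplier k B} (hl : w.left = w'.left)
    (hr : w.right = w'.right) : w = w' :=
  Subtype.ext (Prod.ext hl hr)

theorem Multiplier.ext_left (hB : IsNondegenerateAlgebra B) {w w' : Multiplier k B}
    (h : ∀ b, w.left b = w'.left b) : w = w' := by
  refine Multiplier.ext' (LinearMap.ext h) (LinearMap.ext fun a => ?_)
  exact hB.eq_of_mul_right fun b => by rw [← w.compat, ← w'.compat, h]

theorem Multiplier.ext_right (hB : IsNondegenerateAlgebra B) {w w' : Multiplier k B}
    (h : ∀ b, w.right b = w'.right b) : w = w' := by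
  refine Multiplier.ext' (LinearMap.ext fun a => ?_) (LinearMap.ext h)
  exact hB.eq_of_mul_left fun b => by rw [w.compat, w'.compat, h]

theorem leftPart_injective (hB : IsNondegenerateAlgebra B) :
    Function.Injective (leftPart k B) := fun _ _ h =>
  Multiplier.ext_left hB fun b => LinearMap.congr_fun h b

theorem rightPart_injective (hB : IsNondegenerateAlgebra B) :
    Function.Injective (rightPart k B) := fun _ _ h =>
  Multiplier.ext_right hB fun b => LinearMap.congr_fun h b

theorem Multiplier.mul_left (w w' : Multiplier k B) (b : B) :
    (w * w').left b = w.left (w'.left b) := rfl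

theorem Multiplier.mul_right (w w' : Multiplier k B) (b : B) :
    (w * w').right b = w'.right (w.right b) := rfl

/-- The linear map to `𝕄(B)` with given left and right parts. -/
def multiplierOfParts {P : Type*} [AddCommGroup P] [Module k P] (l r : P →ₗ[k] B →ₗ[k] B)
    (h : ∀ p a b, a * l p b = r p a * b) : P →ₗ[k] Multiplier k B where
  toFun p := ⟨(l p, r p), h p⟩
  map_add' p q := Multiplier.ext' (map_add l p q) (map_add r p q)
  map_smul' c p := Multiplier.ext' (map_smul l c p) (map_smul r c p)

theorem mulLeft_add (a b : B) :
    LinearMap.mulLeft k (a + b) = LinearMap.mulLeft k a + LinearMap.mulLeft k b :=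
  LinearMap.ext fun x => add_mul a b x

theorem mulRight_add (a b : B) :
    LinearMap.mulRight k (a + b) = LinearMap.mulRight k a + LinearMap.mulRight k b :=
  LinearMap.ext fun x => mul_add x a b

theorem mulRight_smul (c : k) (a : B) :
    LinearMap.mulRight k (c • a) = c • LinearMap.mulRight k a :=
  LinearMap.ext fun x => mul_smul_comm c x a

theorem mulLeft_mul (a b : B) :
    LinearMap.mulLeft k (a * b) = LinearMap.mulLeft k a ∘ₗ LinearMap.mulLeft k b :=
  LinearMap.ext fun x => mul_assoc a b x

theorem mulRight_mul (a b : B) :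
    LinearMap.mulRight k (a * b) = LinearMap.mulRight k b ∘ₗ LinearMap.mulRight k a :=
  LinearMap.ext fun x => (mul_assoc x a b).symm

theorem mulLeft_comp_mulRight (a b : B) :
    LinearMap.mulLeft k a ∘ₗ LinearMap.mulRight k b =
      LinearMap.mulRight k b ∘ₗ LinearMap.mulLeft k a :=
  LinearMap.ext fun x => (mul_assoc a x b).symm

variable {A : Type u} [NonUnitalRing A] [Module k A] [IsScalarTower k A A] [SMulCommClass k A A]
  {M : Type u} [AddCommGroup M] [Module k M]

theorem mul_tmul_eq (z : A ⊗[k] A) (c d : A) :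
    z * (c ⊗ₜ[k] d) =
      (LinearMap.mulRight k d).lTensor A ((LinearMap.mulRight k c).rTensor A z) := by
  induction z with
  | zero => simp
  | tmul x y => simp
  | add x y hx hy => simp only [add_mul, map_add, hx, hy]

theorem tmul_mul_eq (z : A ⊗[k] A) (c d : A) :
    (c ⊗ₜ[k] d) * z =
      (LinearMap.mulLeft k d).lTensor A ((LinearMap.mulLeft k c).rTensor A z) := by
  induction z with
  | zero => simp
  | tmul x y => simp
  | add x y hx hy => simp only [mul_add, map_add, hx, hy]

/-- `z(1 ⊗ a) = z'(1 ⊗ a)` for all `a` implies `z = z'`. -/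
theorem IsNondegenerateAlgebra.lTensor_right (hA : IsNondegenerateAlgebra A) {z z' : M ⊗[k] A}
    (h : ∀ a, (LinearMap.mulRight k a).lTensor M z = (LinearMap.mulRight k a).lTensor M z') :
    z = z' :=
  eq_of_lTensor (fun a : A => LinearMap.mulRight k a) (fun n hn => hA.left n hn) h

theorem IsNondegenerateAlgebra.lTensor_left (hA : IsNondegenerateAlgebra A) {z z' : M ⊗[k] A}
    (h : ∀ a, (LinearMap.mulLeft k a).lTensor M z = (LinearMap.mulLeft k a).lTensor M z') :
    z = z' :=
  eq_of_lTensor (fun a : A => LinearMap.mulLeft k a) (fun n hn => hA.right n hn) h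

theorem IsNondegenerateAlgebra.rTensor_right (hA : IsNondegenerateAlgebra A) {z z' : A ⊗[k] M}
    (h : ∀ a, (LinearMap.mulRight k a).rTensor M z = (LinearMap.mulRight k a).rTensor M z') :
    z = z' :=
  eq_of_rTensor (fun a : A => LinearMap.mulRight k a) (fun n hn => hA.left n hn) h

theorem IsNondegenerateAlgebra.rTensor_left (hA : IsNondegenerateAlgebra A) {z z' : A ⊗[k] M}
    (h : ∀ a, (LinearMap.mulLeft k a).rTensor M z = (LinearMap.mulLeft k a).rTensor M z') :
    z = z' :=
  eq_of_rTensor (fun a : A => LinearMap.mulLeft k a) (fun n hn => hA.right n hn) h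

theorem IsNondegenerateAlgebra.eq_of_mul_tmul (hA : IsNondegenerateAlgebra A) {z z' : A ⊗[k] A}
    (h : ∀ c d : A, z * (c ⊗ₜ[k] d) = z' * (c ⊗ₜ[k] d)) : z = z' := by
  refine hA.rTensor_right fun c => hA.lTensor_right fun d => ?_
  rw [← mul_tmul_eq, ← mul_tmul_eq, h]

theorem IsNondegenerateAlgebra.eq_of_tmul_mul (hA : IsNondegenerateAlgebra A) {z z' : A ⊗[k] A}
    (h : ∀ c d : A, (c ⊗ₜ[k] d) * z = (c ⊗ₜ[k] d) * z') : z = z' := by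
  refine hA.rTensor_left fun c => hA.lTensor_left fun d => ?_
  rw [← tmul_mul_eq, ← tmul_mul_eq, h]

theorem IsNondegenerateAlgebra.tensor (hA : IsNondegenerateAlgebra A) :
    IsNondegenerateAlgebra (A ⊗[k] A) where
  left z h := hA.eq_of_mul_tmul (k := k) fun c d => by rw [h, zero_mul]
  right z h := hA.eq_of_tmul_mul (k := k) fun c d => by rw [h, mul_zero]

theorem mul_rTensor_mulRight (y z : A ⊗[k] A) (c : A) :
    y * (LinearMap.mulRight k c).rTensor A z = (LinearMap.mulRight k c).rTensor A (y * z) := by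
  induction y with
  | zero => simp
  | add x y hx hy => simp only [add_mul, map_add, hx, hy]
  | tmul a b =>
    induction z with
    | zero => simp
    | tmul x y => simp [mul_assoc]
    | add x y hx hy => simp only [mul_add, map_add, hx, hy]

theorem mul_rTensor_of_compat {f g : A →ₗ[k] A} (h : ∀ a b, a * f b = g a * b)
    (y z : A ⊗[k] A) : y * f.rTensor A z = g.rTensor A y * z := by
  induction y with
  | zero => simp
  | add x y hx hy => simp only [add_mul, map_add, hx, hy]
  | tmul a b =>
    induction z with
    | zero => simp
    | tmul x y => simp [h]
    | add x y hx hy => simp only [mul_add, map_add, hx, hy]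

theorem mul_lTensor_of_compat {f g : A →ₗ[k] A} (h : ∀ a b, a * f b = g a * b)
    (y z : A ⊗[k] A) : y * f.lTensor A z = g.lTensor A y * z := by
  induction y with
  | zero => simp
  | add x y hx hy => simp only [add_mul, map_add, hx, hy]
  | tmul a b =>
    induction z with
    | zero => simp
    | tmul x y => simp [h]
    | add x y hx hy => simp only [mul_add, map_add, hx, hy]

theorem mul_rTensor_mulLeft (y z : A ⊗[k] A) (c : A) :
    y * (LinearMap.mulLeft k c).rTensor A z = (LinearMap.mulRight k c).rTensor A y * z :=
  mul_rTensor_of_compat (fun a b => (mul_assoc a c b).symm) y z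

theorem mul_lTensor_mulLeft (y z : A ⊗[k] A) (c : A) :
    y * (LinearMap.mulLeft k c).lTensor A z = (LinearMap.mulRight k c).lTensor A y * z :=
  mul_lTensor_of_compat (fun a b => (mul_assoc a c b).symm) y z

/-- `w((z)(c ⊗ 1)) = (w z)(c ⊗ 1)`. -/
theorem Multiplier.left_rTensor (hA : IsNondegenerateAlgebra A) (w : Multiplier k (A ⊗[k] A))
    (z : A ⊗[k] A) (c : A) :
    w.left ((LinearMap.mulRight k c).rTensor A z) =
      (LinearMap.mulRight k c).rTensor A (w.left z) :=
  hA.tensor.eq_of_mul_left fun y => by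
    rw [w.compat, mul_rTensor_mulRight, mul_rTensor_mulRight, w.compat]

end MultiplierLemmas

/-! ### The opposite algebra -/

section Opposite

/-- The opposite algebra of `A`, with the same underlying vector space. -/
def Op (A : Type u) : Type u := A

variable {k : Type v} [Field k] {A : Type u} [NonUnitalRing A] [Module k A]

instance : AddCommGroup (Op A) := inferInstanceAs (AddCommGroup A)

instance : NonUnitalRing (Op A) where
  __ := (inferInstance : AddCommGroup (Op A))
  mul a b := (show A from b) * (show A from a)
  left_distrib a b c := add_mul (show A from b) (show A from c) (show A from a)
  right_distrib a b c := mul_add (show A from c) (show A from a) (show A from b)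
  zero_mul a := mul_zero (show A from a)
  mul_zero a := zero_mul (show A from a)
  mul_assoc a b c := (mul_assoc (show A from c) (show A from b) (show A from a)).symm

instance : Module k (Op A) := inferInstanceAs (Module k A)

instance [SMulCommClass k A A] : IsScalarTower k (Op A) (Op A) where
  smul_assoc c a b := (mul_smul_comm c (show A from b) (show A from a))

instance [IsScalarTower k A A] : SMulCommClass k (Op A) (Op A) where
  smul_comm c a b := (smul_mul_assoc c (show A from b) (show A from a)).symm

variable [IsScalarTower k A A] [SMulCommClass k A A]

theorem Op.tensor_mul_eq (y z : Op A ⊗[k] Op A) :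
    y * z = ((show A ⊗[k] A from z) * (show A ⊗[k] A from y) : A ⊗[k] A) := by
  induction y with
  | zero => rw [zero_mul]; exact (mul_zero (show A ⊗[k] A from z)).symm
  | add x y hx hy =>
    rw [add_mul, hx, hy]
    exact (mul_add (show A ⊗[k] A from z) (show A ⊗[k] A from x) (show A ⊗[k] A from y)).symm
  | tmul a b =>
    induction z with
    | zero => rw [mul_zero]; exact (zero_mul (show A ⊗[k] A from _)).symm
    | tmul x y =>
      rw [Algebra.TensorProduct.tmul_mul_tmul]
      exact (Algebra.TensorProduct.tmul_mul_tmul (R := k) (A := A) (B := A) x a y b).symm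
    | add x y hx hy =>
      rw [mul_add, hx, hy]
      exact (add_mul (show A ⊗[k] A from x) (show A ⊗[k] A from y) (show A ⊗[k] A from _)).symm

/-- A multiplier, regarded as a multiplier of the opposite algebra. -/
def Multiplier.op : Multiplier k (A ⊗[k] A) →ₗ[k] Multiplier k (Op A ⊗[k] Op A) where
  toFun w := ⟨(w.right, w.left), fun y z => by
    rw [Op.tensor_mul_eq, Op.tensor_mul_eq]
    exact (w.compat z y).symm⟩
  map_add' _ _ := rfl
  map_smul' _ _ := rfl

end Opposite

end WMB

namespace WMB

namespace RegularWMB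

/-! ### First consequences of the axioms, and the opposite weak multiplier bialgebra -/

section Basic

variable {k : Type v} [Field k] {A : Type u} [NonUnitalRing A]
    [Module k A] [IsScalarTower k A A] [SMulCommClass k A A] (H : RegularWMB k A)

theorem nondeg (H : RegularWMB k A) : IsNondegenerateAlgebra A := ⟨H.nondegenerate_left, H.nondegenerate_right⟩

theorem nondeg₂ (H : RegularWMB k A) : IsNondegenerateAlgebra (A ⊗[k] A) := H.nondeg.tensor

theorem E_left_E_left (z : A ⊗[k] A) : H.E.left (H.E.left z) = H.E.left z := by
  rw [← Multiplier.mul_left, H.E_mul_E]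

theorem E_right_E_right (z : A ⊗[k] A) : H.E.right (H.E.right z) = H.E.right z := by
  rw [← Multiplier.mul_right, H.E_mul_E]

/-- To prove a linear identity on the range of `E`, it suffices to check it on `Δ(a)(b ⊗ c)`. -/
theorem E_left_induction {p : A ⊗[k] A → Prop} (zero : p 0)
    (add : ∀ x y, p x → p y → p (x + y)) (smul : ∀ (c : k) x, p x → p (c • x))
    (h : ∀ a b c : A, p ((H.Δ a).left (b ⊗ₜ[k] c))) (z : A ⊗[k] A) : p (H.E.left z) := by
  have hz : H.E.left z ∈ LinearMap.range H.E.left := ⟨z, rfl⟩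
  rw [H.range_left] at hz
  generalize H.E.left z = y at hz ⊢
  induction hz using Submodule.span_induction with
  | mem x hx => obtain ⟨a, b, c, rfl⟩ := hx; exact h a b c
  | zero => exact zero
  | add x y _ _ hx hy => exact add x y hx hy
  | smul c x _ hx => exact smul c x hx

theorem E_right_induction {p : A ⊗[k] A → Prop} (zero : p 0)
    (add : ∀ x y, p x → p y → p (x + y)) (smul : ∀ (c : k) x, p x → p (c • x))
    (h : ∀ a b c : A, p ((H.Δ a).right (b ⊗ₜ[k] c))) (z : A ⊗[k] A) : p (H.E.right z) := by
  have hz : H.E.right z ∈ LinearMap.range H.E.right := ⟨z, rfl⟩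
  rw [H.range_right] at hz
  generalize H.E.right z = y at hz ⊢
  induction hz using Submodule.span_induction with
  | mem x hx => obtain ⟨a, b, c, rfl⟩ := hx; exact h a b c
  | zero => exact zero
  | add x y _ _ hx hy => exact add x y hx hy
  | smul c x _ hx => exact smul c x hx

theorem E_left_Δ_left (a : A) (y : A ⊗[k] A) : H.E.left ((H.Δ a).left y) = (H.Δ a).left y := by
  induction y with
  | zero => simp
  | add x y hx hy => simp only [map_add, hx, hy]
  | tmul b c =>
    have h : (H.Δ a).left (b ⊗ₜ[k] c) ∈ LinearMap.range H.E.left := by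
      rw [H.range_left]
      exact Submodule.subset_span ⟨a, b, c, rfl⟩
    obtain ⟨z, hz⟩ := h
    rw [← hz, H.E_left_E_left]

theorem E_right_Δ_right (a : A) (y : A ⊗[k] A) :
    H.E.right ((H.Δ a).right y) = (H.Δ a).right y := by
  induction y with
  | zero => simp
  | add x y hx hy => simp only [map_add, hx, hy]
  | tmul b c =>
    have h : (H.Δ a).right (b ⊗ₜ[k] c) ∈ LinearMap.range H.E.right := by
      rw [H.range_right]
      exact Submodule.subset_span ⟨a, b, c, rfl⟩
    obtain ⟨z, hz⟩ := h
    rw [← hz, H.E_right_E_right]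

theorem Δ_left_E_left (a : A) (y : A ⊗[k] A) : (H.Δ a).left (H.E.left y) = (H.Δ a).left y :=
  H.nondeg₂.eq_of_mul_left fun x => by
    rw [Multiplier.compat, Multiplier.compat, E_right_Δ_right, ← Multiplier.compat]

theorem Δ_left_mul (a b : A) (y : A ⊗[k] A) :
    (H.Δ (a * b)).left y = (H.Δ a).left ((H.Δ b).left y) := by
  rw [H.Δ_mul, Multiplier.mul_left]

theorem Δ_right_mul (a b : A) (y : A ⊗[k] A) :
    (H.Δ (a * b)).right y = (H.Δ b).right ((H.Δ a).right y) := by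
  rw [H.Δ_mul, Multiplier.mul_right]

/-- The multipliers `Δ(g)` detect left multiples by `E`. -/
theorem E_left_eq_of_Δ_left {y y' : A ⊗[k] A}
    (h : ∀ g, (H.Δ g).left y = (H.Δ g).left y') : H.E.left y = H.E.left y' :=
  H.nondeg₂.eq_of_mul_left fun x => by
    rw [Multiplier.compat, Multiplier.compat]
    refine H.E_right_induction (p := fun z => z * y = z * y') ?_ ?_ ?_ ?_ x
    · rw [zero_mul, zero_mul]
    · intro a b ha hb
      rw [add_mul, add_mul, ha, hb]
    · intro c a ha
      rw [smul_mul_assoc, smul_mul_assoc, ha]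
    · intro a b c
      rw [← Multiplier.compat, ← Multiplier.compat, h]

theorem Δ_left_tmul (a b c : A) :
    (H.Δ a).left (c ⊗ₜ[k] b) = (LinearMap.mulRight k c).rTensor A (H.T₁ (a ⊗ₜ[k] b)) := by
  refine H.nondeg.eq_of_mul_tmul fun c' d => ?_
  rw [← Multiplier.left_mul H.nondeg₂, Algebra.TensorProduct.tmul_mul_tmul, H.T₁_spec,
    ← mul_rTensor_mulLeft]
  simp

theorem Δ_left_tmul' (a b d : A) :
    (H.Δ b).left (a ⊗ₜ[k] d) = (LinearMap.mulRight k d).lTensor A (H.T₄ (a ⊗ₜ[k] b)) := by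
  refine H.nondeg.eq_of_mul_tmul fun c' d => ?_
  rw [← Multiplier.left_mul H.nondeg₂, Algebra.TensorProduct.tmul_mul_tmul, H.T₄_spec,
    ← mul_lTensor_mulLeft]
  simp

theorem rTensor_mulLeft_mul (y z : A ⊗[k] A) (c : A) :
    (LinearMap.mulLeft k c).rTensor A (y * z) = (LinearMap.mulLeft k c).rTensor A y * z := by
  induction y with
  | zero => simp
  | add x y hx hy => simp only [add_mul, map_add, hx, hy]
  | tmul a b =>
    induction z with
    | zero => simp
    | tmul x y => simp [mul_assoc]
    | add x y hx hy => simp only [mul_add, map_add, hx, hy]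

theorem lTensor_mulLeft_mul (y z : A ⊗[k] A) (c : A) :
    (LinearMap.mulLeft k c).lTensor A (y * z) = (LinearMap.mulLeft k c).lTensor A y * z := by
  induction y with
  | zero => simp
  | add x y hx hy => simp only [add_mul, map_add, hx, hy]
  | tmul a b =>
    induction z with
    | zero => simp
    | tmul x y => simp [mul_assoc]
    | add x y hx hy => simp only [mul_add, map_add, hx, hy]

theorem Δ_right_tmul' (a b c : A) :
    (H.Δ a).right (c ⊗ₜ[k] b) = (LinearMap.mulLeft k c).rTensor A (H.T₃ (a ⊗ₜ[k] b)) := by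
  refine H.nondeg.eq_of_tmul_mul fun c' d => ?_
  rw [← Multiplier.right_mul H.nondeg₂, Algebra.TensorProduct.tmul_mul_tmul, H.T₃_spec,
    mul_rTensor_mulLeft]
  simp

theorem E_left_T₁ (z : A ⊗[k] A) : H.E.left (H.T₁ z) = H.T₁ z := by
  induction z with
  | zero => simp
  | add x y hx hy => simp only [map_add, hx, hy]
  | tmul a b =>
    refine H.nondeg.eq_of_mul_tmul fun c d => ?_
    rw [← Multiplier.left_mul H.nondeg₂, ← H.T₁_spec, E_left_Δ_left]

theorem Δ_left_T₁ (x a b : A) : (H.Δ x).left (H.T₁ (a ⊗ₜ[k] b)) = H.T₁ ((x * a) ⊗ₜ[k] b) := by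
  refine H.nondeg.eq_of_mul_tmul fun c d => ?_
  rw [← Multiplier.left_mul H.nondeg₂, ← H.T₁_spec, ← H.T₁_spec, Δ_left_mul]

/-- `(c ⊗ 1)Δ(a)(1 ⊗ b)` in terms of `T₁` and `T₂`. -/
theorem T₁_T₂ (a b c : A) :
    (LinearMap.mulLeft k c).rTensor A (H.T₁ (a ⊗ₜ[k] b)) =
      (LinearMap.mulRight k b).lTensor A (H.T₂ (c ⊗ₜ[k] a)) := by
  refine H.nondeg.eq_of_mul_tmul fun x y => H.nondeg₂.eq_of_mul_left fun w => ?_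
  rw [← rTensor_mulLeft_mul, ← H.T₁_spec, mul_rTensor_mulLeft, Multiplier.compat,
    ← mul_lTensor_mulLeft, LinearMap.lTensor_tmul, LinearMap.mulLeft_apply, ← mul_assoc]
  congr 1
  induction w with
  | zero => simp
  | add x y hx hy => simp only [add_mul, map_add, hx, hy]
  | tmul p q =>
    rw [LinearMap.rTensor_tmul, LinearMap.mulRight_apply, H.T₂_spec]

/-- `(1 ⊗ c)Δ(a)(1 ⊗ b)` in terms of `T₁` and `T₃`. -/
theorem T₁_T₃ (a b c : A) :
    (LinearMap.mulLeft k c).lTensor A (H.T₁ (a ⊗ₜ[k] b)) =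
      (LinearMap.mulRight k b).lTensor A (H.T₃ (a ⊗ₜ[k] c)) := by
  refine H.nondeg.eq_of_mul_tmul fun x y => H.nondeg₂.eq_of_mul_left fun w => ?_
  rw [← lTensor_mulLeft_mul, ← H.T₁_spec, mul_lTensor_mulLeft, Multiplier.compat,
    ← mul_lTensor_mulLeft, LinearMap.lTensor_tmul, LinearMap.mulLeft_apply, ← mul_assoc]
  congr 1
  induction w with
  | zero => simp
  | add x y hx hy => simp only [add_mul, map_add, hx, hy]
  | tmul p q =>
    rw [LinearMap.lTensor_tmul, LinearMap.mulRight_apply, H.T₃_spec]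

/-- `(c ⊗ 1)Δ(b)(a ⊗ 1)` in terms of `T₄` and `T₂`. -/
theorem T₄_T₂ (a b c : A) :
    (LinearMap.mulLeft k c).rTensor A (H.T₄ (a ⊗ₜ[k] b)) =
      (LinearMap.mulRight k a).rTensor A (H.T₂ (c ⊗ₜ[k] b)) := by
  refine H.nondeg.eq_of_mul_tmul fun x y => H.nondeg₂.eq_of_mul_left fun w => ?_
  rw [← rTensor_mulLeft_mul, ← H.T₄_spec, mul_rTensor_mulLeft, Multiplier.compat,
    ← mul_rTensor_mulLeft, LinearMap.rTensor_tmul, LinearMap.mulLeft_apply, ← mul_assoc]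
  congr 1
  induction w with
  | zero => simp
  | add x y hx hy => simp only [add_mul, map_add, hx, hy]
  | tmul p q =>
    rw [LinearMap.rTensor_tmul, LinearMap.mulRight_apply, H.T₂_spec]

/-- `(1 ⊗ c)Δ(b)(a ⊗ 1)` in terms of `T₄` and `T₃`. -/
theorem T₄_T₃ (a b c : A) :
    (LinearMap.mulLeft k c).lTensor A (H.T₄ (a ⊗ₜ[k] b)) =
      (LinearMap.mulRight k a).rTensor A (H.T₃ (b ⊗ₜ[k] c)) := by
  refine H.nondeg.eq_of_mul_tmul fun x y => H.nondeg₂.eq_of_mul_left fun w => ?_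
  rw [← lTensor_mulLeft_mul, ← H.T₄_spec, mul_lTensor_mulLeft, Multiplier.compat,
    ← mul_rTensor_mulLeft, LinearMap.rTensor_tmul, LinearMap.mulLeft_apply, ← mul_assoc]
  congr 1
  induction w with
  | zero => simp
  | add x y hx hy => simp only [add_mul, map_add, hx, hy]
  | tmul p q =>
    rw [LinearMap.lTensor_tmul, LinearMap.mulRight_apply, H.T₃_spec]

theorem sliceL_T₁ (a b : A) : sliceL A H.ε (H.T₁ (a ⊗ₜ[k] b)) = a * b :=
  LinearMap.congr_fun H.counit_left (a ⊗ₜ[k] b)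

theorem sliceR_T₂ (a b : A) : sliceR A H.ε (H.T₂ (a ⊗ₜ[k] b)) = a * b :=
  LinearMap.congr_fun H.counit_right (a ⊗ₜ[k] b)

theorem sliceL_T₃ (a b : A) : sliceL A H.ε (H.T₃ (a ⊗ₜ[k] b)) = b * a := by
  refine H.nondeg.eq_of_mul_right fun c => ?_
  have h := congrArg (sliceL A H.ε) (H.T₁_T₃ a c b)
  rw [sliceL_lTensor, sliceL_lTensor, sliceL_T₁] at h
  rw [mul_assoc]
  exact h.symm

theorem sliceR_T₄ (a b : A) : sliceR A H.ε (H.T₄ (a ⊗ₜ[k] b)) = b * a := by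
  refine H.nondeg.eq_of_mul_left fun c => ?_
  have h := congrArg (sliceR A H.ε) (H.T₄_T₂ a b c)
  rw [sliceR_rTensor, sliceR_rTensor, sliceR_T₂] at h
  rw [← mul_assoc]
  exact h

theorem _root_.WMB.Op.mul'_apply (z : A ⊗[k] A) :
    LinearMap.mul' k (Op A) z = LinearMap.mul' k A (tw A A z) := by
  have h : (LinearMap.mul' k (Op A) : A ⊗[k] A →ₗ[k] A) = LinearMap.mul' k A ∘ₗ tw A A :=
    TensorProduct.ext' fun x y => by
      have h₁ : ∀ x y : A, LinearMap.mul' k A (tw A A (x ⊗ₜ[k] y)) = y * x := fun x y => by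
        rw [tw_tmul, LinearMap.mul'_apply]
      have h₁ := h₁ x y
      exact (LinearMap.mul'_apply (A := Op A)).trans h₁.symm
  exact LinearMap.congr_fun h z

theorem rTensor_leg23_tmul (f g : A ⊗[k] A →ₗ[k] A ⊗[k] A) (x b y : A) :
    TensorProduct.assoc k A A A (f.rTensor A (leg23 A g ((x ⊗ₜ[k] b) ⊗ₜ[k] y))) =
      assocMap (f ∘ₗ TensorProduct.mk k A A x) LinearMap.id (g (b ⊗ₜ[k] y)) := by
  simp only [leg23, LinearMap.comp_apply, LinearEquiv.coe_coe, TensorProduct.assoc_tmul,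
    LinearMap.lTensor_tmul]
  generalize g (b ⊗ₜ[k] y) = z
  induction z with
  | zero => simp
  | tmul p q => simp
  | add p q hp hq => simp only [map_add, TensorProduct.tmul_add, hp, hq]

theorem leg23_tmul {M : Type*} [AddCommGroup M] [Module k M] (g : A ⊗[k] A →ₗ[k] A ⊗[k] A)
    (z : M ⊗[k] A) (y : A) :
    TensorProduct.assoc k M A A (leg23 M g (z ⊗ₜ[k] y)) =
      (g ∘ₗ (TensorProduct.mk k A A).flip y).lTensor M z := by
  simp only [leg23, LinearMap.comp_apply, LinearEquiv.coe_coe, LinearEquiv.apply_symm_apply]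
  induction z with
  | zero => simp
  | tmul p q => simp
  | add p q hp hq => simp only [map_add, TensorProduct.add_tmul, hp, hq]

/-- Coassociativity, on elements. -/
theorem coassoc_apply (x b y : A) :
    assocMap (H.T₂ ∘ₗ TensorProduct.mk k A A x) LinearMap.id (H.T₁ (b ⊗ₜ[k] y)) =
      (H.T₁ ∘ₗ (TensorProduct.mk k A A).flip y).lTensor A (H.T₂ (x ⊗ₜ[k] b)) := by
  have h := congrArg (TensorProduct.assoc k A A A)
    (LinearMap.congr_fun H.coassoc ((x ⊗ₜ[k] b) ⊗ₜ[k] y))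
  rwa [LinearMap.comp_apply, LinearMap.comp_apply, rTensor_leg23_tmul, LinearMap.rTensor_tmul,
    leg23_tmul] at h

/-- The coassociativity of `T₃` and `T₄`: multiplying it by `c ⊗ 1 ⊗ d` gives that of `T₁` and `T₂`,
multiplied by `y` on the third leg and by `x` on the first one. -/
theorem coassoc_op_apply (x b y : A) :
    assocMap (H.T₄ ∘ₗ TensorProduct.mk k A A x) LinearMap.id (H.T₃ (b ⊗ₜ[k] y)) =
      (H.T₃ ∘ₗ (TensorProduct.mk k A A).flip y).lTensor A (H.T₄ (x ⊗ₜ[k] b)) := by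
  refine H.nondeg.rTensor_left fun c => eq_of_lTensor
    (fun d : A => (LinearMap.mulRight k d).lTensor A)
    (fun z hz => eq_zero_of_lTensor (fun a : A => LinearMap.mulRight k a)
      (fun n hn => H.nondeg.left n hn) z hz) fun d => ?_
  have h := congrArg (fun z => (LinearMap.mulRight k x).rTensor (A ⊗[k] A)
    (((LinearMap.mulLeft k y).lTensor A).lTensor A z)) (H.coassoc_apply c b d)
  have e₁ : (LinearMap.mulRight k x).rTensor (A ⊗[k] A)
      (((LinearMap.mulLeft k y).lTensor A).lTensor A
        (assocMap (H.T₂ ∘ₗ TensorProduct.mk k A A c) LinearMap.id (H.T₁ (b ⊗ₜ[k] d)))) =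
      ((LinearMap.mulRight k d).lTensor A).lTensor A ((LinearMap.mulLeft k c).rTensor (A ⊗[k] A)
        (assocMap (H.T₄ ∘ₗ TensorProduct.mk k A A x) LinearMap.id (H.T₃ (b ⊗ₜ[k] y)))) := by
    have hT : (LinearMap.mulLeft k c).rTensor A ∘ₗ (H.T₄ ∘ₗ TensorProduct.mk k A A x) =
        (LinearMap.mulRight k x).rTensor A ∘ₗ (H.T₂ ∘ₗ TensorProduct.mk k A A c) :=
      LinearMap.ext fun b => H.T₄_T₂ x b c
    rw [lTensor_lTensor_assocMap, rTensor_assocMap, rTensor_assocMap, lTensor_lTensor_assocMap,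
      hT, LinearMap.comp_id, LinearMap.comp_id, assocMap_eq_lTensor,
      assocMap_eq_lTensor _ (LinearMap.mulRight k d), H.T₁_T₃]
  have e₂ : (LinearMap.mulRight k x).rTensor (A ⊗[k] A)
      (((LinearMap.mulLeft k y).lTensor A).lTensor A
        ((H.T₁ ∘ₗ (TensorProduct.mk k A A).flip d).lTensor A (H.T₂ (c ⊗ₜ[k] b)))) =
      ((LinearMap.mulRight k d).lTensor A).lTensor A ((LinearMap.mulLeft k c).rTensor (A ⊗[k] A)
        ((H.T₃ ∘ₗ (TensorProduct.mk k A A).flip y).lTensor A (H.T₄ (x ⊗ₜ[k] b)))) := by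
    have hT : (LinearMap.mulLeft k y).lTensor A ∘ₗ H.T₁ ∘ₗ (TensorProduct.mk k A A).flip d =
        (LinearMap.mulRight k d).lTensor A ∘ₗ H.T₃ ∘ₗ (TensorProduct.mk k A A).flip y :=
      LinearMap.ext fun b => H.T₁_T₃ b d y
    rw [← LinearMap.lTensor_comp_apply, hT, rTensor_lTensor, ← H.T₄_T₂, ← rTensor_lTensor,
      LinearMap.lTensor_comp_apply, rTensor_lTensor]
  rw [← e₁, ← e₂]
  exact h

theorem coassoc_op :
    H.T₄.rTensor A ∘ₗ leg23 A H.T₃ = leg23 A H.T₃ ∘ₗ H.T₄.rTensor A := by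
  refine TensorProduct.ext_threefold fun x b y => ?_
  apply (TensorProduct.assoc k A A A).injective
  rw [LinearMap.comp_apply, LinearMap.comp_apply, rTensor_leg23_tmul, LinearMap.rTensor_tmul,
    leg23_tmul, coassoc_op_apply]

/-- The opposite weak multiplier bialgebra: the multiplication is reversed, and the left and right
multiplications by `E` and by `Δ(a)` are interchanged. -/
noncomputable def op : RegularWMB k (Op A) where
  E := Multiplier.op H.E
  Δ := (Multiplier.op ∘ₗ H.Δ : A →ₗ[k] Multiplier k (Op A ⊗[k] Op A))
  T₁ := H.T₃
  T₂ := H.T₄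
  T₃ := H.T₁
  T₄ := H.T₂
  ε := H.ε
  idempotent a := by
    obtain ⟨z, hz⟩ := H.idempotent a
    exact ⟨tw A A z, (Op.mul'_apply (tw A A z)).trans (by rw [tw_tw, hz])⟩
  nondegenerate_left a h := H.nondegenerate_right a h
  nondegenerate_right a h := H.nondegenerate_left a h
  E_mul_E := Multiplier.ext' (LinearMap.ext H.E_right_E_right) (LinearMap.ext H.E_left_E_left)
  Δ_mul a b := Multiplier.ext' (LinearMap.ext (H.Δ_right_mul b a))
    (LinearMap.ext (H.Δ_left_mul b a))
  T₁_spec a b c d := by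
    rw [Op.tensor_mul_eq]
    exact H.T₃_spec a b c d
  T₂_spec a b c d := by
    rw [Op.tensor_mul_eq]
    exact H.T₄_spec a b c d
  T₃_spec a b c d := by
    rw [Op.tensor_mul_eq]
    exact H.T₁_spec a b c d
  T₄_spec a b c d := by
    rw [Op.tensor_mul_eq]
    exact H.T₂_spec a b c d
  coassoc := H.coassoc_op
  counit_left := TensorProduct.ext' fun a b => H.sliceL_T₃ a b
  counit_right := TensorProduct.ext' fun a b => H.sliceR_T₄ a b
  range_left := H.range_right
  range_right := H.range_left
  E_comm_left := H.E_comm_right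
  E_comm_right := H.E_comm_left
  E_three_left := H.E_three_right
  E_three_right := H.E_three_left
  counit_mul_left a b c := H.counit_mul_right b c a
  counit_mul_right a b c := H.counit_mul_left c a b

end Basic

end RegularWMB

end WMB

namespace WMB

namespace RegularWMB

/-! ### The counital maps as multipliers -/

section Counital

variable {k : Type v} [Field k] {A : Type u} [NonUnitalRing A]
    [Module k A] [IsScalarTower k A A] [SMulCommClass k A A] (H : RegularWMB k A)

/-- `⊓̄ᴿ(a) x`, as a function of `a` and `x`. -/
noncomputable def piBarRl : A →ₗ[k] A →ₗ[k] A :=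
  (TensorProduct.curry (sliceR A H.ε ∘ₗ H.E.left)).flip

/-- `x ⊓̄ᴿ(a)`, as a function of `a` and `x`. -/
noncomputable def piBarRr : A →ₗ[k] A →ₗ[k] A :=
  (TensorProduct.curry (sliceR A H.ε ∘ₗ H.T₁)).flip

/-- `⊓ᴿ(a) x`, as a function of `a` and `x`. -/
noncomputable def piRl : A →ₗ[k] A →ₗ[k] A :=
  (TensorProduct.curry (sliceR A H.ε ∘ₗ H.T₃)).flip

/-- `x ⊓ᴿ(a)`, as a function of `a` and `x`. -/
noncomputable def piRr : A →ₗ[k] A →ₗ[k] A :=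
  (TensorProduct.curry (sliceR A H.ε ∘ₗ H.E.right)).flip

/-- `⊓ᴸ(a) x`, as a function of `a` and `x`, where `⊓ᴸ(a) = (ε ⊗ 𝕄(A))[E(a ⊗ 1)]`. -/
noncomputable def piLl : A →ₗ[k] A →ₗ[k] A :=
  TensorProduct.curry (sliceL A H.ε ∘ₗ H.E.left)

/-- `x ⊓ᴸ(a)`, as a function of `a` and `x`. -/
noncomputable def piLr : A →ₗ[k] A →ₗ[k] A :=
  TensorProduct.curry (sliceL A H.ε ∘ₗ H.T₄)

/-- `⊓̄ᴸ(a) x`, as a function of `a` and `x`. -/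
noncomputable def piBarLl : A →ₗ[k] A →ₗ[k] A :=
  TensorProduct.curry (sliceL A H.ε ∘ₗ H.T₂)

/-- `x ⊓̄ᴸ(a)`, as a function of `a` and `x`. -/
noncomputable def piBarLr : A →ₗ[k] A →ₗ[k] A :=
  TensorProduct.curry (sliceL A H.ε ∘ₗ H.E.right)

theorem piBarRl_apply (a x : A) : H.piBarRl a x = sliceR A H.ε (H.E.left (x ⊗ₜ[k] a)) := rfl
theorem piBarRr_apply (a x : A) : H.piBarRr a x = sliceR A H.ε (H.T₁ (x ⊗ₜ[k] a)) := rfl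
theorem piRl_apply (a x : A) : H.piRl a x = sliceR A H.ε (H.T₃ (x ⊗ₜ[k] a)) := rfl
theorem piRr_apply (a x : A) : H.piRr a x = sliceR A H.ε (H.E.right (x ⊗ₜ[k] a)) := rfl
theorem piLl_apply (a x : A) : H.piLl a x = sliceL A H.ε (H.E.left (a ⊗ₜ[k] x)) := rfl
theorem piLr_apply (a x : A) : H.piLr a x = sliceL A H.ε (H.T₄ (a ⊗ₜ[k] x)) := rfl

/-- The left and right multiplications by `⊓ᴸ(b)` form a multiplier. -/
theorem piL_compat (a b c : A) : a * H.piLl b c = H.piLr b a * c := by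
  rw [piLl_apply, H.counit_mul_left, Δ_left_tmul', sliceL_lTensor, piLr_apply,
    LinearMap.mulRight_apply]

theorem piBarL_compat (a b c : A) : a * H.piBarLl b c = H.piBarLr b a * c :=
  (H.op.piL_compat c b a).symm

theorem ε_piLr (x a : A) : H.ε (H.piLr x a) = H.ε (a * x) := by
  rw [piLr_apply, apply_sliceL_eq_apply_sliceR, sliceR_T₄]

/-- `(A ⊗ E)(Δ(a)(b ⊗ 1) ⊗ d) = (Δ ⊗ A)(E(a ⊗ d))(b ⊗ 1 ⊗ 1)`. -/
theorem lTensor_E_T₄ (a b d : A) :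
    (H.E.left ∘ₗ (TensorProduct.mk k A A).flip d).lTensor A (H.T₄ (b ⊗ₜ[k] a)) =
      assocMap (H.T₄ ∘ₗ TensorProduct.mk k A A b) LinearMap.id (H.E.left (a ⊗ₜ[k] d)) := by
  refine eq_of_lTensor (fun c : A => (LinearMap.mulRight k c).rTensor A)
    (fun z hz => eq_zero_of_rTensor (fun a : A => LinearMap.mulRight k a)
      (fun n hn => H.nondeg.left n hn) z hz) fun c => ?_
  have h := congrArg (TensorProduct.assoc k A A A) (H.E_three_left a b c d)
  rw [leg23_tmul, Δ_left_tmul', ← LinearMap.lTensor_comp_apply] at h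
  have e₁ : (H.E.left ∘ₗ (TensorProduct.mk k A A).flip d) ∘ₗ LinearMap.mulRight k c =
      (LinearMap.mulRight k c).rTensor A ∘ₗ (H.E.left ∘ₗ (TensorProduct.mk k A A).flip d) := by
    ext x
    exact Multiplier.left_rTensor H.nondeg H.E (x ⊗ₜ[k] d) c
  have e₂ : ((LinearMap.applyₗ (R := k) (b ⊗ₜ[k] c) ∘ₗ leftPart k (A ⊗[k] A)) ∘ₗ H.Δ) =
      (LinearMap.mulRight k c).lTensor A ∘ₗ (H.T₄ ∘ₗ TensorProduct.mk k A A b) :=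
    LinearMap.ext fun x => H.Δ_left_tmul' b x c
  rw [e₁, LinearMap.lTensor_comp_apply, e₂] at h
  rw [h]
  exact (map_assocMap LinearMap.id (LinearMap.mulRight k c) LinearMap.id
    (H.T₄ ∘ₗ TensorProduct.mk k A A b) LinearMap.id (H.E.left (a ⊗ₜ[k] d))).symm

/-- `E(a ⊗ 1) = a₁ ⊗ ⊓ᴸ(a₂)`. -/
theorem lTensor_piLl_T₄ (a b d : A) :
    (H.piLl.flip d).lTensor A (H.T₄ (b ⊗ₜ[k] a)) = H.E.left ((a * b) ⊗ₜ[k] d) := by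
  have h := congrArg ((sliceL A H.ε).lTensor A) (H.lTensor_E_T₄ a b d)
  have e₁ : sliceR A H.ε ∘ₗ H.T₄ ∘ₗ TensorProduct.mk k A A b = LinearMap.mulRight k b :=
    LinearMap.ext fun x => H.sliceR_T₄ b x
  rw [sliceL_assocMap, e₁, ← LinearMap.lTensor_comp_apply] at h
  exact h.trans (Multiplier.left_rTensor H.nondeg H.E (a ⊗ₜ[k] d) b).symm

/-- The left and right multiplications by `⊓ᴿ(a)` form a multiplier. Both sides come from
`(c ⊗ a)E(b ⊗ 1) = c b₁ ⊗ a ⊓ᴸ(b₂)` and `ε(a ⊓ᴸ(x)) = ε(a x)`. -/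
theorem piR_compat (a b c : A) : c * H.piRl a b = H.piRr a c * b := by
  refine H.nondeg.eq_of_mul_right fun g => ?_
  have key : (LinearMap.mulRight k (b * g)).rTensor A (H.E.right (c ⊗ₜ[k] a)) =
      (LinearMap.mulLeft k c).rTensor A ((H.piLr.flip a).lTensor A (H.T₄ (g ⊗ₜ[k] b))) := by
    refine H.nondeg.lTensor_right fun d => ?_
    have e : LinearMap.mulLeft k a ∘ₗ H.piLl.flip d = LinearMap.mulRight k d ∘ₗ H.piLr.flip a :=
      LinearMap.ext fun q => H.piL_compat a q d
    rw [← mul_tmul_eq, ← Multiplier.compat, ← lTensor_piLl_T₄, tmul_mul_eq,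
      ← rTensor_lTensor, ← rTensor_lTensor, ← LinearMap.lTensor_comp_apply,
      ← LinearMap.lTensor_comp_apply, e]
  have h := congrArg (sliceR A H.ε) key
  have e : H.ε ∘ₗ H.piLr.flip a = H.ε ∘ₗ LinearMap.mulLeft k a :=
    LinearMap.ext fun q => H.ε_piLr q a
  rw [sliceR_rTensor, sliceR_rTensor, sliceR_lTensor, e, ← sliceR_lTensor, T₄_T₃,
    sliceR_rTensor] at h
  simpa [mul_assoc, piRr_apply, piRl_apply] using h.symm

theorem piBarR_compat (a b c : A) : c * H.piBarRl a b = H.piBarRr a c * b :=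
  (H.op.piR_compat a c b).symm

/-- The corestriction defining `⊓ᴿ` is genuine: `⊓ᴿ(a)` is a multiplier with the expected left and
right parts. -/
theorem piR_eq : H.piR = multiplierOfParts H.piRl H.piRr fun p a b => H.piR_compat p b a :=
  corestrict_eq_of_comp (rightPart_injective H.nondeg) rfl

theorem piBarR_eq :
    H.piBarR = multiplierOfParts H.piBarRl H.piBarRr fun p a b => H.piBarR_compat p b a :=
  corestrict_eq_of_comp (leftPart_injective H.nondeg) rfl

theorem piBarL_eq :
    H.piBarL = multiplierOfParts H.piBarLl H.piBarLr fun p a b => H.piBarL_compat a p b :=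
  corestrict_eq_of_comp (rightPart_injective H.nondeg) rfl

theorem piR_left (a : A) : (H.piR a).left = H.piRl a := by rw [piR_eq]; rfl
theorem piR_right (a : A) : (H.piR a).right = H.piRr a := by rw [piR_eq]; rfl
theorem piBarR_left (a : A) : (H.piBarR a).left = H.piBarRl a := by rw [piBarR_eq]; rfl
theorem piBarR_right (a : A) : (H.piBarR a).right = H.piBarRr a := by rw [piBarR_eq]; rfl
theorem piBarL_left (a : A) : (H.piBarL a).left = H.piBarLl a := by rw [piBarL_eq]; rfl
theorem piBarL_right (a : A) : (H.piBarL a).right = H.piBarLr a := by rw [piBarL_eq]; rfl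

theorem sliceL_Δ_left (x : A) (w : A ⊗[k] A) :
    sliceL A H.ε ((H.Δ x).left w) = x * sliceL A H.ε (H.E.left w) := by
  induction w with
  | zero => simp
  | tmul b c => rw [H.counit_mul_left]
  | add x y hx hy => simp only [map_add, mul_add, hx, hy]

theorem sliceR_Δ_left (x : A) (w : A ⊗[k] A) :
    sliceR A H.ε ((H.Δ x).left w) = x * sliceR A H.ε (H.E.left w) := by
  induction w with
  | zero => simp
  | tmul b c =>
    rw [Δ_left_tmul, sliceR_rTensor]
    exact (H.piBarR_compat c b x).symm
  | add x y hx hy => simp only [map_add, mul_add, hx, hy]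

end Counital

end RegularWMB

end WMB

namespace WMB

namespace RegularWMB

/-! ### Comodules -/

section ComoduleBasics

variable {k : Type v} [Field k] {A : Type u} [NonUnitalRing A]
    [Module k A] [IsScalarTower k A A] [SMulCommClass k A A]
  {M : Type u} [AddCommGroup M] [Module k M]

/-- `m ↦ f(m ⊗ a)`. -/
noncomputable def evalAt (f : M ⊗[k] A →ₗ[k] M ⊗[k] A) (a : A) : M →ₗ[k] M ⊗[k] A :=
  f ∘ₗ (TensorProduct.mk k M A).flip a

@[simp] theorem evalAt_apply (f : M ⊗[k] A →ₗ[k] M ⊗[k] A) (a : A) (m : M) :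
    evalAt f a m = f (m ⊗ₜ[k] a) := rfl

/-- `(λ ⊗ A)λ¹³`, as a map on `M ⊗ (A ⊗ A)`: for a comodule it sends `m ⊗ y` to `m₀ ⊗ Δ(m₁)y`. -/
noncomputable def iterate (f : M ⊗[k] A →ₗ[k] M ⊗[k] A) :
    M ⊗[k] (A ⊗[k] A) →ₗ[k] M ⊗[k] (A ⊗[k] A) :=
  (TensorProduct.assoc k M A A).toLinearMap ∘ₗ (f.rTensor A ∘ₗ leg13 A f) ∘ₗ
    (TensorProduct.assoc k M A A).symm.toLinearMap

theorem iterate_tmul (f : M ⊗[k] A →ₗ[k] M ⊗[k] A) (m : M) (a b : A) :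
    iterate f (m ⊗ₜ[k] (a ⊗ₜ[k] b)) = assocMap (evalAt f a) LinearMap.id (f (m ⊗ₜ[k] b)) := by
  simp only [iterate, leg13, LinearMap.comp_apply, LinearEquiv.coe_coe,
    TensorProduct.assoc_symm_tmul, TensorProduct.rightComm_tmul, LinearMap.rTensor_tmul]
  generalize f (m ⊗ₜ[k] b) = z
  induction z with
  | zero => simp
  | tmul p q => simp
  | add p q hp hq => simp only [map_add, TensorProduct.add_tmul, hp, hq]

variable (H : RegularWMB k A)

/-- `(M, λ, ϱ)` is a right comodule, not necessarily full. -/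
structure IsComodule (lam rho : M ⊗[k] A →ₗ[k] M ⊗[k] A) : Prop where
  compat : ∀ (m : M) (a b : A),
    (LinearMap.mulLeft k a).lTensor M (lam (m ⊗ₜ[k] b)) =
      (LinearMap.mulRight k b).lTensor M (rho (m ⊗ₜ[k] a))
  coassoc : lam.rTensor A ∘ₗ leg13 A lam ∘ₗ leg23 M H.T₁ = leg23 M H.T₁ ∘ₗ lam.rTensor A
  normalized : lam.rTensor A ∘ₗ leg13 A lam ∘ₗ leg23 M H.E.left = lam.rTensor A ∘ₗ leg13 A lam

variable {H} in
theorem IsFullComodule.isComodule {lam rho : M ⊗[k] A →ₗ[k] M ⊗[k] A}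
    (h : H.IsFullComodule lam rho) : H.IsComodule lam rho :=
  ⟨h.compat, h.coassoc, h.normalized⟩

/-- The comodule axioms on elements: coassociativity. -/
theorem iterate_T₁_iff (lam : M ⊗[k] A →ₗ[k] M ⊗[k] A) :
    lam.rTensor A ∘ₗ leg13 A lam ∘ₗ leg23 M H.T₁ = leg23 M H.T₁ ∘ₗ lam.rTensor A ↔
      ∀ (m : M) (a b : A), iterate lam (m ⊗ₜ[k] H.T₁ (a ⊗ₜ[k] b)) =
        (H.T₁ ∘ₗ (TensorProduct.mk k A A).flip b).lTensor M (lam (m ⊗ₜ[k] a)) := by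
  have e₁ : ∀ (m : M) (a b : A), iterate lam (m ⊗ₜ[k] H.T₁ (a ⊗ₜ[k] b)) =
      TensorProduct.assoc k M A A ((lam.rTensor A ∘ₗ leg13 A lam ∘ₗ leg23 M H.T₁)
        ((m ⊗ₜ[k] a) ⊗ₜ[k] b)) := fun m a b => by
    simp [iterate, leg23]
  constructor
  · intro h m a b
    rw [e₁, h, LinearMap.comp_apply, LinearMap.rTensor_tmul, leg23_tmul]
  · intro h
    refine TensorProduct.ext_threefold fun m a b => ?_
    apply (TensorProduct.assoc k M A A).injective
    rw [← e₁, h, LinearMap.comp_apply, LinearMap.rTensor_tmul, leg23_tmul]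

/-- The comodule axioms on elements: normalization. -/
theorem iterate_E_iff (lam : M ⊗[k] A →ₗ[k] M ⊗[k] A) :
    lam.rTensor A ∘ₗ leg13 A lam ∘ₗ leg23 M H.E.left = lam.rTensor A ∘ₗ leg13 A lam ↔
      ∀ (m : M) (y : A ⊗[k] A), iterate lam (m ⊗ₜ[k] H.E.left y) = iterate lam (m ⊗ₜ[k] y) := by
  have e₁ : ∀ (m : M) (a b : A), iterate lam (m ⊗ₜ[k] H.E.left (a ⊗ₜ[k] b)) =
      TensorProduct.assoc k M A A ((lam.rTensor A ∘ₗ leg13 A lam ∘ₗ leg23 M H.E.left)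
        ((m ⊗ₜ[k] a) ⊗ₜ[k] b)) := fun m a b => by
    simp [iterate, leg23]
  have e₂ : ∀ (m : M) (a b : A), iterate lam (m ⊗ₜ[k] (a ⊗ₜ[k] b)) =
      TensorProduct.assoc k M A A ((lam.rTensor A ∘ₗ leg13 A lam)
        ((m ⊗ₜ[k] a) ⊗ₜ[k] b)) := fun m a b => by
    simp [iterate]
  constructor
  · intro h m y
    induction y with
    | zero => simp
    | tmul a b => rw [e₁, h, e₂]
    | add x y hx hy => simp only [map_add, TensorProduct.tmul_add, hx, hy]
  · intro h
    refine TensorProduct.ext_threefold fun m a b => ?_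
    apply (TensorProduct.assoc k M A A).injective
    rw [← e₁, h, e₂]

namespace IsComodule

variable {H} {lam rho : M ⊗[k] A →ₗ[k] M ⊗[k] A}

theorem lam_lTensor (hM : H.IsComodule lam rho) (z : M ⊗[k] A) (b : A) :
    lam ((LinearMap.mulRight k b).lTensor M z) = (LinearMap.mulRight k b).lTensor M (lam z) := by
  induction z with
  | zero => simp
  | add x y hx hy => simp only [map_add, hx, hy]
  | tmul m a =>
    refine H.nondeg.lTensor_left fun c => ?_
    rw [LinearMap.lTensor_tmul, hM.compat, LinearMap.mulRight_apply, mulRight_mul,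
      LinearMap.lTensor_comp_apply, ← hM.compat, ← LinearMap.lTensor_comp_apply,
      ← LinearMap.lTensor_comp_apply, mulLeft_comp_mulRight]

theorem lam_mul (hM : H.IsComodule lam rho) (m : M) (a b : A) :
    lam (m ⊗ₜ[k] (a * b)) = (LinearMap.mulRight k b).lTensor M (lam (m ⊗ₜ[k] a)) :=
  hM.lam_lTensor (m ⊗ₜ[k] a) b

theorem rho_mul (hM : H.IsComodule lam rho) (m : M) (a b : A) :
    rho (m ⊗ₜ[k] (a * b)) = (LinearMap.mulLeft k a).lTensor M (rho (m ⊗ₜ[k] b)) := by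
  refine H.nondeg.lTensor_right fun c => ?_
  rw [← hM.compat, ← LinearMap.lTensor_comp_apply, ← mulLeft_comp_mulRight,
    LinearMap.lTensor_comp_apply, ← hM.compat, ← LinearMap.lTensor_comp_apply, mulLeft_mul]

theorem iterate_T₁ (hM : H.IsComodule lam rho) (m : M) (a b : A) :
    iterate lam (m ⊗ₜ[k] H.T₁ (a ⊗ₜ[k] b)) =
        (H.T₁ ∘ₗ (TensorProduct.mk k A A).flip b).lTensor M (lam (m ⊗ₜ[k] a)) :=
  (H.iterate_T₁_iff lam).1 hM.coassoc m a b

theorem iterate_E (hM : H.IsComodule lam rho) (m : M) (y : A ⊗[k] A) :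
    iterate lam (m ⊗ₜ[k] H.E.left y) = iterate lam (m ⊗ₜ[k] y) :=
  (H.iterate_E_iff lam).1 hM.normalized m y

theorem iterate_rTensor (hM : H.IsComodule lam rho) (m : M) (y : A ⊗[k] A) (s : A) :
    iterate lam (m ⊗ₜ[k] (LinearMap.mulRight k s).rTensor A y) =
      ((LinearMap.mulRight k s).rTensor A).lTensor M (iterate lam (m ⊗ₜ[k] y)) := by
  induction y with
  | zero => simp
  | add x y hx hy => simp only [map_add, TensorProduct.tmul_add, hx, hy]
  | tmul a b =>
    have e : evalAt lam (a * s) = (LinearMap.mulRight k s).lTensor M ∘ₗ evalAt lam a :=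
      LinearMap.ext fun m => hM.lam_mul m a s
    rw [LinearMap.rTensor_tmul, iterate_tmul, iterate_tmul, LinearMap.mulRight_apply, e]
    exact (lTensor_map_assocMap (LinearMap.mulRight k s) LinearMap.id (evalAt lam a)
      LinearMap.id (lam (m ⊗ₜ[k] b))).symm

/-- `m₀ ⊗ Δ(m₁)Δ(p)w = m₀ ⊗ Δ(m₁ p)w`. -/
theorem iterate_Δ (hM : H.IsComodule lam rho) (m : M) (p : A) (w : A ⊗[k] A) :
    iterate lam (m ⊗ₜ[k] (H.Δ p).left w) =
      (LinearMap.applyₗ (R := k) w ∘ₗ leftPart k (A ⊗[k] A) ∘ₗ H.Δ).lTensor M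
        (lam (m ⊗ₜ[k] p)) := by
  induction w with
  | zero => simp
  | add x y hx hy =>
    simp only [map_add, TensorProduct.tmul_add, LinearMap.add_comp, LinearMap.lTensor_add,
      LinearMap.add_apply, hx, hy]
  | tmul s q =>
    rw [Δ_left_tmul, hM.iterate_rTensor, hM.iterate_T₁, ← LinearMap.lTensor_comp_apply]
    congr 2
    exact LinearMap.ext fun x => (H.Δ_left_tmul x q s).symm

/-- `m₀ ⊗ E Δ(m₁)y = m₀ ⊗ Δ(m₁)y`. -/
theorem iterate_E_left (hM : H.IsComodule lam rho) (m : M) (y : A ⊗[k] A) :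
    H.E.left.lTensor M (iterate lam (m ⊗ₜ[k] y)) = iterate lam (m ⊗ₜ[k] y) := by
  rw [← hM.iterate_E]
  refine H.E_left_induction (p := fun z => H.E.left.lTensor M (iterate lam (m ⊗ₜ[k] z)) =
    iterate lam (m ⊗ₜ[k] z)) ?_ ?_ ?_ ?_ y
  · simp
  · intro x y hx hy
    simp only [map_add, TensorProduct.tmul_add, hx, hy]
  · intro c x hx
    simp only [map_smul, TensorProduct.tmul_smul, hx]
  · intro a b c
    rw [hM.iterate_Δ, ← LinearMap.lTensor_comp_apply]
    congr 2
    exact LinearMap.ext fun x => H.E_left_Δ_left x _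

/-- A map `s` with `s(Δ(x)w) = x s(E w)` satisfies `m₀ ⊗ s(Δ(m₁)y) = m₀ ⊗ m₁ s(E y)`: by
normalization it suffices to consider `y = Δ(a)w`. Both slices of `ε` are such maps. -/
theorem lTensor_iterate (hM : H.IsComodule lam rho) {s : A ⊗[k] A →ₗ[k] A}
    (hs : ∀ x w, s ((H.Δ x).left w) = x * s (H.E.left w)) (m : M) (y : A ⊗[k] A) :
    s.lTensor M (iterate lam (m ⊗ₜ[k] y)) = lam (m ⊗ₜ[k] s (H.E.left y)) := by
  rw [← hM.iterate_E]
  refine H.E_left_induction (p := fun z => s.lTensor M (iterate lam (m ⊗ₜ[k] z)) =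
    lam (m ⊗ₜ[k] s z)) ?_ ?_ ?_ ?_ y
  · simp
  · intro x y hx hy
    simp only [map_add, TensorProduct.tmul_add, hx, hy]
  · intro c x hx
    simp only [map_smul, TensorProduct.tmul_smul, hx]
  · intro a b c
    rw [hM.iterate_Δ, ← LinearMap.lTensor_comp_apply, hs, hM.lam_mul]
    congr 2
    exact LinearMap.ext fun x => hs x _

end IsComodule

/-- `m ⊓̄ᴿ(c) = (M ⊗ ε)λ(m ⊗ c)`, or `⊓ᴿ(c) m = (M ⊗ ε)ϱ(m ⊗ c)`. -/
noncomputable def epsAct (f : M ⊗[k] A →ₗ[k] M ⊗[k] A) (c : A) : M →ₗ[k] M :=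
  sliceR M H.ε ∘ₗ evalAt f c

theorem epsAct_apply (f : M ⊗[k] A →ₗ[k] M ⊗[k] A) (c : A) (m : M) :
    H.epsAct f c m = sliceR M H.ε (f (m ⊗ₜ[k] c)) := rfl

namespace IsComodule

variable {H} {lam rho : M ⊗[k] A →ₗ[k] M ⊗[k] A}

/-- `λ(m r ⊗ a) = λ(m ⊗ r a)` for `r = ⊓̄ᴿ(c)`. -/
theorem lam_epsAct (hM : H.IsComodule lam rho) (m : M) (c a : A) :
    lam (H.epsAct lam c m ⊗ₜ[k] a) = lam (m ⊗ₜ[k] H.piBarRl c a) := by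
  have h := hM.lTensor_iterate (s := sliceR A H.ε) H.sliceR_Δ_left m (a ⊗ₜ[k] c)
  rwa [iterate_tmul, sliceR_assocMap] at h

/-- `m₀ r ⊗ m₁ a = m₀ ⊗ m₁ ⊓ᴸ(c) a` for `r = ⊓̄ᴿ(c)`. -/
theorem rTensor_epsAct (hM : H.IsComodule lam rho) (m : M) (c a : A) :
    (H.epsAct lam c).rTensor A (lam (m ⊗ₜ[k] a)) = lam (m ⊗ₜ[k] H.piLl c a) := by
  have h := hM.lTensor_iterate (s := sliceL A H.ε) H.sliceL_Δ_left m (c ⊗ₜ[k] a)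
  rwa [iterate_tmul, sliceL_assocMap] at h

/-- `(1 ⊗ y)(m₀ ⊗ Δ(m₁)w)` in terms of `λ` and of `ϱ`. -/
theorem iterate_compat (hM : H.IsComodule lam rho) (m : M) (y w : A ⊗[k] A) :
    (LinearMap.mulLeft k y).lTensor M (iterate lam (m ⊗ₜ[k] w)) =
      (LinearMap.mulRight k w).lTensor M (iterate rho (m ⊗ₜ[k] y)) := by
  induction y with
  | zero => simp [LinearMap.mulLeft_zero_eq_zero]
  | add x y hx hy =>
    rw [mulLeft_add, LinearMap.lTensor_add, LinearMap.add_apply, hx, hy,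
      TensorProduct.tmul_add, map_add, map_add]
  | tmul c d =>
    induction w with
    | zero => simp [LinearMap.mulRight_zero_eq_zero]
    | add x y hx hy =>
      rw [mulRight_add, LinearMap.lTensor_add, LinearMap.add_apply, ← hx, ← hy,
        TensorProduct.tmul_add, map_add, map_add]
    | tmul a b =>
      have e₁ : LinearMap.mulLeft k (c ⊗ₜ[k] d) =
          TensorProduct.map (LinearMap.mulLeft k c) (LinearMap.mulLeft k d) := by
        ext x y
        simp
      have e₂ : LinearMap.mulRight k (a ⊗ₜ[k] b) =
          TensorProduct.map (LinearMap.mulRight k a) (LinearMap.mulRight k b) := by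
        ext x y
        simp
      have e₃ : (LinearMap.mulLeft k c).lTensor M ∘ₗ evalAt lam a =
          (LinearMap.mulRight k a).lTensor M ∘ₗ evalAt rho c :=
        LinearMap.ext fun m => hM.compat m c a
      rw [e₁, e₂, iterate_tmul, iterate_tmul, lTensor_map_assocMap, lTensor_map_assocMap, e₃,
        LinearMap.comp_id, LinearMap.comp_id, assocMap_eq_lTensor, hM.compat,
        ← assocMap_eq_lTensor]

/-- A comodule over `A` is a comodule over the opposite algebra, with `λ` and `ϱ` interchanged. The
axioms for `ϱ` may be checked after multiplication by elements `w` of `A ⊗ A`, where they turn into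
those for `λ`; it suffices to consider `w = Δ(p)w'`. -/
theorem op (hM : H.IsComodule lam rho) :
    IsComodule (A := Op A) H.op rho lam where
  compat m a b := (hM.compat m b a).symm
  coassoc := by
    refine (iterate_T₁_iff (A := Op A) H.op rho).2 fun m (a : A) (b : A) => ?_
    change iterate rho (m ⊗ₜ[k] H.T₃ (a ⊗ₜ[k] b)) =
        (H.T₃ ∘ₗ (TensorProduct.mk k A A).flip b).lTensor M (rho (m ⊗ₜ[k] a))
    refine H.nondeg₂.lTensor_right fun w => ?_
    have hT : ∀ x w, H.T₃ (x ⊗ₜ[k] b) * H.E.left w = H.T₃ (x ⊗ₜ[k] b) * w := fun x w => by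
      rw [Multiplier.compat]
      exact congrArg (· * w) (H.op.E_left_T₁ (x ⊗ₜ[k] b))
    have e : LinearMap.mulRight k w ∘ₗ (H.T₃ ∘ₗ (TensorProduct.mk k A A).flip b) =
        LinearMap.mulRight k (H.E.left w) ∘ₗ (H.T₃ ∘ₗ (TensorProduct.mk k A A).flip b) :=
      LinearMap.ext fun x => (hT x w).symm
    rw [← hM.iterate_compat, ← hM.iterate_E, ← LinearMap.lTensor_comp_apply, e]
    refine H.E_left_induction (p := fun z =>
      (LinearMap.mulLeft k (H.T₃ (a ⊗ₜ[k] b))).lTensor M (iterate lam (m ⊗ₜ[k] z)) =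
        (LinearMap.mulRight k z ∘ₗ (H.T₃ ∘ₗ (TensorProduct.mk k A A).flip b)).lTensor M
          (rho (m ⊗ₜ[k] a))) ?_ ?_ ?_ ?_ w
    · simp [LinearMap.mulRight_zero_eq_zero]
    · intro x y hx hy
      rw [TensorProduct.tmul_add, map_add, map_add, hx, hy, mulRight_add,
        LinearMap.add_comp, LinearMap.lTensor_add, LinearMap.add_apply]
    · intro c x hx
      rw [TensorProduct.tmul_smul, map_smul, map_smul, hx, mulRight_smul, LinearMap.smul_comp,
        LinearMap.lTensor_smul, LinearMap.smul_apply]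
    · intro p s q
      have hΔ : ∀ x y w : _, H.T₃ (x ⊗ₜ[k] b) * (H.Δ y).left w = H.T₃ ((x * y) ⊗ₜ[k] b) * w :=
        fun x y w => by
          rw [Multiplier.compat]
          exact congrArg (· * w) (H.op.Δ_left_T₁ y x b)
      rw [hM.iterate_Δ, ← LinearMap.lTensor_comp_apply]
      have e₁ : LinearMap.mulLeft k (H.T₃ (a ⊗ₜ[k] b)) ∘ₗ (LinearMap.applyₗ (R := k) (s ⊗ₜ[k] q) ∘ₗ
          leftPart k (A ⊗[k] A) ∘ₗ H.Δ) = (LinearMap.mulRight k (s ⊗ₜ[k] q) ∘ₗ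
          (H.T₃ ∘ₗ (TensorProduct.mk k A A).flip b)) ∘ₗ LinearMap.mulLeft k a :=
        LinearMap.ext fun x => hΔ a x _
      have e₂ : LinearMap.mulRight k ((H.Δ p).left (s ⊗ₜ[k] q)) ∘ₗ
          (H.T₃ ∘ₗ (TensorProduct.mk k A A).flip b) = (LinearMap.mulRight k (s ⊗ₜ[k] q) ∘ₗ
          (H.T₃ ∘ₗ (TensorProduct.mk k A A).flip b)) ∘ₗ LinearMap.mulRight k p :=
        LinearMap.ext fun x => hΔ x p _
      rw [e₁, e₂, LinearMap.lTensor_comp_apply, hM.compat, ← LinearMap.lTensor_comp_apply]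
  normalized := by
    refine (iterate_E_iff (A := Op A) H.op rho).2 fun m (y : A ⊗[k] A) => ?_
    change iterate rho (m ⊗ₜ[k] H.E.right y) = iterate rho (m ⊗ₜ[k] y)
    refine H.nondeg₂.lTensor_right fun w => ?_
    have e : LinearMap.mulLeft k (H.E.right y) = LinearMap.mulLeft k y ∘ₗ H.E.left :=
      LinearMap.ext fun x => (H.E.compat y x).symm
    rw [← hM.iterate_compat, ← hM.iterate_compat, e, LinearMap.lTensor_comp_apply,
      hM.iterate_E_left]

/-- `ϱ(r m ⊗ a) = ϱ(m ⊗ a r)` for `r = ⊓ᴿ(c)`. -/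
theorem rho_epsAct (hM : H.IsComodule lam rho) (m : M) (c a : A) :
    rho (H.epsAct rho c m ⊗ₜ[k] a) = rho (m ⊗ₜ[k] H.piRr c a) :=
  hM.op.lam_epsAct m c a

/-- `r m₀ ⊗ a m₁ = m₀ ⊗ a ⊓̄ᴸ(c) m₁` for `r = ⊓ᴿ(c)`. -/
theorem rTensor_epsAct_rho (hM : H.IsComodule lam rho) (m : M) (c a : A) :
    (H.epsAct rho c).rTensor A (rho (m ⊗ₜ[k] a)) = rho (m ⊗ₜ[k] H.piBarLr c a) :=
  hM.op.rTensor_epsAct m c a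

end IsComodule

/-- `A` is a comodule over itself. -/
theorem isComodule_self : H.IsComodule H.T₁ H.T₃ := by
  -- `c x₁ ⊗ x₂ a ⊗ x₃ b = c x₁ ⊗ Δ(x₂)(a ⊗ b)`, by the coassociativity of `T₁` and `T₂`
  have key : ∀ (c x : A) (z : A ⊗[k] A), (LinearMap.mulLeft k c).rTensor (A ⊗[k] A)
      (iterate H.T₁ (x ⊗ₜ[k] z)) =
      (LinearMap.applyₗ (R := k) z ∘ₗ leftPart k (A ⊗[k] A) ∘ₗ H.Δ).lTensor A
        (H.T₂ (c ⊗ₜ[k] x)) := by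
    intro c x z
    induction z with
    | zero => simp
    | add z w hz hw =>
      simp only [map_add, TensorProduct.tmul_add, LinearMap.add_comp, LinearMap.lTensor_add,
        LinearMap.add_apply, hz, hw]
    | tmul a b =>
      have e : (LinearMap.mulLeft k c).rTensor A ∘ₗ evalAt H.T₁ a =
          (LinearMap.mulRight k a).lTensor A ∘ₗ (H.T₂ ∘ₗ TensorProduct.mk k A A c) :=
        LinearMap.ext fun p => H.T₁_T₂ p a c
      have h := lTensor_map_assocMap (LinearMap.mulRight k a) LinearMap.id
        (H.T₂ ∘ₗ TensorProduct.mk k A A c) LinearMap.id (H.T₁ (x ⊗ₜ[k] b))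
      rw [iterate_tmul, rTensor_assocMap, e]
      refine h.symm.trans ?_
      rw [H.coassoc_apply, ← LinearMap.lTensor_comp_apply]
      congr 2
      exact LinearMap.ext fun x => (H.Δ_left_tmul x b a).symm
  refine ⟨fun m a b => H.T₁_T₃ m b a, (H.iterate_T₁_iff _).2 fun x a b => ?_,
    (H.iterate_E_iff _).2 fun x z => ?_⟩
  · refine H.nondeg.rTensor_left fun c => ?_
    rw [key, rTensor_lTensor, T₁_T₂, ← LinearMap.lTensor_comp_apply]
    congr 2
    exact LinearMap.ext fun x => H.Δ_left_T₁ x a b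
  · refine H.nondeg.rTensor_left fun c => ?_
    rw [key, key]
    congr 2
    exact LinearMap.ext fun x => H.Δ_left_E_left x z

end ComoduleBasics

end RegularWMB

end WMB

namespace WMB

namespace RegularWMB

/-! ### The idempotent `E` and the base algebra -/

section BaseAlgebra

variable {k : Type v} [Field k] {A : Type u} [NonUnitalRing A]
    [Module k A] [IsScalarTower k A A] [SMulCommClass k A A] (H : RegularWMB k A)

/-- `E(r ⊗ 1) = E(1 ⊗ ⊓ᴸ(p))` for `r = ⊓̄ᴿ(p)`. -/
theorem E_left_piBarRl (p c q : A) :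
    H.E.left (H.piBarRl p c ⊗ₜ[k] q) = H.E.left (c ⊗ₜ[k] H.piLl p q) := by
  refine H.E_left_eq_of_Δ_left fun g => ?_
  have e : LinearMap.mulRight k (H.piBarRl p c) = LinearMap.mulRight k c ∘ₗ H.epsAct H.T₁ p :=
    LinearMap.ext fun x => H.piBarR_compat p c x
  rw [Δ_left_tmul, Δ_left_tmul, e, LinearMap.rTensor_comp_apply,
    H.isComodule_self.rTensor_epsAct]

/-- `(r ⊗ 1)E = (1 ⊗ ⊓̄ᴸ(p))E` for `r = ⊓ᴿ(p)`. -/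
theorem E_right_piRr (p c q : A) :
    H.E.right (H.piRr p c ⊗ₜ[k] q) = H.E.right (c ⊗ₜ[k] H.piBarLr p q) :=
  H.op.E_left_piBarRl p c q

theorem lift_piLl (y : A ⊗[k] A) :
    TensorProduct.lift H.piLl y = sliceL A H.ε (H.E.left y) := by
  induction y with
  | zero => simp
  | tmul a b => rfl
  | add x y hx hy => simp only [map_add, hx, hy]

theorem lift_piBarLr (y : A ⊗[k] A) :
    TensorProduct.lift H.piBarLr y = sliceL A H.ε (H.E.right y) := by
  induction y with
  | zero => simp
  | tmul a b => rfl
  | add x y hx hy => simp only [map_add, hx, hy]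

/-- `⊓ᴸ(a₁)a₂ = a`. -/
theorem lift_piLl_T₁ (z : A ⊗[k] A) :
    TensorProduct.lift H.piLl (H.T₁ z) = LinearMap.mul' k A z := by
  rw [lift_piLl, E_left_T₁, ← H.counit_left, LinearMap.comp_apply]

/-- `a₂⊓̄ᴸ(a₁) = a`. -/
theorem lift_piBarLr_T₃ (a b : A) :
    TensorProduct.lift H.piBarLr (H.T₃ (a ⊗ₜ[k] b)) = b * a := by
  have h : H.E.right (H.T₃ (a ⊗ₜ[k] b)) = H.T₃ (a ⊗ₜ[k] b) := H.op.E_left_T₁ (a ⊗ₜ[k] b)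
  rw [lift_piBarLr, h, sliceL_T₃]

/-- `(A ⊗ ε ⊗ A)((1 ⊗ E)(E ⊗ 1)) = E(⊓̄ᴿ(-) ⊗ 1)`. -/
theorem sliceR_leg23_E (y : A ⊗[k] A) (d : A) :
    (sliceR A H.ε).rTensor A (leg23 A H.E.left (H.E.left y ⊗ₜ[k] d)) =
      H.E.left (sliceR A H.ε (H.E.left y) ⊗ₜ[k] d) := by
  refine H.E_left_induction (p := fun z =>
    (sliceR A H.ε).rTensor A (leg23 A H.E.left (z ⊗ₜ[k] d)) =
      H.E.left (sliceR A H.ε z ⊗ₜ[k] d)) ?_ ?_ ?_ ?_ y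
  · simp
  · intro x y hx hy
    simp only [TensorProduct.add_tmul, map_add, hx, hy]
  · intro c x hx
    rw [← TensorProduct.smul_tmul', map_smul, map_smul, hx, map_smul, ← TensorProduct.smul_tmul',
      map_smul]
  · intro a b c
    have e : sliceR A H.ε ∘ₗ ((LinearMap.applyₗ (R := k) (b ⊗ₜ[k] c) ∘ₗ
        leftPart k (A ⊗[k] A)) ∘ₗ H.Δ) =
        LinearMap.mulRight k (sliceR A H.ε (H.E.left (b ⊗ₜ[k] c))) :=
      LinearMap.ext fun x => H.sliceR_Δ_left x _
    rw [H.E_three_left, ← LinearMap.rTensor_comp_apply, e, sliceR_Δ_left,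
      ← Multiplier.left_rTensor H.nondeg]
    simp

/-- If `E t = t`, then `E` fixes `⊓̄ᴿ(t₁)c ⊗ t₂`: slice the middle leg of
`(1 ⊗ E)(E ⊗ 1) = (E ⊗ 1)(1 ⊗ E)` by `ε`. -/
theorem E_left_rTensor_piBarRl (c : A) {t : A ⊗[k] A} (ht : H.E.left t = t) :
    H.E.left ((H.piBarRl.flip c).rTensor A t) = (H.piBarRl.flip c).rTensor A t := by
  have h₁ : ∀ t : A ⊗[k] A, (sliceR A H.ε).rTensor A (leg23 A H.E.left
      (H.E.left.rTensor A ((TensorProduct.assoc k A A A).symm (c ⊗ₜ[k] t)))) =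
      H.E.left ((H.piBarRl.flip c).rTensor A t) := by
    intro t
    induction t with
    | zero => simp
    | add x y hx hy => simp only [TensorProduct.tmul_add, map_add, hx, hy]
    | tmul y d =>
      rw [TensorProduct.assoc_symm_tmul, LinearMap.rTensor_tmul, sliceR_leg23_E,
        LinearMap.rTensor_tmul]
      rfl
  have h₂ : ∀ t : A ⊗[k] A, (sliceR A H.ε).rTensor A
      (H.E.left.rTensor A ((TensorProduct.assoc k A A A).symm (c ⊗ₜ[k] t))) =
      (H.piBarRl.flip c).rTensor A t := by
    intro t
    induction t with
    | zero => simp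
    | add x y hx hy => simp only [TensorProduct.tmul_add, map_add, hx, hy]
    | tmul y d =>
      rw [TensorProduct.assoc_symm_tmul, LinearMap.rTensor_tmul, LinearMap.rTensor_tmul,
        LinearMap.rTensor_tmul]
      rfl
  have h₃ : leg23 A H.E.left ((TensorProduct.assoc k A A A).symm (c ⊗ₜ[k] t)) =
      (TensorProduct.assoc k A A A).symm (c ⊗ₜ[k] t) := by
    simp [leg23, ht]
  rw [← h₁, ← LinearMap.comp_apply (leg23 A H.E.left), ← H.E_comm_left, LinearMap.comp_apply, h₃,
    h₂]

/-- `E(1 ⊗ ab) = ⊓̄ᴿ(a₁) ⊗ a₂ b`, an element of `R ⊗ A`. -/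
theorem rTensor_piBarRl_T₁ (c : A) (z : A ⊗[k] A) :
    (H.piBarRl.flip c).rTensor A (H.T₁ z) = H.E.left (c ⊗ₜ[k] LinearMap.mul' k A z) := by
  rw [← H.E_left_rTensor_piBarRl c (H.E_left_T₁ z), ← lift_piLl_T₁]
  generalize H.T₁ z = t
  induction t with
  | zero => simp
  | add x y hx hy => simp only [TensorProduct.tmul_add, map_add, hx, hy]
  | tmul p q =>
    rw [LinearMap.rTensor_tmul, TensorProduct.lift.tmul, LinearMap.flip_apply, E_left_piBarRl]

/-- `(1 ⊗ ba)E = ⊓ᴿ(a₁) ⊗ b a₂`, an element of `R ⊗ A`. -/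
theorem rTensor_piRr_T₃ (c a b : A) :
    (H.piRr.flip c).rTensor A (H.T₃ (a ⊗ₜ[k] b)) = H.E.right (c ⊗ₜ[k] (b * a)) := by
  exact (H.op.rTensor_piBarRl_T₁ c (a ⊗ₜ[k] b)).trans
    (congrArg (fun x : A => H.E.right (c ⊗ₜ[k] x)) (LinearMap.mul'_apply (R := k) (A := Op A)))

theorem rTensor_piRr_T₃_tw (c : A) (z : A ⊗[k] A) :
    (H.piRr.flip c).rTensor A (H.T₃ (tw A A z)) = H.E.right (c ⊗ₜ[k] LinearMap.mul' k A z) := by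
  induction z with
  | zero => simp
  | add x y hx hy => simp only [TensorProduct.tmul_add, map_add, hx, hy]
  | tmul a b => rw [tw_tmul, rTensor_piRr_T₃, LinearMap.mul'_apply]

/-- Every `⊓ᴿ(x)` is some `⊓̄ᴿ(y)`: the element `w = (1 ⊗ x)E` of `𝕄(A) ⊗ A` multiplied by `1 ⊗ d`
is `(1 ⊗ x)(E(1 ⊗ d))`, which has its first leg in the range of `⊓̄ᴿ`. Since `A` is non-degenerate,
so has `w`. -/
theorem piR_mem_range_piBarR (x : A) : H.piR x ∈ LinearMap.range H.piBarR := by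
  obtain ⟨z, rfl⟩ := H.idempotent x
  set S := LinearMap.range H.piBarR
  set w := H.piR.rTensor A (H.T₃ (tw A A z)) with hw
  have h₁ : H.piR (LinearMap.mul' k A z) = sliceR _ H.ε w := by
    refine Multiplier.ext_right H.nondeg fun c => ?_
    have e : (LinearMap.applyₗ (R := k) c ∘ₗ rightPart k A) ∘ₗ H.piR = H.piRr.flip c :=
      LinearMap.ext fun x => by
        rw [LinearMap.flip_apply, ← piR_right]
        rfl
    have h := sliceR_rTensor H.ε (LinearMap.applyₗ (R := k) c ∘ₗ rightPart k A) w
    rw [hw, ← LinearMap.rTensor_comp_apply, e, rTensor_piRr_T₃_tw] at h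
    rw [piR_right, piRr_apply, h]
    rfl
  have h₂ : S.mkQ.rTensor A w = 0 := by
    refine eq_zero_of_lTensor (fun a : A => LinearMap.mulRight k a)
      (fun n hn => H.nondeg.left n hn) _ fun d => ?_
    obtain ⟨z', rfl⟩ := H.idempotent d
    have h₃ : (LinearMap.mulRight k (LinearMap.mul' k A z')).lTensor _ w =
        (LinearMap.mulLeft k (LinearMap.mul' k A z)).lTensor _
          (H.piBarR.rTensor A (H.T₁ z')) := by
      refine eq_of_rTensor (fun c : A × A => LinearMap.mulLeft k c.1 ∘ₗ
        LinearMap.applyₗ (R := k) c.2 ∘ₗ leftPart k A) (fun n hn => ?_) fun c => ?_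
      · refine Multiplier.ext_left H.nondeg fun b => H.nondeg.eq_of_mul_left fun a => ?_
        exact (hn (a, b)).trans (mul_zero a).symm
      · have e₁ : (LinearMap.mulLeft k c.1 ∘ₗ LinearMap.applyₗ (R := k) c.2 ∘ₗ leftPart k A) ∘ₗ
            H.piR = LinearMap.mulRight k c.2 ∘ₗ H.piRr.flip c.1 := by
          refine LinearMap.ext fun x => ?_
          have := (H.piR x).compat c.1 c.2
          rw [piR_right] at this
          exact this
        have e₂ : (LinearMap.mulLeft k c.1 ∘ₗ LinearMap.applyₗ (R := k) c.2 ∘ₗ leftPart k A) ∘ₗ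
            H.piBarR = LinearMap.mulLeft k c.1 ∘ₗ H.piBarRl.flip c.2 := by
          refine LinearMap.ext fun x => ?_
          rw [LinearMap.comp_apply, LinearMap.comp_apply, LinearMap.comp_apply,
            LinearMap.comp_apply, LinearMap.flip_apply, ← piBarR_left]
          rfl
        rw [rTensor_lTensor, rTensor_lTensor, hw, ← LinearMap.rTensor_comp_apply,
          ← LinearMap.rTensor_comp_apply, e₁, e₂, LinearMap.rTensor_comp_apply,
          LinearMap.rTensor_comp_apply, rTensor_piRr_T₃_tw, rTensor_piBarRl_T₁, ← mul_tmul_eq,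
          ← tmul_mul_eq, Multiplier.compat]
    have e₃ : S.mkQ ∘ₗ H.piBarR = 0 := by
      refine LinearMap.ext fun x => ?_
      rw [LinearMap.comp_apply, Submodule.mkQ_apply, LinearMap.zero_apply,
        Submodule.Quotient.mk_eq_zero]
      exact ⟨x, rfl⟩
    rw [← rTensor_lTensor, h₃, rTensor_lTensor, ← LinearMap.rTensor_comp_apply, e₃]
    simp
  rw [← Submodule.Quotient.mk_eq_zero, h₁, ← Submodule.mkQ_apply, ← sliceR_rTensor, h₂, map_zero]

theorem exists_piR_eq (x : A) : ∃ y, H.piRl x = H.piBarRl y ∧ H.piRr x = H.piBarRr y := by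
  obtain ⟨y, hy⟩ := H.piR_mem_range_piBarR x
  exact ⟨y, by rw [← piR_left, ← hy, piBarR_left], by rw [← piR_right, ← hy, piBarR_right]⟩

theorem exists_piBarR_eq (x : A) : ∃ y, H.piBarRl x = H.piRl y ∧ H.piBarRr x = H.piRr y := by
  obtain ⟨y, h₁, h₂⟩ := H.op.exists_piR_eq x
  exact ⟨y, h₂, h₁⟩

/-- The ranges of `⊓̄ᴿ` and `⊓ᴿ` coincide. -/
theorem range_piBarR : LinearMap.range H.piBarR = H.base := by
  refine le_antisymm ?_ ?_
  · rintro _ ⟨x, rfl⟩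
    obtain ⟨y, h₁, h₂⟩ := H.exists_piBarR_eq x
    refine ⟨y, Multiplier.ext' ?_ ?_⟩
    · rw [piR_left, piBarR_left, h₁]
    · rw [piR_right, piBarR_right, h₂]
  · rintro _ ⟨x, rfl⟩
    exact H.piR_mem_range_piBarR x

/-- `⊓̄ᴿ(p) = 0` implies `⊓ᴸ(p) = 0`, since both conditions involve `p` only through the functional
`x ↦ ε(x p)`. -/
theorem piLl_eq_zero {p : A} (h : H.piBarRr p = 0) : H.piLl p = 0 := by
  have hε : H.ε ∘ₗ LinearMap.mulRight k p = 0 := LinearMap.ext fun (x : A) => by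
    rw [LinearMap.comp_apply, LinearMap.mulRight_apply, ← H.sliceL_T₁,
      apply_sliceL_eq_apply_sliceR, ← piBarRr_apply, h]
    simp
  have hr : ∀ c, H.piLr p c = 0 := fun c => H.nondeg.right _ fun d => by
    have h := congrArg (sliceL (k := k) A H.ε) (H.T₄_T₃ p c d)
    rw [sliceL_lTensor, sliceL_rTensor, hε, ← piLr_apply] at h
    rw [LinearMap.mulLeft_apply] at h
    rw [h]
    simp [sliceL]
  refine LinearMap.ext fun c => H.nondeg.right _ fun b => ?_
  rw [piL_compat, hr, zero_mul]

/-- The map `⊓ᴿ(p) ↦ ⊓̄ᴸ(p)` is well defined. -/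
theorem piBarLr_eq_zero {p : A} (h : H.piRl p = 0) : H.piBarLr p = 0 :=
  H.op.piLl_eq_zero h

/-- `E` commutes with `1 ⊗ ⊓̄ᴿ(a)`. -/
theorem E_left_lTensor_piBarRl (a b x : A) :
    H.E.left (b ⊗ₜ[k] H.piBarRl a x) = (H.piBarRl a).lTensor A (H.E.left (b ⊗ₜ[k] x)) := by
  have h := congrArg (fun z => sliceR (A ⊗[k] A) H.ε z)
    (LinearMap.congr_fun H.E_comm_left ((b ⊗ₜ[k] x) ⊗ₜ[k] a))
  have e : ∀ z : A ⊗[k] A, sliceR (A ⊗[k] A) H.ε (leg23 A H.E.left (z ⊗ₜ[k] a)) =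
      (H.piBarRl a).lTensor A z := by
    intro z
    induction z with
    | zero => simp
    | add x y hx hy => simp only [TensorProduct.add_tmul, map_add, hx, hy]
    | tmul p q =>
      simp only [leg23, LinearMap.comp_apply, LinearEquiv.coe_coe, TensorProduct.assoc_tmul,
        LinearMap.lTensor_tmul, piBarRl_apply]
      generalize H.E.left (q ⊗ₜ[k] a) = y
      induction y with
      | zero => simp
      | tmul p q => simp
      | add x y hx hy => simp only [TensorProduct.tmul_add, map_add, hx, hy]
  simp only [LinearMap.comp_apply, LinearMap.rTensor_tmul] at h
  rwa [sliceR_rTensor, e, e, LinearMap.lTensor_tmul] at h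

/-- `⊓ᴸ(b)` and `⊓̄ᴿ(a)` commute. -/
theorem piLl_piBarRl (a b x : A) : H.piLl b (H.piBarRl a x) = H.piBarRl a (H.piLl b x) := by
  have h := congrArg (sliceL A H.ε) (H.E_left_lTensor_piBarRl a b x)
  rwa [sliceL_lTensor] at h

theorem piBarLr_piRr (a b x : A) : H.piBarLr b (H.piRr a x) = H.piRr a (H.piBarLr b x) :=
  H.op.piLl_piBarRl a b x

theorem piBarRr_piBarRl (a q c : A) :
    H.piBarRr (H.piBarRl q a) c = H.piBarRr a (H.piBarRr q c) :=
  (congrArg (sliceR A H.ε) (H.isComodule_self.lam_epsAct c q a)).symm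

/-- `⊓ᴿ(a r) = ⊓ᴿ(a) r` for `r = ⊓ᴿ(q)`. -/
theorem piRl_piRr (a q c : A) : H.piRl (H.piRr q a) c = H.piRl a (H.piRl q c) :=
  H.op.piBarRr_piBarRl a q c

theorem ε_piRl (x y : A) : H.ε (H.piRl x y) = H.ε (x * y) := by
  rw [piRl_apply, ← apply_sliceL_eq_apply_sliceR, sliceL_T₃]

theorem piLl_piLl (a b x : A) : H.piLl b (H.piLl a x) = H.piLl (H.piBarRl a b) x :=
  (congrArg (sliceL A H.ε) (H.E_left_piBarRl a b x)).symm

/-- Local units: every `d` is some `⊓ᴸ(b)d`. The subspace `S = ⊓ᴸ(A)d` is stable under `⊓ᴸ(A)`. As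
`E(c ⊗ d)` lies in `A ⊗ S`, the element `⊓̄ᴿ(d₁) ⊗ d₂ = E(1 ⊗ d)` vanishes modulo `S` in the second
leg, hence so does `⊓ᴸ(d₁)d₂ = d`. -/
theorem exists_piLl_eq_self (d : A) : ∃ b, H.piLl b d = d := by
  set S := LinearMap.range (H.piLl.flip d) with hS
  have hstab : ∀ p, S ≤ S.comap (H.piLl p) := by
    rintro p _ ⟨b, rfl⟩
    exact ⟨H.piBarRl b p, (H.piLl_piLl b p d).symm⟩
  obtain ⟨z, hz⟩ := H.idempotent d
  -- `E(1 ⊗ d)` vanishes modulo `S`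
  have h₁ : H.piBarR.rTensor _ (S.mkQ.lTensor A (H.T₁ z)) = 0 := by
    refine eq_zero_of_rTensor (fun c : A => LinearMap.applyₗ (R := k) c ∘ₗ leftPart k A)
      (fun w hw => Multiplier.ext_left H.nondeg hw) _ fun c => ?_
    have e : (LinearMap.applyₗ (R := k) c ∘ₗ leftPart k A) ∘ₗ H.piBarR = H.piBarRl.flip c :=
      LinearMap.ext fun x => by
        rw [LinearMap.flip_apply, ← piBarR_left]
        rfl
    rw [← LinearMap.rTensor_comp_apply, e, rTensor_lTensor, rTensor_piBarRl_T₁, hz]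
    clear e
    obtain ⟨y, rfl⟩ := H.idempotent c
    induction y with
    | zero => simp
    | add x y hx hy => simp only [map_add, TensorProduct.add_tmul, hx, hy, add_zero]
    | tmul a b =>
      have e' : S.mkQ ∘ₗ H.piLl.flip d = 0 := LinearMap.ext fun x => by
        rw [LinearMap.comp_apply, Submodule.mkQ_apply, LinearMap.zero_apply,
          Submodule.Quotient.mk_eq_zero]
        exact ⟨x, rfl⟩
      rw [LinearMap.mul'_apply, ← lTensor_piLl_T₄, ← LinearMap.lTensor_comp_apply, e']
      simp
  -- the map `p ⊗ [x] ↦ [⊓ᴸ(p)x]`, which factors through `⊓̄ᴿ(p) ⊗ [x]`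
  let B : A ⊗[k] (A ⧸ S) →ₗ[k] A ⧸ S := TensorProduct.lift
    { toFun := fun p => S.mapQ S (H.piLl p) (hstab p)
      map_add' := fun p q => by
        ext x
        simp
      map_smul' := fun c p => by
        ext x
        simp }
  have hB : LinearMap.ker (H.piBarR.rTensor (A ⧸ S)) ≤ LinearMap.ker B := by
    refine ker_rTensor_le fun p hp m => ?_
    have h0 : H.piLl p = 0 := H.piLl_eq_zero (by rw [← piBarR_right, hp]; rfl)
    obtain ⟨m, rfl⟩ := S.mkQ_surjective m
    change S.mapQ S (H.piLl p) (hstab p) (S.mkQ m) = 0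
    rw [Submodule.mkQ_apply, Submodule.mapQ_apply, h0]
    simp
  have h₂ : ∀ t : A ⊗[k] A, B (S.mkQ.lTensor A t) = S.mkQ (TensorProduct.lift H.piLl t) := by
    intro t
    induction t with
    | zero => simp
    | tmul a b => rfl
    | add x y hx hy => simp only [map_add, hx, hy]
  have h₃ := h₂ (H.T₁ z)
  rw [lift_piLl_T₁, hz, hB h₁] at h₃
  have h₄ : d ∈ S := by
    rw [← Submodule.Quotient.mk_eq_zero, ← Submodule.mkQ_apply, ← h₃]
  exact h₄

/-- Local units: any finitely many elements of `A` are fixed by some `⊓ᴸ(b)`. -/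
theorem exists_forall_piLl_eq_self (s : Finset A) : ∃ b, ∀ d ∈ s, H.piLl b d = d := by
  classical
  induction s using Finset.induction_on with
  | empty => exact ⟨0, by simp⟩
  | insert d s _ ih =>
    obtain ⟨b, hb⟩ := ih
    obtain ⟨b', hb'⟩ := H.exists_piLl_eq_self (d - H.piLl b d)
    -- the element corresponding to `l' + l - l' l`
    refine ⟨b' + b - H.piBarRl b b', fun x hx => ?_⟩
    rw [map_sub, map_add, LinearMap.sub_apply, LinearMap.add_apply, ← piLl_piLl]
    rcases Finset.mem_insert.1 hx with rfl | hx
    · rw [map_sub] at hb'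
      rw [add_sub_right_comm, hb', sub_add_cancel]
    · rw [hb x hx, add_sub_cancel_left]

/-- The slice by `ε` of the first leg of the coassociativity of `T₁` and `T₂`. -/
theorem T₁_piBarLl (a c b : A) :
    H.T₁ (H.piBarLl a c ⊗ₜ[k] b) = (H.piBarLl a).rTensor A (H.T₁ (c ⊗ₜ[k] b)) := by
  have h := congrArg (sliceL (A ⊗[k] A) H.ε) (H.coassoc_apply a c b)
  rw [sliceL_assocMap_left, sliceL_lTensor] at h
  exact h.symm

/-- `Δ(l c) = (l ⊗ 1)Δ(c)` for `l = ⊓̄ᴸ(a)`. -/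
theorem Δ_left_piBarLl (a c : A) (w : A ⊗[k] A) :
    (H.Δ (H.piBarLl a c)).left w = (H.piBarLl a).rTensor A ((H.Δ c).left w) := by
  induction w with
  | zero => simp
  | add x y hx hy => simp only [map_add, hx, hy]
  | tmul s q =>
    have e : LinearMap.mulRight k s ∘ₗ H.piBarLl a = H.piBarLl a ∘ₗ LinearMap.mulRight k s :=
      LinearMap.ext fun x => by
        have := (H.piBarL a).left_mul H.nondeg x s
        rw [piBarL_left] at this
        exact this.symm
    rw [Δ_left_tmul, Δ_left_tmul, T₁_piBarLl, ← LinearMap.rTensor_comp_apply, e,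
      LinearMap.rTensor_comp_apply]

end BaseAlgebra

end RegularWMB

end WMB

namespace WMB

namespace RegularWMB

/-! ### The actions of the base algebra on comodules -/

section FullComodules

variable {k : Type v} [Field k] {A : Type u} [NonUnitalRing A]
    [Module k A] [IsScalarTower k A A] [SMulCommClass k A A] (H : RegularWMB k A)
  {M : Type u} [AddCommGroup M] [Module k M] {N : Type u} [AddCommGroup N] [Module k N]

theorem coe_piR' (a : A) : (H.piR' a).1 = H.piR a := rfl

theorem coe_piBarR' (a : A) : (H.piBarR' a).1 = H.piBarR a :=
  LinearMap.congr_fun (corestrict_comp (i := H.base.subtype) (g := H.piBarR)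
    (by rw [Submodule.range_subtype, range_piBarR])) a

theorem exists_piR'_eq (r : H.base) : ∃ a, H.piR' a = r :=
  H.piR.surjective_rangeRestrict r

theorem exists_piBarR'_eq (r : H.base) : ∃ a, H.piBarR' a = r := by
  have h : r.1 ∈ LinearMap.range H.piBarR := by rw [range_piBarR]; exact r.2
  obtain ⟨a, ha⟩ := h
  exact ⟨a, Subtype.ext ((H.coe_piBarR' a).trans ha)⟩

/-- `τ` is the well-defined map `⊓ᴿ(a) ↦ ⊓̄ᴸ(a)`. -/
theorem tau_piR' (a : A) : H.tau (H.piR' a) = H.piBarL a := by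
  refine descend_apply (fun x hx => ?_) a
  rw [LinearMap.mem_ker] at hx ⊢
  have h : H.piRl x = 0 := by rw [← piR_left, ← coe_piR', hx]; rfl
  refine Multiplier.ext_right H.nondeg fun b => ?_
  rw [piBarL_right, H.piBarLr_eq_zero h]
  rfl

namespace IsComodule

variable {H} {lam rho : M ⊗[k] A →ₗ[k] M ⊗[k] A}

/-- If the first legs of `λ` span `M`, then every `y` is some `y ⊓̄ᴿ(b)`: write `y` with finitely many
`ω(m₁ a)m₀` and choose a local unit `⊓ᴸ(b)` for the elements `a`. -/
theorem exists_epsAct_eq_self (hM : H.IsComodule lam rho)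
    (hs : Submodule.span k {x | ∃ (ω : A →ₗ[k] k) (m : M) (a : A),
      x = sliceR M ω (lam (m ⊗ₜ[k] a))} = ⊤) (y : M) : ∃ b, H.epsAct lam b y = y := by
  classical
  suffices h : ∃ s : Finset A, ∀ b, (∀ d ∈ s, H.piLl b d = d) → H.epsAct lam b y = y by
    obtain ⟨s, h⟩ := h
    obtain ⟨b, hb⟩ := H.exists_forall_piLl_eq_self s
    exact ⟨b, h b hb⟩
  have hy : y ∈ (⊤ : Submodule k M) := trivial
  rw [← hs] at hy
  induction hy using Submodule.span_induction with
  | mem x hx =>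
    obtain ⟨ω, m, a, rfl⟩ := hx
    refine ⟨{a}, fun b hb => ?_⟩
    rw [← sliceR_rTensor, hM.rTensor_epsAct, hb a (by simp)]
  | zero => exact ⟨∅, by simp⟩
  | add x y _ _ hx hy =>
    obtain ⟨s, hs⟩ := hx
    obtain ⟨t, ht⟩ := hy
    refine ⟨s ∪ t, fun b hb => ?_⟩
    rw [map_add, hs b fun d hd => hb d (Finset.mem_union_left _ hd),
      ht b fun d hd => hb d (Finset.mem_union_right _ hd)]
  | smul c x _ hx =>
    obtain ⟨s, hs⟩ := hx
    exact ⟨s, fun b hb => by rw [map_smul, hs b hb]⟩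

/-- `m₀ ⊗ ⊓̄ᴿ(m₂ a) m₁ d = λ(m ⊓̄ᴿ(a) ⊗ d)`. -/
theorem lTensor_lift_iterate (hM : H.IsComodule lam rho) (m : M) (d a : A) :
    (TensorProduct.lift H.piBarRl.flip).lTensor M (iterate lam (m ⊗ₜ[k] (d ⊗ₜ[k] a))) =
      lam (H.epsAct lam a m ⊗ₜ[k] d) := by
  have e : TensorProduct.lift H.piBarRl.flip = sliceR A H.ε ∘ₗ H.E.left :=
    TensorProduct.ext' fun x y => rfl
  rw [e, LinearMap.lTensor_comp_apply, hM.iterate_E_left, iterate_tmul, sliceR_assocMap]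
  rfl

theorem rho_eq_zero (hM : H.IsComodule lam rho) {y : M} (h : ∀ a, lam (y ⊗ₜ[k] a) = 0) (a : A) :
    rho (y ⊗ₜ[k] a) = 0 :=
  H.nondeg.lTensor_right fun b => by rw [← hM.compat, h, map_zero, map_zero]

end IsComodule

/-- `A` is a full comodule if the comultiplication is right full. -/
theorem RightFull.isFullComodule (hfull : H.RightFull) : H.IsFullComodule H.T₁ H.T₃ :=
  ⟨H.isComodule_self.compat, H.isComodule_self.coassoc, H.isComodule_self.normalized,
    Or.inl hfull⟩

namespace IsFullComodule

variable {H} {lam rho : M ⊗[k] A →ₗ[k] M ⊗[k] A}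

/-- The elements `y` of a full comodule are determined by `λ(y ⊗ -)`, as every `y` is some
`(M ⊗ ε)λ(y ⊗ b)` or `(M ⊗ ε)ϱ(y ⊗ b)`. -/
theorem eq_zero_of_lam (h : H.IsFullComodule lam rho) {y : M} (hy : ∀ a, lam (y ⊗ₜ[k] a) = 0) :
    y = 0 := by
  rcases h.full with hf | hf
  · obtain ⟨b, hb⟩ := h.isComodule.exists_epsAct_eq_self hf y
    rw [← hb, epsAct_apply, hy, map_zero]
  · have hb : ∃ b : A, H.epsAct rho b y = y := h.isComodule.op.exists_epsAct_eq_self hf y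
    obtain ⟨b, hb⟩ := hb
    rw [← hb, epsAct_apply, h.isComodule.rho_eq_zero hy, map_zero]

theorem eq_of_lam (h : H.IsFullComodule lam rho) {y z : M}
    (hy : ∀ a, lam (y ⊗ₜ[k] a) = lam (z ⊗ₜ[k] a)) : y = z := by
  rw [← sub_eq_zero]
  exact h.eq_zero_of_lam fun a => by rw [TensorProduct.sub_tmul, map_sub, hy, sub_self]

theorem eq_of_rho (h : H.IsFullComodule lam rho) {y z : M}
    (hy : ∀ a, rho (y ⊗ₜ[k] a) = rho (z ⊗ₜ[k] a)) : y = z := by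
  rw [← sub_eq_zero]
  refine h.eq_zero_of_lam (h.isComodule.op.rho_eq_zero fun a => ?_)
  exact (congrArg rho (TensorProduct.sub_tmul y z a)).trans
    ((map_sub rho _ _).trans (sub_eq_zero.2 (hy a)))

theorem epsAct_lam_eq_zero (h : H.IsFullComodule lam rho) {c : A} (hc : H.piBarR' c = 0) (m : M) :
    H.epsAct lam c m = 0 :=
  h.eq_zero_of_lam fun a => by
    rw [h.isComodule.lam_epsAct, ← piBarR_left, ← coe_piBarR', hc]
    exact (congrArg lam (TensorProduct.tmul_zero A m)).trans (map_zero lam)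

theorem epsAct_rho_eq_zero (h : H.IsFullComodule lam rho) {c : A} (hc : H.piR' c = 0) (m : M) :
    H.epsAct rho c m = 0 :=
  h.eq_of_rho fun a => by
    rw [h.isComodule.rho_epsAct, ← piR_right, ← coe_piR', hc, TensorProduct.zero_tmul, map_zero]
    exact (congrArg rho (TensorProduct.tmul_zero A m)).trans (map_zero rho)

theorem right_piBarR' (h : H.IsFullComodule lam rho) (m : M) (c : A) :
    (H.comoduleBaseAction lam rho).right (m ⊗ₜ[k] H.piBarR' c) = H.epsAct lam c m :=
  descend_apply (p := H.piBarR'.lTensor M) (g := sliceR M H.ε ∘ₗ lam)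
    (ker_lTensor_le fun _ hx m => h.epsAct_lam_eq_zero hx m) (m ⊗ₜ[k] c)

theorem left_piR' (h : H.IsFullComodule lam rho) (m : M) (c : A) :
    (H.comoduleBaseAction lam rho).left (H.piR' c ⊗ₜ[k] m) = H.epsAct rho c m := by
  refine (descend_apply (p := H.piR'.rTensor M) (g := sliceR M H.ε ∘ₗ rho ∘ₗ tw A M)
    (ker_rTensor_le fun x hx m => ?_) (c ⊗ₜ[k] m)).trans ?_
  · rw [LinearMap.comp_apply, LinearMap.comp_apply, tw_tmul]
    exact h.epsAct_rho_eq_zero hx m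
  · rw [LinearMap.comp_apply, LinearMap.comp_apply, tw_tmul]
    rfl

/-- `λ(m r ⊗ a) = λ(m ⊗ r a)`. -/
theorem lam_right (h : H.IsFullComodule lam rho) (m : M) (r : H.base) (a : A) :
    lam ((H.comoduleBaseAction lam rho).right (m ⊗ₜ[k] r) ⊗ₜ[k] a) =
      lam (m ⊗ₜ[k] r.1.left a) := by
  obtain ⟨c, rfl⟩ := H.exists_piBarR'_eq r
  rw [h.right_piBarR', h.isComodule.lam_epsAct, coe_piBarR', piBarR_left]

/-- `ϱ(r m ⊗ a) = ϱ(m ⊗ a r)`. -/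
theorem rho_left (h : H.IsFullComodule lam rho) (m : M) (r : H.base) (a : A) :
    rho ((H.comoduleBaseAction lam rho).left (r ⊗ₜ[k] m) ⊗ₜ[k] a) =
      rho (m ⊗ₜ[k] r.1.right a) := by
  obtain ⟨c, rfl⟩ := H.exists_piR'_eq r
  rw [h.left_piR', h.isComodule.rho_epsAct, coe_piR', piR_right]

theorem mulLeft_comp_left (w : Multiplier k A) (a : A) :
    LinearMap.mulLeft k a ∘ₗ w.left = LinearMap.mulLeft k (w.right a) :=
  LinearMap.ext fun b => w.compat a b

theorem mulRight_comp_right (w : Multiplier k A) (b : A) :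
    LinearMap.mulRight k b ∘ₗ w.right = LinearMap.mulRight k (w.left b) :=
  LinearMap.ext fun a => (w.compat a b).symm

/-- `λ(r m ⊗ a) = (1 ⊗ r)λ(m ⊗ a)`. -/
theorem lam_left (h : H.IsFullComodule lam rho) (m : M) (r : H.base) (a : A) :
    lam ((H.comoduleBaseAction lam rho).left (r ⊗ₜ[k] m) ⊗ₜ[k] a) =
      r.1.left.lTensor M (lam (m ⊗ₜ[k] a)) :=
  H.nondeg.lTensor_left fun c => by
    rw [h.compat, h.rho_left, ← h.compat, ← LinearMap.lTensor_comp_apply, mulLeft_comp_left]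

/-- `ϱ(m r ⊗ a) = ϱ(m ⊗ a)(1 ⊗ r)`. -/
theorem rho_right (h : H.IsFullComodule lam rho) (m : M) (r : H.base) (a : A) :
    rho ((H.comoduleBaseAction lam rho).right (m ⊗ₜ[k] r) ⊗ₜ[k] a) =
      r.1.right.lTensor M (rho (m ⊗ₜ[k] a)) :=
  H.nondeg.lTensor_right fun c => by
    rw [← h.compat, h.lam_right, h.compat, ← LinearMap.lTensor_comp_apply, mulRight_comp_right]

/-- `r m₀ ⊗ a m₁ = m₀ ⊗ a τ(r) m₁`. -/
theorem rTensor_left_rho (h : H.IsFullComodule lam rho) (m : M) (r : H.base) (a : A) :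
    ((H.comoduleBaseAction lam rho).left ∘ₗ TensorProduct.mk k H.base M r).rTensor A
      (rho (m ⊗ₜ[k] a)) = rho (m ⊗ₜ[k] (H.tau r).right a) := by
  obtain ⟨c, rfl⟩ := H.exists_piR'_eq r
  have e : (H.comoduleBaseAction lam rho).left ∘ₗ TensorProduct.mk k H.base M (H.piR' c) =
      H.epsAct rho c := LinearMap.ext fun m => h.left_piR' m c
  rw [e, h.isComodule.rTensor_epsAct_rho, tau_piR', piBarL_right]

/-- `m₀ ⊓ᴿ(c m₁) = ⊓ᴿ(c) m`. -/
theorem right_rho (h : H.IsFullComodule lam rho) (m : M) (c : A) :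
    (H.comoduleBaseAction lam rho).right (H.piR'.lTensor M (rho (m ⊗ₜ[k] c))) =
      (H.comoduleBaseAction lam rho).left (H.piR' c ⊗ₜ[k] m) := by
  rw [h.left_piR']
  refine h.eq_of_rho fun a => ?_
  have key : (TensorProduct.lift H.piRr.flip).lTensor M (iterate rho (m ⊗ₜ[k] (a ⊗ₜ[k] c))) =
      rho (H.epsAct rho c m ⊗ₜ[k] a) := h.isComodule.op.lTensor_lift_iterate m a c
  rw [← key, iterate_tmul]
  generalize rho (m ⊗ₜ[k] c) = z
  induction z with
  | zero => simp
  | add x y hx hy => simp only [map_add, TensorProduct.add_tmul, hx, hy]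
  | tmul n x =>
    rw [LinearMap.lTensor_tmul, h.rho_right, assocMap_tmul, evalAt_apply, coe_piR', piR_right]
    generalize rho (n ⊗ₜ[k] a) = z
    induction z with
    | zero => simp
    | add x y hx hy => simp only [map_add, TensorProduct.add_tmul, hx, hy]
    | tmul n y => simp

/-- `⊓̄ᴿ(m₁ c) m₀ = m ⊓̄ᴿ(c)`. -/
theorem left_lam (h : H.IsFullComodule lam rho) (m : M) (c : A) :
    (H.comoduleBaseAction lam rho).left (H.piBarR'.rTensor M (tw M A (lam (m ⊗ₜ[k] c)))) =
      (H.comoduleBaseAction lam rho).right (m ⊗ₜ[k] H.piBarR' c) := by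
  rw [h.right_piBarR']
  refine h.eq_of_lam fun a => ?_
  rw [← h.isComodule.lTensor_lift_iterate m a c, iterate_tmul]
  generalize lam (m ⊗ₜ[k] c) = z
  induction z with
  | zero => simp
  | add x y hx hy => simp only [map_add, TensorProduct.add_tmul, hx, hy]
  | tmul n x =>
    rw [tw_tmul, LinearMap.rTensor_tmul, h.lam_left, assocMap_tmul, evalAt_apply, coe_piBarR',
      piBarR_left]
    generalize lam (n ⊗ₜ[k] a) = z
    induction z with
    | zero => simp
    | add x y hx hy => simp only [map_add, TensorProduct.add_tmul, hx, hy]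
    | tmul n y => simp

variable {lam' rho' : N ⊗[k] A →ₗ[k] N ⊗[k] A} {f : M →ₗ[k] N}

theorem map_lam (hf : IsComoduleMap lam lam' f) (m : M) (a : A) :
    f.rTensor A (lam (m ⊗ₜ[k] a)) = lam' (f m ⊗ₜ[k] a) :=
  LinearMap.congr_fun hf (m ⊗ₜ[k] a)

theorem map_rho (h : H.IsFullComodule lam rho) (h' : H.IsFullComodule lam' rho')
    (hf : IsComoduleMap lam lam' f) (m : M) (a : A) :
    f.rTensor A (rho (m ⊗ₜ[k] a)) = rho' (f m ⊗ₜ[k] a) :=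
  H.nondeg.lTensor_right fun b => by
    rw [← rTensor_lTensor, ← h.compat, rTensor_lTensor, map_lam hf, h'.compat]

theorem map_right (h : H.IsFullComodule lam rho) (h' : H.IsFullComodule lam' rho')
    (hf : IsComoduleMap lam lam' f) (m : M) (r : H.base) :
    f ((H.comoduleBaseAction lam rho).right (m ⊗ₜ[k] r)) =
      (H.comoduleBaseAction lam' rho').right (f m ⊗ₜ[k] r) := by
  obtain ⟨c, rfl⟩ := H.exists_piBarR'_eq r
  rw [h.right_piBarR', h'.right_piBarR', epsAct_apply, epsAct_apply, ← map_lam hf,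
    sliceR_rTensor]

theorem map_left (h : H.IsFullComodule lam rho) (h' : H.IsFullComodule lam' rho')
    (hf : IsComoduleMap lam lam' f) (m : M) (r : H.base) :
    f ((H.comoduleBaseAction lam rho).left (r ⊗ₜ[k] m)) =
      (H.comoduleBaseAction lam' rho').left (r ⊗ₜ[k] f m) := by
  obtain ⟨c, rfl⟩ := H.exists_piR'_eq r
  rw [h.left_piR', h'.left_piR', epsAct_apply, epsAct_apply, ← h.map_rho h' hf,
    sliceR_rTensor]

end IsFullComodule

end FullComodules

end RegularWMB

end WMB

namespace WMB

namespace RegularWMB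

/-! ### Tensor products over the base algebra -/

section TensorR

variable {k : Type v} [Field k] {A : Type u} [NonUnitalRing A]
    [Module k A] [IsScalarTower k A A] [SMulCommClass k A A] {H : RegularWMB k A}
variable {V : Type u} [AddCommGroup V] [Module k V] {W : Type u} [AddCommGroup W] [Module k W]
  {V' : Type u} [AddCommGroup V'] [Module k V'] {W' : Type u} [AddCommGroup W'] [Module k W']
  {Z : Type u} [AddCommGroup Z] [Module k Z] {S : Type*} [AddCommGroup S] [Module k S]

theorem proj_surjective (bV : H.BaseAction V) (bW : H.BaseAction W) :
    Function.Surjective (proj bV bW) :=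
  Submodule.mkQ_surjective _

theorem proj_right (bV : H.BaseAction V) (bW : H.BaseAction W) (v : V) (r : H.base) (w : W) :
    proj bV bW (bV.right (v ⊗ₜ[k] r) ⊗ₜ[k] w) = proj bV bW (v ⊗ₜ[k] bW.left (r ⊗ₜ[k] w)) := by
  rw [← sub_eq_zero, ← map_sub]
  exact (Submodule.Quotient.mk_eq_zero _).2 (Submodule.subset_span ⟨v, r, w, rfl⟩)

theorem ker_proj_le {bV : H.BaseAction V} {bW : H.BaseAction W} {g : V ⊗[k] W →ₗ[k] S}
    (h : ∀ v r w, g (bV.right (v ⊗ₜ[k] r) ⊗ₜ[k] w) = g (v ⊗ₜ[k] bW.left (r ⊗ₜ[k] w))) :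
    LinearMap.ker (proj bV bW) ≤ LinearMap.ker g := by
  rw [proj, Submodule.ker_mkQ, balancing, Submodule.span_le]
  rintro _ ⟨v, r, w, rfl⟩
  rw [SetLike.mem_coe, LinearMap.mem_ker, map_sub, h, sub_self]

theorem mapR_proj {bV : H.BaseAction V} {bW : H.BaseAction W} {bV' : H.BaseAction V'}
    {bW' : H.BaseAction W'} {f : V →ₗ[k] V'} {g : W →ₗ[k] W'}
    (hf : ∀ v r, f (bV.right (v ⊗ₜ[k] r)) = bV'.right (f v ⊗ₜ[k] r))
    (hg : ∀ r w, g (bW.left (r ⊗ₜ[k] w)) = bW'.left (r ⊗ₜ[k] g w)) (z : V ⊗[k] W) :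
    mapR bV bW bV' bW' f g (proj bV bW z) = proj bV' bW' (TensorProduct.map f g z) :=
  descend_apply (ker_proj_le fun v r w => by
    simp only [LinearMap.comp_apply, TensorProduct.map_tmul, hf, hg]
    exact proj_right bV' bW' _ _ _) z

/-- The actions of `R` on `V ⊗_R W` are the left action on `V` and the right action on `W`. -/
structure IsTensorBase (bV : H.BaseAction V) (bW : H.BaseAction W)
    (bVW : H.BaseAction (TensorR bV bW)) : Prop where
  right : ∀ v w r, bVW.right (proj bV bW (v ⊗ₜ[k] w) ⊗ₜ[k] r) =
    proj bV bW (v ⊗ₜ[k] bW.right (w ⊗ₜ[k] r))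
  left : ∀ r v w, bVW.left (r ⊗ₜ[k] proj bV bW (v ⊗ₜ[k] w)) =
    proj bV bW (bV.left (r ⊗ₜ[k] v) ⊗ₜ[k] w)

theorem IsTensorBase.right_proj {bV : H.BaseAction V} {bW : H.BaseAction W}
    {bVW : H.BaseAction (TensorR bV bW)} (h : IsTensorBase bV bW bVW) (z : V ⊗[k] W)
    (r : H.base) : bVW.right (proj bV bW z ⊗ₜ[k] r) =
      proj bV bW ((bW.right ∘ₗ (TensorProduct.mk k W H.base).flip r).lTensor V z) := by
  induction z with
  | zero => simp
  | tmul v w => rw [h.right]; rfl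
  | add x y hx hy => simp only [map_add, TensorProduct.add_tmul, hx, hy]

theorem IsTensorBase.left_proj {bV : H.BaseAction V} {bW : H.BaseAction W}
    {bVW : H.BaseAction (TensorR bV bW)} (h : IsTensorBase bV bW bVW) (z : V ⊗[k] W)
    (r : H.base) : bVW.left (r ⊗ₜ[k] proj bV bW z) =
      proj bV bW ((bV.left ∘ₗ TensorProduct.mk k H.base V r).rTensor W z) := by
  induction z with
  | zero => simp
  | tmul v w => rw [h.left]; rfl
  | add x y hx hy => simp only [map_add, TensorProduct.tmul_add, hx, hy]

variable {bV : H.BaseAction V} {bW : H.BaseAction W} {bZ : H.BaseAction Z}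
  {bVW : H.BaseAction (TensorR bV bW)} {bWZ : H.BaseAction (TensorR bW bZ)}

theorem assocR_proj (h₁ : IsTensorBase bV bW bVW) (h₂ : IsTensorBase bW bZ bWZ)
    (t : (V ⊗[k] W) ⊗[k] Z) :
    assocR bV bW bZ bVW bWZ (proj bVW bZ ((proj bV bW).rTensor Z t)) =
      proj bV bWZ ((proj bW bZ).lTensor V (TensorProduct.assoc k V W Z t)) := by
  set G := proj bV bWZ ∘ₗ (proj bW bZ).lTensor V ∘ₗ (TensorProduct.assoc k V W Z).toLinearMap
    with hG
  have hG' : ∀ v w z, G ((v ⊗ₜ[k] w) ⊗ₜ[k] z) = proj bV bWZ (v ⊗ₜ[k] proj bW bZ (w ⊗ₜ[k] z)) :=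
    fun v w z => by simp [hG]
  -- `G` factors through `(V ⊗_R W) ⊗ Z`, and the factorization vanishes on the balancing relations
  have hk : LinearMap.ker ((proj bV bW).rTensor Z) ≤ LinearMap.ker G := by
    refine ker_rTensor_le fun x hx z => ?_
    refine (ker_proj_le (g := G ∘ₗ (TensorProduct.mk k _ Z).flip z) fun v r w => ?_) hx
    simp only [LinearMap.comp_apply, LinearMap.flip_apply, TensorProduct.mk_apply, hG']
    rw [proj_right, h₂.left]
  refine descend_apply (p := proj bVW bZ ∘ₗ (proj bV bW).rTensor Z) (g := G) (fun t ht => ?_) t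
  rw [LinearMap.mem_ker, LinearMap.comp_apply] at ht
  rw [LinearMap.mem_ker, ← descend_apply hk]
  refine ker_proj_le (fun u r z => ?_) ht
  obtain ⟨y, rfl⟩ := proj_surjective bV bW u
  have hd : ∀ (y : V ⊗[k] W) (z : Z), descend ((proj bV bW).rTensor Z) G
      (proj bV bW y ⊗ₜ[k] z) = G (y ⊗ₜ[k] z) := fun y z =>
    descend_apply (p := (proj bV bW).rTensor Z) hk (y ⊗ₜ[k] z)
  rw [h₁.right_proj, hd, hd]
  induction y with
  | zero => simp
  | add x y hx hy => simp only [map_add, TensorProduct.add_tmul, hx, hy]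
  | tmul v w =>
    rw [LinearMap.lTensor_tmul, hG', hG', LinearMap.comp_apply, LinearMap.flip_apply,
      TensorProduct.mk_apply, proj_right]

theorem assocRInv_proj (h₁ : IsTensorBase bV bW bVW) (h₂ : IsTensorBase bW bZ bWZ)
    (t : V ⊗[k] (W ⊗[k] Z)) :
    assocRInv bV bW bZ bVW bWZ (proj bV bWZ ((proj bW bZ).lTensor V t)) =
      proj bVW bZ ((proj bV bW).rTensor Z ((TensorProduct.assoc k V W Z).symm t)) := by
  set G := proj bVW bZ ∘ₗ (proj bV bW).rTensor Z ∘ₗ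
    (TensorProduct.assoc k V W Z).symm.toLinearMap with hG
  have hG' : ∀ v w z, G (v ⊗ₜ[k] (w ⊗ₜ[k] z)) = proj bVW bZ (proj bV bW (v ⊗ₜ[k] w) ⊗ₜ[k] z) :=
    fun v w z => by simp [hG]
  have hk : LinearMap.ker ((proj bW bZ).lTensor V) ≤ LinearMap.ker G := by
    refine ker_lTensor_le fun x hx v => ?_
    refine (ker_proj_le (g := G ∘ₗ TensorProduct.mk k V _ v) fun w r z => ?_) hx
    simp only [LinearMap.comp_apply, TensorProduct.mk_apply, hG']
    rw [← proj_right, h₁.right]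
  refine descend_apply (p := proj bV bWZ ∘ₗ (proj bW bZ).lTensor V) (g := G) (fun t ht => ?_) t
  rw [LinearMap.mem_ker, LinearMap.comp_apply] at ht
  rw [LinearMap.mem_ker, ← descend_apply hk]
  refine ker_proj_le (fun v r u => ?_) ht
  obtain ⟨y, rfl⟩ := proj_surjective bW bZ u
  have hd : ∀ (v : V) (y : W ⊗[k] Z), descend ((proj bW bZ).lTensor V) G
      (v ⊗ₜ[k] proj bW bZ y) = G (v ⊗ₜ[k] y) := fun v y =>
    descend_apply (p := (proj bW bZ).lTensor V) hk (v ⊗ₜ[k] y)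
  rw [h₂.left_proj, hd, hd]
  induction y with
  | zero => simp
  | add x y hx hy => simp only [map_add, TensorProduct.tmul_add, hx, hy]
  | tmul w z =>
    rw [LinearMap.rTensor_tmul, hG', hG', LinearMap.comp_apply,
      TensorProduct.mk_apply, ← proj_right]

end TensorR

end RegularWMB

end WMB

namespace WMB

/-! ### The action of multipliers on modules -/

section MultiplierAction

variable {k : Type v} [Field k] {B : Type u} [NonUnitalRing B] [Module k B]
  [IsScalarTower k B B] [SMulCommClass k B B]
  {V : Type u} [AddCommGroup V] [Module k V] {W : Type u} [AddCommGroup W] [Module k W]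
  {act : V ⊗[k] B →ₗ[k] V} {actW : W ⊗[k] B →ₗ[k] W}

namespace IsIdempotentNondegenerateModule

theorem eq_of_act (h : IsIdempotentNondegenerateModule act) {v v' : V}
    (hv : ∀ a, act (v ⊗ₜ[k] a) = act (v' ⊗ₜ[k] a)) : v = v' := by
  rw [← sub_eq_zero]
  exact h.nondegenerate _ fun a => by rw [TensorProduct.sub_tmul, map_sub, hv, sub_self]

theorem act_right_act (h : IsIdempotentNondegenerateModule act) (w : Multiplier k B)
    (x : V ⊗[k] B) (b : B) :
    act (act (w.right.lTensor V x) ⊗ₜ[k] b) = act (act x ⊗ₜ[k] w.left b) := by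
  induction x with
  | zero => simp
  | tmul v a => rw [LinearMap.lTensor_tmul, ← h.assoc, ← h.assoc, w.compat]
  | add x y hx hy => simp only [map_add, TensorProduct.add_tmul, hx, hy]

theorem multiplierAction_act (h : IsIdempotentNondegenerateModule act) (x : V ⊗[k] B)
    (w : Multiplier k B) :
    multiplierAction act (act x ⊗ₜ[k] w) = act (w.right.lTensor V x) := by
  set G := act ∘ₗ (TensorProduct.lift (rightPart k B).flip).lTensor V ∘ₗ
      (TensorProduct.assoc k V B (Multiplier k B)).toLinearMap with hG
  have hG' : ∀ (x : V ⊗[k] B) w, G (x ⊗ₜ[k] w) = act (w.right.lTensor V x) := fun x w => by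
    induction x with
    | zero => simp
    | tmul v a => rfl
    | add x y hx hy => simp only [map_add, TensorProduct.add_tmul, hx, hy]
  refine (descend_apply (p := act.rTensor (Multiplier k B)) (g := G)
    (ker_rTensor_le fun x hx w => ?_) (x ⊗ₜ[k] w)).trans (hG' x w)
  refine h.nondegenerate _ fun b => ?_
  rw [hG', h.act_right_act, hx, TensorProduct.zero_tmul, map_zero]

theorem multiplierAction_act_tmul (h : IsIdempotentNondegenerateModule act) (v : V) (a : B)
    (w : Multiplier k B) :
    multiplierAction act (act (v ⊗ₜ[k] a) ⊗ₜ[k] w) = act (v ⊗ₜ[k] w.right a) :=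
  h.multiplierAction_act _ w

theorem act_multiplierAction (h : IsIdempotentNondegenerateModule act) (v : V)
    (w : Multiplier k B) (b : B) :
    act (multiplierAction act (v ⊗ₜ[k] w) ⊗ₜ[k] b) = act (v ⊗ₜ[k] w.left b) := by
  obtain ⟨x, rfl⟩ := h.idempotent v
  rw [h.multiplierAction_act, h.act_right_act]

/-- Module maps commute with the actions of multipliers. -/
theorem map_multiplierAction (h : IsIdempotentNondegenerateModule act)
    (hW : IsIdempotentNondegenerateModule actW) {f : V →ₗ[k] W} (hf : IsModuleMap act actW f)
    (v : V) (w : Multiplier k B) :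
    f (multiplierAction act (v ⊗ₜ[k] w)) = multiplierAction actW (f v ⊗ₜ[k] w) :=
  hW.eq_of_act fun b => by
    rw [← hf, h.act_multiplierAction, hW.act_multiplierAction, hf]

end IsIdempotentNondegenerateModule

/-- The algebra as a module over itself. -/
theorem isIdempotentNondegenerateModule_mul' (hB : IsNondegenerateAlgebra B)
    (hi : Function.Surjective (LinearMap.mul' k B)) :
    IsIdempotentNondegenerateModule (LinearMap.mul' k B) where
  assoc v a b := by simp only [LinearMap.mul'_apply, mul_assoc]
  idempotent := hi
  nondegenerate v h := hB.left v h

variable {A : Type u} [NonUnitalRing A] [Module k A]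
  [IsScalarTower k A A] [SMulCommClass k A A]
  {actV : V ⊗[k] A →ₗ[k] V} {actW : W ⊗[k] A →ₗ[k] W}

@[simp] theorem externalAction_tmul (actV : V ⊗[k] A →ₗ[k] V) (actW : W ⊗[k] A →ₗ[k] W)
    (v : V) (w : W) (a b : A) :
    externalAction actV actW ((v ⊗ₜ[k] w) ⊗ₜ[k] (a ⊗ₜ[k] b)) =
      actV (v ⊗ₜ[k] a) ⊗ₜ[k] actW (w ⊗ₜ[k] b) := by
  simp [externalAction]

theorem externalAction_eq (actV : V ⊗[k] A →ₗ[k] V) (actW : W ⊗[k] A →ₗ[k] W)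
    (v : V) (w : W) (y : A ⊗[k] A) :
    externalAction actV actW ((v ⊗ₜ[k] w) ⊗ₜ[k] y) =
      TensorProduct.map (actV ∘ₗ TensorProduct.mk k V A v) (actW ∘ₗ TensorProduct.mk k W A w) y := by
  induction y with
  | zero => simp
  | tmul a b => simp
  | add x y hx hy => simp only [map_add, TensorProduct.tmul_add, hx, hy]

theorem externalAction_tmul_eq (actV : V ⊗[k] A →ₗ[k] V) (actW : W ⊗[k] A →ₗ[k] W)
    (z : V ⊗[k] W) (a b : A) :
    externalAction actV actW (z ⊗ₜ[k] (a ⊗ₜ[k] b)) =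
      TensorProduct.map (actV ∘ₗ (TensorProduct.mk k V A).flip a)
        (actW ∘ₗ (TensorProduct.mk k W A).flip b) z := by
  induction z with
  | zero => simp
  | tmul v w => simp
  | add x y hx hy => simp only [map_add, TensorProduct.add_tmul, hx, hy]

theorem isIdempotentNondegenerateModule_externalAction
    (hV : IsIdempotentNondegenerateModule actV) (hW : IsIdempotentNondegenerateModule actW) :
    IsIdempotentNondegenerateModule (externalAction actV actW) where
  assoc z x y := by
    induction x with
    | zero => simp
    | add x x' hx hx' => simp only [add_mul, TensorProduct.tmul_add, map_add,
        TensorProduct.add_tmul, hx, hx']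
    | tmul a b =>
      induction y with
      | zero => simp
      | add x x' hx hx' => simp only [mul_add, TensorProduct.tmul_add, map_add, hx, hx']
      | tmul c d =>
        induction z with
        | zero => simp
        | add x x' hx hx' => simp only [TensorProduct.add_tmul, map_add, hx, hx']
        | tmul v w =>
          simp only [Algebra.TensorProduct.tmul_mul_tmul, externalAction_tmul, hV.assoc, hW.assoc]
  idempotent := by
    rw [externalAction, LinearMap.coe_comp]
    exact (TensorProduct.map_surjective hV.idempotent hW.idempotent).comp
      (TensorProduct.tensorTensorTensorComm k V W A A).surjective
  nondegenerate z hz := by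
    refine eq_zero_of_lTensor (fun b : A => actW ∘ₗ (TensorProduct.mk k W A).flip b)
      (fun w hw => hW.nondegenerate w hw) z fun b => ?_
    refine eq_zero_of_rTensor (fun a : A => actV ∘ₗ (TensorProduct.mk k V A).flip a)
      (fun v hv => hV.nondegenerate v hv) _ fun a => ?_
    rw [← hz (a ⊗ₜ[k] b), externalAction_tmul_eq, ← LinearMap.comp_apply, LinearMap.rTensor,
      LinearMap.lTensor, ← TensorProduct.map_comp]
    rfl

end MultiplierAction

namespace RegularWMB

/-! ### The monoidal product of modules -/

section TensorModules

variable {k : Type v} [Field k] {A : Type u} [NonUnitalRing A]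
    [Module k A] [IsScalarTower k A A] [SMulCommClass k A A] (H : RegularWMB k A)
  {V : Type u} [AddCommGroup V] [Module k V] {W : Type u} [AddCommGroup W] [Module k W]
  {actV : V ⊗[k] A →ₗ[k] V} {actW : W ⊗[k] A →ₗ[k] W}

theorem isModule_mul' (H : RegularWMB k A) : IsIdempotentNondegenerateModule (LinearMap.mul' k A) :=
  isIdempotentNondegenerateModule_mul' H.nondeg H.idempotent

theorem E₂_externalAction (hV : IsIdempotentNondegenerateModule actV)
    (hW : IsIdempotentNondegenerateModule actW) (z : V ⊗[k] W) (y : A ⊗[k] A) :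
    H.E₂ actV actW (externalAction actV actW (z ⊗ₜ[k] y)) =
      externalAction actV actW (z ⊗ₜ[k] H.E.right y) :=
  (isIdempotentNondegenerateModule_externalAction hV hW).multiplierAction_act_tmul z y H.E

theorem externalAction_E₂ (hV : IsIdempotentNondegenerateModule actV)
    (hW : IsIdempotentNondegenerateModule actW) (z : V ⊗[k] W) (y : A ⊗[k] A) :
    externalAction actV actW (H.E₂ actV actW z ⊗ₜ[k] y) =
      externalAction actV actW (z ⊗ₜ[k] H.E.left y) :=
  (isIdempotentNondegenerateModule_externalAction hV hW).act_multiplierAction z H.E y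

theorem diagonalAction_externalAction (hV : IsIdempotentNondegenerateModule actV)
    (hW : IsIdempotentNondegenerateModule actW) (z : V ⊗[k] W) (y : A ⊗[k] A) (c : A) :
    H.diagonalAction actV actW (externalAction actV actW (z ⊗ₜ[k] y) ⊗ₜ[k] c) =
      externalAction actV actW (z ⊗ₜ[k] (H.Δ c).right y) :=
  (isIdempotentNondegenerateModule_externalAction hV hW).multiplierAction_act_tmul z y (H.Δ c)

theorem externalAction_diagonalAction (hV : IsIdempotentNondegenerateModule actV)
    (hW : IsIdempotentNondegenerateModule actW) (z : V ⊗[k] W) (c : A) (y : A ⊗[k] A) :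
    externalAction actV actW (H.diagonalAction actV actW (z ⊗ₜ[k] c) ⊗ₜ[k] y) =
      externalAction actV actW (z ⊗ₜ[k] (H.Δ c).left y) :=
  (isIdempotentNondegenerateModule_externalAction hV hW).act_multiplierAction z (H.Δ c) y

theorem E₂_E₂ (hV : IsIdempotentNondegenerateModule actV)
    (hW : IsIdempotentNondegenerateModule actW) (z : V ⊗[k] W) :
    H.E₂ actV actW (H.E₂ actV actW z) = H.E₂ actV actW z :=
  (isIdempotentNondegenerateModule_externalAction hV hW).eq_of_act fun y => by
    rw [H.externalAction_E₂ hV hW, H.externalAction_E₂ hV hW, H.externalAction_E₂ hV hW,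
      E_left_E_left]

theorem E₂_diagonalAction (hV : IsIdempotentNondegenerateModule actV)
    (hW : IsIdempotentNondegenerateModule actW) (z : V ⊗[k] W) (c : A) :
    H.E₂ actV actW (H.diagonalAction actV actW (z ⊗ₜ[k] c)) =
      H.diagonalAction actV actW (z ⊗ₜ[k] c) :=
  (isIdempotentNondegenerateModule_externalAction hV hW).eq_of_act fun y => by
    rw [H.externalAction_E₂ hV hW, H.externalAction_diagonalAction hV hW,
      H.externalAction_diagonalAction hV hW, Δ_left_E_left]

theorem diagonalAction_E₂ (hV : IsIdempotentNondegenerateModule actV)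
    (hW : IsIdempotentNondegenerateModule actW) (z : V ⊗[k] W) (c : A) :
    H.diagonalAction actV actW (H.E₂ actV actW z ⊗ₜ[k] c) =
      H.diagonalAction actV actW (z ⊗ₜ[k] c) :=
  (isIdempotentNondegenerateModule_externalAction hV hW).eq_of_act fun y => by
    rw [H.externalAction_diagonalAction hV hW, H.externalAction_E₂ hV hW,
      H.externalAction_diagonalAction hV hW, E_left_Δ_left]

theorem diagonalAction_mul (hV : IsIdempotentNondegenerateModule actV)
    (hW : IsIdempotentNondegenerateModule actW) (z : V ⊗[k] W) (a b : A) :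
    H.diagonalAction actV actW (z ⊗ₜ[k] (a * b)) =
      H.diagonalAction actV actW (H.diagonalAction actV actW (z ⊗ₜ[k] a) ⊗ₜ[k] b) :=
  (isIdempotentNondegenerateModule_externalAction hV hW).eq_of_act fun y => by
    rw [H.externalAction_diagonalAction hV hW, H.externalAction_diagonalAction hV hW,
      H.externalAction_diagonalAction hV hW, Δ_left_mul]

/-- `E₂` is determined by the diagonal action. -/
theorem E₂_eq_of_diagonalAction (hV : IsIdempotentNondegenerateModule actV)
    (hW : IsIdempotentNondegenerateModule actW) {z z' : V ⊗[k] W}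
    (h : ∀ c, H.diagonalAction actV actW (z ⊗ₜ[k] c) = H.diagonalAction actV actW (z' ⊗ₜ[k] c)) :
    H.E₂ actV actW z = H.E₂ actV actW z' :=
  (isIdempotentNondegenerateModule_externalAction hV hW).eq_of_act fun y => by
    rw [H.externalAction_E₂ hV hW, H.externalAction_E₂ hV hW]
    refine H.E_left_induction (p := fun y => externalAction actV actW (z ⊗ₜ[k] y) =
      externalAction actV actW (z' ⊗ₜ[k] y)) ?_ ?_ ?_ ?_ y
    · simp
    · intro x y hx hy
      simp only [TensorProduct.tmul_add, map_add, hx, hy]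
    · intro c x hx
      simp only [TensorProduct.tmul_smul, map_smul, hx]
    · intro a b c
      rw [← H.externalAction_diagonalAction hV hW, h, H.externalAction_diagonalAction hV hW]

/-- The range of `E₂` is spanned by the range of the diagonal action. -/
theorem E₂_induction (hV : IsIdempotentNondegenerateModule actV)
    (hW : IsIdempotentNondegenerateModule actW) {p : V ⊗[k] W → Prop} (zero : p 0)
    (add : ∀ x y, p x → p y → p (x + y)) (smul : ∀ (c : k) x, p x → p (c • x))
    (diag : ∀ z a, p (H.diagonalAction actV actW (z ⊗ₜ[k] a))) (z : V ⊗[k] W) :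
    p (H.E₂ actV actW z) := by
  obtain ⟨x, rfl⟩ := (isIdempotentNondegenerateModule_externalAction hV hW).idempotent z
  induction x with
  | zero => simpa using zero
  | add x y hx hy => rw [map_add, map_add]; exact add _ _ hx hy
  | tmul z y =>
    rw [H.E₂_externalAction hV hW]
    refine H.E_right_induction (p := fun y => p (externalAction actV actW (z ⊗ₜ[k] y)))
      ?_ ?_ ?_ ?_ y
    · simpa using zero
    · intro x y hx hy
      rw [TensorProduct.tmul_add, map_add]
      exact add _ _ hx hy
    · intro c x hx
      rw [TensorProduct.tmul_smul, map_smul]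
      exact smul _ _ hx
    · intro a b c
      rw [← H.diagonalAction_externalAction hV hW]
      exact diag _ _

theorem right_act (hV : IsIdempotentNondegenerateModule actV) (v : V) (a : A) (r : H.base) :
    (H.moduleBaseAction actV).right (actV (v ⊗ₜ[k] a) ⊗ₜ[k] r) = actV (v ⊗ₜ[k] r.1.right a) :=
  hV.multiplierAction_act_tmul v a r.1

theorem left_act (hV : IsIdempotentNondegenerateModule actV) (v : V) (a : A) (r : H.base) :
    (H.moduleBaseAction actV).left (r ⊗ₜ[k] actV (v ⊗ₜ[k] a)) =
      actV (v ⊗ₜ[k] (H.tau r).right a) := by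
  refine Eq.trans ?_ (hV.multiplierAction_act_tmul v a (H.tau r))
  simp [moduleBaseAction]

theorem act_right (hV : IsIdempotentNondegenerateModule actV) (v : V) (r : H.base) (a : A) :
    actV ((H.moduleBaseAction actV).right (v ⊗ₜ[k] r) ⊗ₜ[k] a) = actV (v ⊗ₜ[k] r.1.left a) :=
  hV.act_multiplierAction v r.1 a

theorem act_left (hV : IsIdempotentNondegenerateModule actV) (v : V) (r : H.base) (a : A) :
    actV ((H.moduleBaseAction actV).left (r ⊗ₜ[k] v) ⊗ₜ[k] a) =
      actV (v ⊗ₜ[k] (H.tau r).left a) := by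
  refine Eq.trans ?_ (hV.act_multiplierAction v (H.tau r) a)
  simp [moduleBaseAction]

/-- `(r ⊗ 1)E = (1 ⊗ τ(r))E`. -/
theorem E_right_right (r : H.base) (c q : A) :
    H.E.right (r.1.right c ⊗ₜ[k] q) = H.E.right (c ⊗ₜ[k] (H.tau r).right q) := by
  obtain ⟨a, rfl⟩ := H.exists_piR'_eq r
  rw [coe_piR', piR_right, tau_piR', piBarL_right, E_right_piRr]

/-- `V ⊗_R W` is the range of the idempotent map `E₂`: both `(r ⊗ 1)E = (1 ⊗ τ(r))E` and the
presentation of `(c ⊗ b a)E` as an element of `A R ⊗ A` are used. -/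
theorem proj_eq_zero_iff (hV : IsIdempotentNondegenerateModule actV)
    (hW : IsIdempotentNondegenerateModule actW) (z : V ⊗[k] W) :
    proj (H.moduleBaseAction actV) (H.moduleBaseAction actW) z = 0 ↔ H.E₂ actV actW z = 0 := by
  constructor
  · intro hz
    refine ker_proj_le (g := H.E₂ actV actW) (fun v r w => ?_) hz
    obtain ⟨x, rfl⟩ := hV.idempotent v
    obtain ⟨y, rfl⟩ := hW.idempotent w
    induction x with
    | zero => simp
    | add x x' hx hx' => simp only [map_add, TensorProduct.add_tmul, hx, hx']
    | tmul v c =>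
      induction y with
      | zero => simp
      | add x x' hx hx' => simp only [map_add, TensorProduct.tmul_add, hx, hx']
      | tmul w q =>
        rw [H.right_act hV, H.left_act hW, ← externalAction_tmul, ← externalAction_tmul,
          H.E₂_externalAction hV hW, H.E₂_externalAction hV hW, E_right_right]
  · suffices h : ∀ z, proj (H.moduleBaseAction actV) (H.moduleBaseAction actW)
        (H.E₂ actV actW z) = proj (H.moduleBaseAction actV) (H.moduleBaseAction actW) z by
      intro hz
      rw [← h, hz, map_zero]
    intro z
    obtain ⟨x, rfl⟩ := (isIdempotentNondegenerateModule_externalAction hV hW).idempotent z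
    induction x with
    | zero => simp
    | add x y hx hy => simp only [map_add, hx, hy]
    | tmul z y =>
      induction y with
      | zero => simp
      | add x y hx hy => simp only [TensorProduct.tmul_add, map_add, hx, hy]
      | tmul c d =>
        induction z with
        | zero => simp
        | add x y hx hy => simp only [TensorProduct.add_tmul, map_add, hx, hy]
        | tmul v w =>
          rw [H.E₂_externalAction hV hW]
          obtain ⟨t, rfl⟩ := H.idempotent d
          induction t with
          | zero => simp
          | add x y hx hy => simp only [TensorProduct.tmul_add, map_add, hx, hy]
          | tmul b a =>
            rw [LinearMap.mul'_apply, ← H.rTensor_piRr_T₃, externalAction_eq, externalAction_tmul,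
              ← H.lift_piBarLr_T₃]
            generalize H.T₃ (a ⊗ₜ[k] b) = t
            induction t with
            | zero => simp
            | add x y hx hy => simp only [TensorProduct.tmul_add, map_add, hx, hy]
            | tmul p q =>
              rw [LinearMap.rTensor_tmul, TensorProduct.map_tmul, TensorProduct.lift.tmul,
                LinearMap.flip_apply, LinearMap.comp_apply, LinearMap.comp_apply,
                TensorProduct.mk_apply, TensorProduct.mk_apply, ← piR_right, ← coe_piR',
                ← H.right_act hV, proj_right, H.left_act hW, tau_piR', piBarL_right]

theorem proj_eq_iff (hV : IsIdempotentNondegenerateModule actV)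
    (hW : IsIdempotentNondegenerateModule actW) (z z' : V ⊗[k] W) :
    proj (H.moduleBaseAction actV) (H.moduleBaseAction actW) z =
        proj (H.moduleBaseAction actV) (H.moduleBaseAction actW) z' ↔
      H.E₂ actV actW z = H.E₂ actV actW z' := by
  rw [← sub_eq_zero, ← map_sub, H.proj_eq_zero_iff hV hW, map_sub, sub_eq_zero]

theorem proj_E₂ (hV : IsIdempotentNondegenerateModule actV)
    (hW : IsIdempotentNondegenerateModule actW) (z : V ⊗[k] W) :
    proj (H.moduleBaseAction actV) (H.moduleBaseAction actW) (H.E₂ actV actW z) =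
      proj (H.moduleBaseAction actV) (H.moduleBaseAction actW) z :=
  (H.proj_eq_iff hV hW _ _).2 (H.E₂_E₂ hV hW z)

theorem tensorAct_proj (hV : IsIdempotentNondegenerateModule actV)
    (hW : IsIdempotentNondegenerateModule actW) (z : V ⊗[k] W) (c : A) :
    tensorAct (H.moduleBaseAction actV) (H.moduleBaseAction actW) actV actW
        (proj (H.moduleBaseAction actV) (H.moduleBaseAction actW) z ⊗ₜ[k] c) =
      proj (H.moduleBaseAction actV) (H.moduleBaseAction actW)
        (H.diagonalAction actV actW (z ⊗ₜ[k] c)) := by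
  refine descend_apply (p := (proj (H.moduleBaseAction actV) (H.moduleBaseAction actW)).rTensor A)
    (g := proj (H.moduleBaseAction actV) (H.moduleBaseAction actW) ∘ₗ
      H.diagonalAction actV actW) (ker_rTensor_le fun z hz c => ?_) (z ⊗ₜ[k] c)
  rw [LinearMap.comp_apply, ← H.diagonalAction_E₂ hV hW, (H.proj_eq_zero_iff hV hW z).1 hz]
  simp

theorem isModule_tensorAct (hV : IsIdempotentNondegenerateModule actV)
    (hW : IsIdempotentNondegenerateModule actW) :
    IsIdempotentNondegenerateModule
      (tensorAct (H.moduleBaseAction actV) (H.moduleBaseAction actW) actV actW) where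
  assoc x a b := by
    obtain ⟨z, rfl⟩ := proj_surjective _ _ x
    rw [H.tensorAct_proj hV hW, H.tensorAct_proj hV hW, H.tensorAct_proj hV hW,
      H.diagonalAction_mul hV hW]
  idempotent x := by
    obtain ⟨z, rfl⟩ := proj_surjective _ _ x
    rw [← H.proj_E₂ hV hW]
    refine H.E₂_induction hV hW (p := fun z => ∃ y, tensorAct (H.moduleBaseAction actV)
      (H.moduleBaseAction actW) actV actW y =
        proj (H.moduleBaseAction actV) (H.moduleBaseAction actW) z) ?_ ?_ ?_ ?_ z
    · exact ⟨0, by simp⟩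
    · rintro z z' ⟨y, hy⟩ ⟨y', hy'⟩
      exact ⟨y + y', by rw [map_add, map_add, hy, hy']⟩
    · rintro c z ⟨y, hy⟩
      exact ⟨c • y, by rw [map_smul, map_smul, hy]⟩
    · intro z a
      exact ⟨_, H.tensorAct_proj hV hW z a⟩
  nondegenerate x hx := by
    obtain ⟨z, rfl⟩ := proj_surjective _ _ x
    have h : H.E₂ actV actW z = H.E₂ actV actW 0 := by
      refine H.E₂_eq_of_diagonalAction hV hW fun c => ?_
      rw [TensorProduct.zero_tmul, map_zero, ← H.E₂_diagonalAction hV hW,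
        ← H.proj_eq_zero_iff hV hW, ← H.tensorAct_proj hV hW]
      exact hx c
    rw [H.proj_eq_zero_iff hV hW, h, map_zero]

/-- `Δ(r c)(1 ⊗ q) = (1 ⊗ r)Δ(c)(1 ⊗ q)`. -/
theorem T₁_base (r : H.base) (c q : A) :
    H.T₁ (r.1.left c ⊗ₜ[k] q) = r.1.left.lTensor A (H.T₁ (c ⊗ₜ[k] q)) := by
  obtain ⟨a, rfl⟩ := H.exists_piR'_eq r
  rw [coe_piR', piR_left]
  refine H.nondeg.lTensor_left fun d => ?_
  have h := H.isComodule_self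
  have e : LinearMap.mulLeft k d ∘ₗ H.piRl a = LinearMap.mulLeft k (H.piRr a d) :=
    LinearMap.ext fun b => H.piR_compat a b d
  rw [← LinearMap.lTensor_comp_apply, e]
  exact (h.compat _ _ _).trans
    ((congrArg _ (h.rho_epsAct c a d)).trans (h.compat c (H.piRr a d) q).symm)

/-- `Δ(r c) = (1 ⊗ r)Δ(c)`. -/
theorem Δ_left_base (r : H.base) (c : A) (y : A ⊗[k] A) :
    (H.Δ (r.1.left c)).left y = r.1.left.lTensor A ((H.Δ c).left y) := by
  induction y with
  | zero => simp
  | add x y hx hy => simp only [map_add, hx, hy]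
  | tmul s q => rw [Δ_left_tmul, Δ_left_tmul, T₁_base, rTensor_lTensor]

/-- `Δ(τ(r) c) = (τ(r) ⊗ 1)Δ(c)`. -/
theorem Δ_left_tau (r : H.base) (c : A) (y : A ⊗[k] A) :
    (H.Δ ((H.tau r).left c)).left y = (H.tau r).left.rTensor A ((H.Δ c).left y) := by
  obtain ⟨a, rfl⟩ := H.exists_piR'_eq r
  rw [tau_piR', piBarL_left, Δ_left_piBarLl]

theorem isTensorBase_tensorAct (hV : IsIdempotentNondegenerateModule actV)
    (hW : IsIdempotentNondegenerateModule actW) :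
    IsTensorBase (H.moduleBaseAction actV) (H.moduleBaseAction actW)
      (H.moduleBaseAction
        (tensorAct (H.moduleBaseAction actV) (H.moduleBaseAction actW) actV actW)) where
  right v w r := by
    refine (H.isModule_tensorAct hV hW).eq_of_act fun c => ?_
    rw [H.act_right (H.isModule_tensorAct hV hW), H.tensorAct_proj hV hW,
      H.tensorAct_proj hV hW]
    congr 1
    refine (isIdempotentNondegenerateModule_externalAction hV hW).eq_of_act fun y => ?_
    rw [H.externalAction_diagonalAction hV hW, H.externalAction_diagonalAction hV hW,
      Δ_left_base]
    generalize (H.Δ c).left y = y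
    induction y with
    | zero => simp
    | add x y hx hy => simp only [TensorProduct.tmul_add, map_add, hx, hy]
    | tmul p q => rw [LinearMap.lTensor_tmul, externalAction_tmul, externalAction_tmul,
        H.act_right hW]
  left r v w := by
    refine (H.isModule_tensorAct hV hW).eq_of_act fun c => ?_
    rw [H.act_left (H.isModule_tensorAct hV hW), H.tensorAct_proj hV hW,
      H.tensorAct_proj hV hW]
    congr 1
    refine (isIdempotentNondegenerateModule_externalAction hV hW).eq_of_act fun y => ?_
    rw [H.externalAction_diagonalAction hV hW, H.externalAction_diagonalAction hV hW,
      Δ_left_tau]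
    generalize (H.Δ c).left y = y
    induction y with
    | zero => simp
    | add x y hx hy => simp only [TensorProduct.tmul_add, map_add, hx, hy]
    | tmul p q => rw [LinearMap.rTensor_tmul, externalAction_tmul, externalAction_tmul,
        H.act_left hV]

end TensorModules

end RegularWMB

end WMB

namespace WMB

namespace RegularWMB

/-! ### The maps `φ` -/

section PhiLemmas

variable {k : Type v} [Field k] {A : Type u} [NonUnitalRing A]
    [Module k A] [IsScalarTower k A A] [SMulCommClass k A A] {H : RegularWMB k A}
  {V : Type u} [AddCommGroup V] [Module k V] {W : Type u} [AddCommGroup W] [Module k W]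
  {M : Type u} [AddCommGroup M] [Module k M] {N : Type u} [AddCommGroup N] [Module k N]
  {act : V ⊗[k] A →ₗ[k] V} {actW : W ⊗[k] A →ₗ[k] W}
  {lam rho : M ⊗[k] A →ₗ[k] M ⊗[k] A} {lamN rhoN : N ⊗[k] A →ₗ[k] N ⊗[k] A}

/-- The maps `a ↦ v·a`. -/
noncomputable def orbit (act : V ⊗[k] A →ₗ[k] V) : V →ₗ[k] A →ₗ[k] V :=
  TensorProduct.curry act

/-- The maps `v ↦ v·a`. -/
noncomputable def actBy (act : V ⊗[k] A →ₗ[k] V) : A →ₗ[k] V →ₗ[k] V :=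
  (TensorProduct.curry act).flip

@[simp] theorem orbit_apply (act : V ⊗[k] A →ₗ[k] V) (v : V) (a : A) :
    orbit act v a = act (v ⊗ₜ[k] a) := rfl

@[simp] theorem actBy_apply (act : V ⊗[k] A →ₗ[k] V) (a : A) (v : V) :
    actBy act a v = act (v ⊗ₜ[k] a) := rfl

/-- The relation `(1 ⊗ a)λ(m ⊗ b) = ϱ(m ⊗ a)(1 ⊗ b)`. -/
def IsCompatible (lam rho : M ⊗[k] A →ₗ[k] M ⊗[k] A) : Prop :=
  ∀ (m : M) (a b : A), (LinearMap.mulLeft k a).lTensor M (lam (m ⊗ₜ[k] b)) =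
    (LinearMap.mulRight k b).lTensor M (rho (m ⊗ₜ[k] a))

theorem eq_of_actBy (hV : IsIdempotentNondegenerateModule act) {z z' : M ⊗[k] V}
    (h : ∀ b, (actBy act b).lTensor M z = (actBy act b).lTensor M z') : z = z' :=
  eq_of_lTensor (fun b : A => actBy act b) (fun v hv => hV.nondegenerate v hv) h

/-- The value of `φ` does not depend on the presentation of the elements of `V`, as
`(v·a)·m₁ b = v·(a m₁ b)` can be computed from `λ(m ⊗ b)`. -/
theorem phi_act (hV : IsIdempotentNondegenerateModule act) (hc : IsCompatible lam rho)
    (v : V) (a : A) (m : M) :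
    phi act rho (act (v ⊗ₜ[k] a) ⊗ₜ[k] m) = (orbit act v).lTensor M (rho (m ⊗ₜ[k] a)) := by
  set G := act.lTensor M ∘ₗ (TensorProduct.leftComm k V M A).toLinearMap ∘ₗ
      rho.lTensor V ∘ₗ (tw A M).lTensor V ∘ₗ (TensorProduct.assoc k V A M).toLinearMap with hG
  have hG' : ∀ v a m, G ((v ⊗ₜ[k] a) ⊗ₜ[k] m) =
      (orbit act v).lTensor M (rho (m ⊗ₜ[k] a)) := fun v a m => by
    simp only [hG, LinearMap.comp_apply, LinearEquiv.coe_coe, TensorProduct.assoc_tmul,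
      LinearMap.lTensor_tmul, tw_tmul]
    generalize rho (m ⊗ₜ[k] a) = z
    induction z with
    | zero => simp
    | tmul p q => simp
    | add x y hx hy => simp only [TensorProduct.tmul_add, map_add, hx, hy]
  have key : ∀ (x : V ⊗[k] A) (m : M) (b : A), (actBy act b).lTensor M (G (x ⊗ₜ[k] m)) =
      (orbit act (act x)).lTensor M (lam (m ⊗ₜ[k] b)) := fun x m b => by
    induction x with
    | zero => simp
    | add x y hx hy => simp only [TensorProduct.add_tmul, map_add, hx, hy, LinearMap.lTensor_add, LinearMap.add_apply]
    | tmul v a =>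
      have e₁ : actBy act b ∘ₗ orbit act v = orbit act v ∘ₗ LinearMap.mulRight k b :=
        LinearMap.ext fun a => (hV.assoc v a b).symm
      have e₂ : orbit act (act (v ⊗ₜ[k] a)) = orbit act v ∘ₗ LinearMap.mulLeft k a :=
        LinearMap.ext fun b => (hV.assoc v a b).symm
      rw [hG', ← LinearMap.lTensor_comp_apply, e₁, e₂, LinearMap.lTensor_comp_apply, ← hc,
        ← LinearMap.lTensor_comp_apply]
  refine (descend_apply (p := act.rTensor M) (g := G) (ker_rTensor_le fun x hx m => ?_)
    ((v ⊗ₜ[k] a) ⊗ₜ[k] m)).trans (hG' v a m)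
  refine eq_of_actBy hV fun b => ?_
  rw [key, hx, map_zero, map_zero, LinearMap.lTensor_zero, LinearMap.zero_apply]

/-- `φ(v ⊗ m)·b = m₀ ⊗ v·(m₁ b)`. -/
theorem actBy_phi (hV : IsIdempotentNondegenerateModule act) (hc : IsCompatible lam rho)
    (v : V) (m : M) (b : A) :
    (actBy act b).lTensor M (phi act rho (v ⊗ₜ[k] m)) =
      (orbit act v).lTensor M (lam (m ⊗ₜ[k] b)) := by
  obtain ⟨x, rfl⟩ := hV.idempotent v
  induction x with
  | zero => simp
  | add x y hx hy => simp only [TensorProduct.add_tmul, map_add, hx, hy, LinearMap.lTensor_add, LinearMap.add_apply]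
  | tmul v a =>
    have e₁ : actBy act b ∘ₗ orbit act v = orbit act v ∘ₗ LinearMap.mulRight k b :=
      LinearMap.ext fun a => (hV.assoc v a b).symm
    have e₂ : orbit act (act (v ⊗ₜ[k] a)) = orbit act v ∘ₗ LinearMap.mulLeft k a :=
      LinearMap.ext fun b => (hV.assoc v a b).symm
    rw [phi_act hV hc, ← LinearMap.lTensor_comp_apply, e₁, e₂, LinearMap.lTensor_comp_apply, ← hc,
      ← LinearMap.lTensor_comp_apply]

/-- `φ` is natural in the module. -/
theorem phi_map_left (hV : IsIdempotentNondegenerateModule act)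
    (hW : IsIdempotentNondegenerateModule actW) (hc : IsCompatible lam rho) {g : V →ₗ[k] W}
    (hg : IsModuleMap act actW g) (v : V) (m : M) :
    phi actW rho (g v ⊗ₜ[k] m) = g.lTensor M (phi act rho (v ⊗ₜ[k] m)) := by
  refine eq_of_actBy hW fun b => ?_
  have e : actBy actW b ∘ₗ g = g ∘ₗ actBy act b := LinearMap.ext fun v => (hg v b).symm
  have e' : orbit actW (g v) = g ∘ₗ orbit act v := LinearMap.ext fun b => (hg v b).symm
  rw [actBy_phi hW hc, e', ← LinearMap.lTensor_comp_apply M (actBy actW b), e,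
    LinearMap.lTensor_comp_apply, LinearMap.lTensor_comp_apply, actBy_phi hV hc]

/-- `φ` is natural in the comodule. -/
theorem phi_map_right (hV : IsIdempotentNondegenerateModule act) (hc : IsCompatible lam rho)
    (hcN : IsCompatible lamN rhoN) {f : M →ₗ[k] N} (hf : IsComoduleMap lam lamN f)
    (v : V) (m : M) :
    phi act rhoN (v ⊗ₜ[k] f m) = f.rTensor V (phi act rho (v ⊗ₜ[k] m)) := by
  refine eq_of_actBy hV fun b => ?_
  rw [actBy_phi hV hcN, ← rTensor_lTensor, actBy_phi hV hc, rTensor_lTensor,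
    IsFullComodule.map_lam hf]

/-- The property `ϱ(r m ⊗ a) = ϱ(m ⊗ a r)` of the left action of `R` on a comodule. -/
def IsLeftBalanced (rho : M ⊗[k] A →ₗ[k] M ⊗[k] A) (bM : H.BaseAction M) : Prop :=
  ∀ m r a, rho (bM.left (r ⊗ₜ[k] m) ⊗ₜ[k] a) = rho (m ⊗ₜ[k] r.1.right a)

theorem phi_right_tmul (hV : IsIdempotentNondegenerateModule act) (hc : IsCompatible lam rho)
    {bM : H.BaseAction M} (hb : IsLeftBalanced rho bM) (v : V) (r : H.base) (m : M) :
    phi act rho ((H.moduleBaseAction act).right (v ⊗ₜ[k] r) ⊗ₜ[k] m) =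
      phi act rho (v ⊗ₜ[k] bM.left (r ⊗ₜ[k] m)) := by
  obtain ⟨x, rfl⟩ := hV.idempotent v
  induction x with
  | zero => simp
  | add x y hx hy => simp only [TensorProduct.add_tmul, map_add, hx, hy]
  | tmul v a => rw [H.right_act hV, phi_act hV hc, phi_act hV hc, hb]

theorem phiHat_proj (hV : IsIdempotentNondegenerateModule act) (hc : IsCompatible lam rho)
    {bV : H.BaseAction V} (hbV : bV = H.moduleBaseAction act)
    {bM : H.BaseAction M} (hb : IsLeftBalanced rho bM) (z : V ⊗[k] M) :
    phiHat act rho bV bM (proj bV bM z) = proj bM bV (phi act rho z) := by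
  subst hbV
  refine descend_apply (ker_proj_le fun v r m => ?_) z
  rw [LinearMap.comp_apply, LinearMap.comp_apply, phi_right_tmul hV hc hb]

theorem phi_tmul_right (hV : IsIdempotentNondegenerateModule act)
    (hM : H.IsFullComodule lam rho) (v : V) (m : M) (r : H.base) :
    phi act rho (v ⊗ₜ[k] (H.comoduleBaseAction lam rho).right (m ⊗ₜ[k] r)) =
      ((H.moduleBaseAction act).right ∘ₗ (TensorProduct.mk k V H.base).flip r).lTensor M
        (phi act rho (v ⊗ₜ[k] m)) := by
  obtain ⟨x, rfl⟩ := hV.idempotent v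
  induction x with
  | zero => simp
  | add x y hx hy => simp only [TensorProduct.add_tmul, map_add, hx, hy]
  | tmul v a =>
    have e : ((H.moduleBaseAction act).right ∘ₗ (TensorProduct.mk k V H.base).flip r) ∘ₗ
        orbit act v = orbit act v ∘ₗ r.1.right := LinearMap.ext fun a => H.right_act hV v a r
    rw [phi_act hV hM.compat, phi_act hV hM.compat, hM.rho_right, ← LinearMap.lTensor_comp_apply,
      ← LinearMap.lTensor_comp_apply, e]

theorem phi_left_tmul (hV : IsIdempotentNondegenerateModule act)
    (hM : H.IsFullComodule lam rho) (r : H.base) (v : V) (m : M) :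
    phi act rho ((H.moduleBaseAction act).left (r ⊗ₜ[k] v) ⊗ₜ[k] m) =
      ((H.comoduleBaseAction lam rho).left ∘ₗ TensorProduct.mk k H.base M r).rTensor V
        (phi act rho (v ⊗ₜ[k] m)) := by
  obtain ⟨x, rfl⟩ := hV.idempotent v
  induction x with
  | zero => simp
  | add x y hx hy => simp only [TensorProduct.add_tmul, TensorProduct.tmul_add, map_add, hx, hy]
  | tmul v a =>
    rw [H.left_act hV, phi_act hV hM.compat, phi_act hV hM.compat, ← hM.rTensor_left_rho,
      rTensor_lTensor]

theorem phiHat_right (hV : IsIdempotentNondegenerateModule act)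
    (hM : H.IsFullComodule lam rho) {bV : H.BaseAction V} (hbV : bV = H.moduleBaseAction act)
    {bM : H.BaseAction M} (hbM : bM = H.comoduleBaseAction lam rho)
    {bVM : H.BaseAction (TensorR bV bM)} {bMV : H.BaseAction (TensorR bM bV)}
    (h : IsTensorBase bV bM bVM) (h' : IsTensorBase bM bV bMV) (x : TensorR bV bM) (r : H.base) :
    phiHat act rho bV bM (bVM.right (x ⊗ₜ[k] r)) =
      bMV.right (phiHat act rho bV bM x ⊗ₜ[k] r) := by
  subst hbV hbM
  obtain ⟨z, rfl⟩ := proj_surjective _ _ x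
  have hb : IsLeftBalanced rho (H.comoduleBaseAction lam rho) := hM.rho_left
  rw [h.right_proj, phiHat_proj hV hM.compat rfl hb, phiHat_proj hV hM.compat rfl hb,
    h'.right_proj]
  congr 1
  induction z with
  | zero => simp
  | add x y hx hy => simp only [map_add, hx, hy]
  | tmul v m => rw [← phi_tmul_right hV hM]; rfl

theorem phiHat_left (hV : IsIdempotentNondegenerateModule act)
    (hM : H.IsFullComodule lam rho) {bV : H.BaseAction V} (hbV : bV = H.moduleBaseAction act)
    {bM : H.BaseAction M} (hbM : bM = H.comoduleBaseAction lam rho)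
    {bVM : H.BaseAction (TensorR bV bM)} {bMV : H.BaseAction (TensorR bM bV)}
    (h : IsTensorBase bV bM bVM) (h' : IsTensorBase bM bV bMV) (r : H.base) (x : TensorR bV bM) :
    phiHat act rho bV bM (bVM.left (r ⊗ₜ[k] x)) =
      bMV.left (r ⊗ₜ[k] phiHat act rho bV bM x) := by
  subst hbV hbM
  obtain ⟨z, rfl⟩ := proj_surjective _ _ x
  have hb : IsLeftBalanced rho (H.comoduleBaseAction lam rho) := hM.rho_left
  rw [h.left_proj, phiHat_proj hV hM.compat rfl hb, phiHat_proj hV hM.compat rfl hb,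
    h'.left_proj]
  congr 1
  induction z with
  | zero => simp
  | add x y hx hy => simp only [map_add, hx, hy]
  | tmul v m => rw [← phi_left_tmul hV hM]; rfl

/-- `(φ_V ⊗ W)(V ⊗ φ_W)`, with values in `M ⊗ (V ⊗ W)`. -/
noncomputable def phi₂ (act : V ⊗[k] A →ₗ[k] V) (actW : W ⊗[k] A →ₗ[k] W)
    (rho : M ⊗[k] A →ₗ[k] M ⊗[k] A) : (V ⊗[k] W) ⊗[k] M →ₗ[k] M ⊗[k] (V ⊗[k] W) :=
  (TensorProduct.assoc k M V W).toLinearMap ∘ₗ (phi act rho).rTensor W ∘ₗ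
    (TensorProduct.assoc k V M W).symm.toLinearMap ∘ₗ (phi actW rho).lTensor V ∘ₗ
      (TensorProduct.assoc k V W M).toLinearMap

theorem phi₂_tmul (act : V ⊗[k] A →ₗ[k] V) (actW : W ⊗[k] A →ₗ[k] W)
    (rho : M ⊗[k] A →ₗ[k] M ⊗[k] A) (v : V) (w : W) (m : M) :
    phi₂ act actW rho ((v ⊗ₜ[k] w) ⊗ₜ[k] m) =
      assocMap (phi act rho ∘ₗ TensorProduct.mk k V M v) LinearMap.id
        (phi actW rho (w ⊗ₜ[k] m)) := by
  simp only [phi₂, LinearMap.comp_apply, LinearEquiv.coe_coe, TensorProduct.assoc_tmul,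
    LinearMap.lTensor_tmul]
  generalize phi actW rho (w ⊗ₜ[k] m) = z
  induction z with
  | zero => simp
  | tmul p q => simp
  | add x y hx hy => simp only [TensorProduct.tmul_add, map_add, hx, hy]

/-- `φ₂(z ⊗ m)·y = m₀ ⊗ z·(Δ(m₁)y)`. -/
theorem externalAction_phi₂ (hV : IsIdempotentNondegenerateModule act)
    (hW : IsIdempotentNondegenerateModule actW) (hc : IsCompatible lam rho)
    (z : V ⊗[k] W) (m : M) (y : A ⊗[k] A) :
    (actBy (externalAction act actW) y).lTensor M (phi₂ act actW rho (z ⊗ₜ[k] m)) =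
      (orbit (externalAction act actW) z).lTensor M (iterate lam (m ⊗ₜ[k] y)) := by
  induction z with
  | zero => simp
  | add x y hx hy => simp only [TensorProduct.add_tmul, map_add, hx, hy, LinearMap.lTensor_add, LinearMap.add_apply]
  | tmul v w =>
    induction y with
    | zero => simp
    | add x y hx hy => simp only [TensorProduct.tmul_add, map_add, hx, hy, LinearMap.lTensor_add, LinearMap.add_apply]
    | tmul a b =>
      have e₁ : actBy (externalAction act actW) (a ⊗ₜ[k] b) =
          TensorProduct.map (actBy act a) (actBy actW b) :=
        LinearMap.ext fun z => externalAction_tmul_eq act actW z a b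
      have e₂ : orbit (externalAction act actW) (v ⊗ₜ[k] w) =
          TensorProduct.map (orbit act v) (orbit actW w) :=
        LinearMap.ext fun y => externalAction_eq act actW v w y
      have e₃ : (actBy act a).lTensor M ∘ₗ phi act rho ∘ₗ TensorProduct.mk k V M v =
          (orbit act v).lTensor M ∘ₗ evalAt lam a := LinearMap.ext fun m => actBy_phi hV hc v m a
      rw [phi₂_tmul, iterate_tmul, e₁, e₂, lTensor_map_assocMap, lTensor_map_assocMap, e₃,
        LinearMap.comp_id, LinearMap.comp_id, assocMap_eq_lTensor, actBy_phi hW hc,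
        ← assocMap_eq_lTensor]

/-- `m₀ ⊗ Δ(g)Δ(m₁)y = m₀ ⊗ Δ(g m₁)y`. -/
theorem IsComodule.Δ_iterate (hM : H.IsComodule lam rho) (g : A) (m : M) (y : A ⊗[k] A) :
    (H.Δ g).left.lTensor M (iterate lam (m ⊗ₜ[k] y)) =
      (LinearMap.applyₗ (R := k) y ∘ₗ leftPart k (A ⊗[k] A) ∘ₗ H.Δ).lTensor M
        (rho (m ⊗ₜ[k] g)) := by
  have e : (LinearMap.applyₗ (R := k) y ∘ₗ leftPart k (A ⊗[k] A) ∘ₗ H.Δ) =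
      LinearMap.applyₗ (R := k) (H.E.left y) ∘ₗ leftPart k (A ⊗[k] A) ∘ₗ H.Δ :=
    LinearMap.ext fun x => (H.Δ_left_E_left x y).symm
  rw [← hM.iterate_E, e]
  refine H.E_left_induction (p := fun y => (H.Δ g).left.lTensor M (iterate lam (m ⊗ₜ[k] y)) =
      (LinearMap.applyₗ (R := k) y ∘ₗ leftPart k (A ⊗[k] A) ∘ₗ H.Δ).lTensor M
        (rho (m ⊗ₜ[k] g))) ?_ ?_ ?_ ?_ y
  · simp
  · intro x y hx hy
    simp only [TensorProduct.tmul_add, map_add, hx, hy, LinearMap.add_comp,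
      LinearMap.lTensor_add, LinearMap.add_apply]
  · intro c x hx
    simp only [TensorProduct.tmul_smul, map_smul, hx, LinearMap.smul_comp,
      LinearMap.lTensor_smul, LinearMap.smul_apply]
  · intro p b c
    set F := LinearMap.applyₗ (R := k) (b ⊗ₜ[k] c) ∘ₗ leftPart k (A ⊗[k] A) ∘ₗ H.Δ
    have e₁ : (H.Δ g).left ∘ₗ F = F ∘ₗ LinearMap.mulLeft k g :=
      LinearMap.ext fun x => (H.Δ_left_mul g x _).symm
    have e₂ : LinearMap.applyₗ (R := k) ((H.Δ p).left (b ⊗ₜ[k] c)) ∘ₗ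
        leftPart k (A ⊗[k] A) ∘ₗ H.Δ = F ∘ₗ LinearMap.mulRight k p :=
      LinearMap.ext fun x => (H.Δ_left_mul x p _).symm
    rw [hM.iterate_Δ, ← LinearMap.lTensor_comp_apply, e₁, e₂, LinearMap.lTensor_comp_apply,
      hM.compat, ← LinearMap.lTensor_comp_apply]

theorem eq_of_externalAction (hV : IsIdempotentNondegenerateModule act)
    (hW : IsIdempotentNondegenerateModule actW) {z z' : M ⊗[k] (V ⊗[k] W)}
    (h : ∀ y, (actBy (externalAction act actW) y).lTensor M z =
      (actBy (externalAction act actW) y).lTensor M z') : z = z' :=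
  eq_of_actBy (isIdempotentNondegenerateModule_externalAction hV hW) h

/-- `φ₂(z·g ⊗ m) = m₀ ⊗ z·(g m₁)`, for the diagonal actions. -/
theorem phi₂_diagonalAction (hV : IsIdempotentNondegenerateModule act)
    (hW : IsIdempotentNondegenerateModule actW) (hM : H.IsComodule lam rho)
    (z : V ⊗[k] W) (g : A) (m : M) :
    phi₂ act actW rho (H.diagonalAction act actW (z ⊗ₜ[k] g) ⊗ₜ[k] m) =
      (orbit (H.diagonalAction act actW) z).lTensor M (rho (m ⊗ₜ[k] g)) := by
  refine eq_of_externalAction hV hW fun y => ?_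
  have e₁ : orbit (externalAction act actW) (H.diagonalAction act actW (z ⊗ₜ[k] g)) =
      orbit (externalAction act actW) z ∘ₗ (H.Δ g).left :=
    LinearMap.ext fun y => H.externalAction_diagonalAction hV hW z g y
  have e₂ : actBy (externalAction act actW) y ∘ₗ orbit (H.diagonalAction act actW) z =
      orbit (externalAction act actW) z ∘ₗ
        LinearMap.applyₗ (R := k) y ∘ₗ leftPart k (A ⊗[k] A) ∘ₗ H.Δ :=
    LinearMap.ext fun g => H.externalAction_diagonalAction hV hW z g y
  rw [externalAction_phi₂ hV hW hM.compat, e₁, LinearMap.lTensor_comp_apply, hM.Δ_iterate,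
    ← LinearMap.lTensor_comp_apply, ← LinearMap.lTensor_comp_apply, e₂]

theorem phi₂_E₂ (hV : IsIdempotentNondegenerateModule act)
    (hW : IsIdempotentNondegenerateModule actW) (hM : H.IsComodule lam rho)
    (z : V ⊗[k] W) (m : M) :
    phi₂ act actW rho (H.E₂ act actW z ⊗ₜ[k] m) = phi₂ act actW rho (z ⊗ₜ[k] m) := by
  refine eq_of_externalAction hV hW fun y => ?_
  have e : orbit (externalAction act actW) (H.E₂ act actW z) =
      orbit (externalAction act actW) z ∘ₗ H.E.left :=
    LinearMap.ext fun y => H.externalAction_E₂ hV hW z y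
  rw [externalAction_phi₂ hV hW hM.compat, externalAction_phi₂ hV hW hM.compat, e,
    LinearMap.lTensor_comp_apply, hM.iterate_E_left]

/-- `φ_{V ⊗_R W}` is induced by `(φ_V ⊗ W)(V ⊗ φ_W)`. -/
theorem phi_tensorAct (hV : IsIdempotentNondegenerateModule act)
    (hW : IsIdempotentNondegenerateModule actW) (hM : H.IsComodule lam rho)
    (z : V ⊗[k] W) (m : M) :
    phi (tensorAct (H.moduleBaseAction act) (H.moduleBaseAction actW) act actW) rho
        (proj (H.moduleBaseAction act) (H.moduleBaseAction actW) z ⊗ₜ[k] m) =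
      (proj (H.moduleBaseAction act) (H.moduleBaseAction actW)).lTensor M
        (phi₂ act actW rho (z ⊗ₜ[k] m)) := by
  rw [← H.proj_E₂ hV hW, ← phi₂_E₂ hV hW hM]
  refine H.E₂_induction hV hW (p := fun z =>
    phi (tensorAct (H.moduleBaseAction act) (H.moduleBaseAction actW) act actW) rho
        (proj (H.moduleBaseAction act) (H.moduleBaseAction actW) z ⊗ₜ[k] m) =
      (proj (H.moduleBaseAction act) (H.moduleBaseAction actW)).lTensor M
        (phi₂ act actW rho (z ⊗ₜ[k] m))) ?_ ?_ ?_ ?_ z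
  · simp
  · intro x y hx hy
    simp only [map_add, TensorProduct.add_tmul, hx, hy]
  · intro c x hx
    simp only [map_smul, ← TensorProduct.smul_tmul', hx]
  · intro z g
    have e : orbit (tensorAct (H.moduleBaseAction act) (H.moduleBaseAction actW) act actW)
        (proj (H.moduleBaseAction act) (H.moduleBaseAction actW) z) =
        proj (H.moduleBaseAction act) (H.moduleBaseAction actW) ∘ₗ
          orbit (H.diagonalAction act actW) z :=
      LinearMap.ext fun c => H.tensorAct_proj hV hW z c
    rw [← H.tensorAct_proj hV hW, phi_act (H.isModule_tensorAct hV hW) hM.compat, e,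
      phi₂_diagonalAction hV hW hM, ← LinearMap.lTensor_comp_apply]

end PhiLemmas

end RegularWMB

end WMB

namespace WMB

/-! ### The monoidal product of comodules -/

section Legs

variable {k : Type v} [Field k] {M : Type*} [AddCommGroup M] [Module k M]
  {N : Type*} [AddCommGroup N] [Module k N] {A : Type*} [AddCommGroup A] [Module k A]

theorem leg13_tmul (f : M ⊗[k] A →ₗ[k] M ⊗[k] A) (m : M) (n : N) (a : A) :
    leg13 N f ((m ⊗ₜ[k] n) ⊗ₜ[k] a) =
      ((TensorProduct.mk k M N).flip n).rTensor A (f (m ⊗ₜ[k] a)) := by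
  simp only [leg13, LinearMap.comp_apply, LinearEquiv.coe_coe, TensorProduct.rightComm_tmul,
    LinearMap.rTensor_tmul]
  generalize f (m ⊗ₜ[k] a) = z
  induction z with
  | zero => simp
  | tmul p q => simp
  | add x y hx hy => simp only [TensorProduct.add_tmul, map_add, hx, hy]

theorem leg23_tmul_tmul (f : N ⊗[k] A →ₗ[k] N ⊗[k] A) (m : M) (n : N) (a : A) :
    leg23 M f ((m ⊗ₜ[k] n) ⊗ₜ[k] a) =
      (TensorProduct.mk k M N m).rTensor A (f (n ⊗ₜ[k] a)) := by
  simp only [leg23, LinearMap.comp_apply, LinearEquiv.coe_coe, TensorProduct.assoc_tmul,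
    LinearMap.lTensor_tmul]
  generalize f (n ⊗ₜ[k] a) = z
  induction z with
  | zero => simp
  | tmul p q => simp
  | add x y hx hy => simp only [TensorProduct.tmul_add, map_add, hx, hy]

end Legs

namespace RegularWMB

section TensorComodules

variable {k : Type v} [Field k] {A : Type u} [NonUnitalRing A]
    [Module k A] [IsScalarTower k A A] [SMulCommClass k A A] {H : RegularWMB k A}
  {M : Type u} [AddCommGroup M] [Module k M] {N : Type u} [AddCommGroup N] [Module k N]
  {V : Type u} [AddCommGroup V] [Module k V] {act : V ⊗[k] A →ₗ[k] V}
  {lam rho : M ⊗[k] A →ₗ[k] M ⊗[k] A} {lamN rhoN : N ⊗[k] A →ₗ[k] N ⊗[k] A}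

/-- `n ⊗ a ↦ λ_M¹³(m ⊗ n ⊗ a)`. -/
noncomputable def lamAt (N : Type u) [AddCommGroup N] [Module k N]
    (lam : M ⊗[k] A →ₗ[k] M ⊗[k] A) (m : M) : N ⊗[k] A →ₗ[k] (M ⊗[k] N) ⊗[k] A :=
  leg13 N lam ∘ₗ (TensorProduct.mk k M N m).rTensor A

/-- `m ⊗ a ↦ m ⊗ ϱ_N(n ⊗ a)`. -/
noncomputable def rhoAt (M : Type u) [AddCommGroup M] [Module k M]
    (rhoN : N ⊗[k] A →ₗ[k] N ⊗[k] A) (n : N) : M ⊗[k] A →ₗ[k] (M ⊗[k] N) ⊗[k] A :=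
  leg23 M rhoN ∘ₗ ((TensorProduct.mk k M N).flip n).rTensor A

theorem lamAt_tmul (lam : M ⊗[k] A →ₗ[k] M ⊗[k] A) (m : M) (n : N) (a : A) :
    lamAt N lam m (n ⊗ₜ[k] a) =
      ((TensorProduct.mk k M N).flip n).rTensor A (lam (m ⊗ₜ[k] a)) :=
  leg13_tmul lam m n a

theorem rhoAt_tmul (rhoN : N ⊗[k] A →ₗ[k] N ⊗[k] A) (n : N) (m : M) (a : A) :
    rhoAt M rhoN n (m ⊗ₜ[k] a) =
      (TensorProduct.mk k M N m).rTensor A (rhoN (n ⊗ₜ[k] a)) :=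
  leg23_tmul_tmul rhoN m n a

theorem leg13_leg23_tmul (lam : M ⊗[k] A →ₗ[k] M ⊗[k] A) (lamN : N ⊗[k] A →ₗ[k] N ⊗[k] A)
    (m : M) (n : N) (a : A) :
    leg13 N lam (leg23 M lamN ((m ⊗ₜ[k] n) ⊗ₜ[k] a)) = lamAt N lam m (lamN (n ⊗ₜ[k] a)) := by
  rw [leg23_tmul_tmul]
  rfl

theorem leg23_leg13_tmul (rho : M ⊗[k] A →ₗ[k] M ⊗[k] A) (rhoN : N ⊗[k] A →ₗ[k] N ⊗[k] A)
    (m : M) (n : N) (a : A) :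
    leg23 M rhoN (leg13 N rho ((m ⊗ₜ[k] n) ⊗ₜ[k] a)) = rhoAt M rhoN n (rho (m ⊗ₜ[k] a)) := by
  rw [leg13_tmul]
  rfl

theorem lamAt_right (hM : H.IsFullComodule lam rho) (m : M) (r : H.base) (z : N ⊗[k] A) :
    lamAt N lam ((H.comoduleBaseAction lam rho).right (m ⊗ₜ[k] r)) z =
      lamAt N lam m (r.1.left.lTensor N z) := by
  induction z with
  | zero => simp
  | add x y hx hy => simp only [map_add, hx, hy]
  | tmul n a => rw [LinearMap.lTensor_tmul, lamAt_tmul, lamAt_tmul, hM.lam_right]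

theorem rhoAt_left (hN : H.IsFullComodule lamN rhoN) (r : H.base) (n : N) (z : M ⊗[k] A) :
    rhoAt M rhoN ((H.comoduleBaseAction lamN rhoN).left (r ⊗ₜ[k] n)) z =
      rhoAt M rhoN n (r.1.right.lTensor M z) := by
  induction z with
  | zero => simp
  | add x y hx hy => simp only [map_add, hx, hy]
  | tmul m a => rw [LinearMap.lTensor_tmul, rhoAt_tmul, rhoAt_tmul, hN.rho_left]

theorem tensorLam_proj (hM : H.IsFullComodule lam rho) (hN : H.IsFullComodule lamN rhoN)
    (z : M ⊗[k] N) (a : A) :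
    tensorLam (H.comoduleBaseAction lam rho) (H.comoduleBaseAction lamN rhoN) lam lamN
        (proj (H.comoduleBaseAction lam rho) (H.comoduleBaseAction lamN rhoN) z ⊗ₜ[k] a) =
      (proj (H.comoduleBaseAction lam rho) (H.comoduleBaseAction lamN rhoN)).rTensor A
        (leg13 N lam (leg23 M lamN (z ⊗ₜ[k] a))) := by
  set bM := H.comoduleBaseAction lam rho with hbM
  set bN := H.comoduleBaseAction lamN rhoN with hbN
  set g := (proj bM bN).rTensor A ∘ₗ leg13 N lam ∘ₗ leg23 M lamN with hg
  refine descend_apply (p := (proj bM bN).rTensor A) (g := g)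
    (ker_rTensor_le fun x hx a => ?_) (z ⊗ₜ[k] a)
  refine (ker_proj_le (g := g ∘ₗ (TensorProduct.mk k _ A).flip a) fun m r n => ?_) hx
  simp only [hg, LinearMap.comp_apply, LinearMap.flip_apply, TensorProduct.mk_apply]
  rw [leg13_leg23_tmul, leg13_leg23_tmul, hbM, hbN, lamAt_right hM, hN.lam_left]

theorem tensorRho_proj (hM : H.IsFullComodule lam rho) (hN : H.IsFullComodule lamN rhoN)
    (z : M ⊗[k] N) (a : A) :
    tensorRho (H.comoduleBaseAction lam rho) (H.comoduleBaseAction lamN rhoN) rho rhoN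
        (proj (H.comoduleBaseAction lam rho) (H.comoduleBaseAction lamN rhoN) z ⊗ₜ[k] a) =
      (proj (H.comoduleBaseAction lam rho) (H.comoduleBaseAction lamN rhoN)).rTensor A
        (leg23 M rhoN (leg13 N rho (z ⊗ₜ[k] a))) := by
  set bM := H.comoduleBaseAction lam rho with hbM
  set bN := H.comoduleBaseAction lamN rhoN with hbN
  set g := (proj bM bN).rTensor A ∘ₗ leg23 M rhoN ∘ₗ leg13 N rho with hg
  refine descend_apply (p := (proj bM bN).rTensor A) (g := g)
    (ker_rTensor_le fun x hx a => ?_) (z ⊗ₜ[k] a)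
  refine (ker_proj_le (g := g ∘ₗ (TensorProduct.mk k _ A).flip a) fun m r n => ?_) hx
  simp only [hg, LinearMap.comp_apply, LinearMap.flip_apply, TensorProduct.mk_apply]
  rw [leg23_leg13_tmul, leg23_leg13_tmul, hbM, hbN, rhoAt_left hN, hM.rho_right]

/-- `m ⊗ a ⊗ n ⊗ b ↦ m ⊗ n ⊗ a b`. -/
noncomputable def mulLegs (M N : Type u) [AddCommGroup M] [Module k M] [AddCommGroup N]
    [Module k N] : (M ⊗[k] A) ⊗[k] (N ⊗[k] A) →ₗ[k] (M ⊗[k] N) ⊗[k] A :=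
  (LinearMap.mul' k A).lTensor (M ⊗[k] N) ∘ₗ
    (TensorProduct.tensorTensorTensorComm k M A N A).toLinearMap

/-- `(1 ⊗ a)λ_M¹³(m ⊗ z)` can be computed from `ϱ_M(m ⊗ a)`. -/
theorem mulLeft_lamAt (hM : IsCompatible lam rho) (m : M) (a : A) (z : N ⊗[k] A) :
    (LinearMap.mulLeft k a).lTensor (M ⊗[k] N) (lamAt N lam m z) =
      mulLegs M N (rho (m ⊗ₜ[k] a) ⊗ₜ[k] z) := by
  induction z with
  | zero => simp
  | add x y hx hy => simp only [TensorProduct.tmul_add, map_add, hx, hy]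
  | tmul n q =>
    rw [lamAt_tmul, ← rTensor_lTensor, hM]
    generalize rho (m ⊗ₜ[k] a) = y
    induction y with
    | zero => simp
    | add x y hx hy => simp only [TensorProduct.add_tmul, map_add, hx, hy]
    | tmul m p => simp [mulLegs]

/-- `(M ⊗ ϱ_N)(z ⊗ n)(1 ⊗ b)` can be computed from `λ_N(n ⊗ b)`. -/
theorem mulRight_rhoAt (hN : IsCompatible lamN rhoN) (n : N) (b : A) (z : M ⊗[k] A) :
    (LinearMap.mulRight k b).lTensor (M ⊗[k] N) (rhoAt M rhoN n z) =
      mulLegs M N (z ⊗ₜ[k] lamN (n ⊗ₜ[k] b)) := by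
  induction z with
  | zero => simp
  | add x y hx hy => simp only [TensorProduct.add_tmul, map_add, hx, hy]
  | tmul m q =>
    rw [rhoAt_tmul, ← rTensor_lTensor, ← hN]
    generalize lamN (n ⊗ₜ[k] b) = y
    induction y with
    | zero => simp
    | add x y hx hy => simp only [TensorProduct.tmul_add, map_add, hx, hy]
    | tmul m p => simp [mulLegs]

/-- Both sides are `m₀ ⊗ n₀ ⊗ a m₁ n₁ b`. -/
theorem isCompatible_tensor (hM : H.IsFullComodule lam rho) (hN : H.IsFullComodule lamN rhoN) :
    IsCompatible
      (tensorLam (H.comoduleBaseAction lam rho) (H.comoduleBaseAction lamN rhoN) lam lamN)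
      (tensorRho (H.comoduleBaseAction lam rho) (H.comoduleBaseAction lamN rhoN) rho rhoN) := by
  intro x a b
  obtain ⟨z, rfl⟩ := proj_surjective _ _ x
  rw [tensorLam_proj hM hN, tensorRho_proj hM hN, ← rTensor_lTensor, ← rTensor_lTensor]
  congr 1
  induction z with
  | zero => simp
  | add x y hx hy => simp only [TensorProduct.add_tmul, map_add, hx, hy]
  | tmul m n =>
    rw [leg13_leg23_tmul, leg23_leg13_tmul, mulLeft_lamAt hM.compat, mulRight_rhoAt hN.compat]

theorem sliceR_tensorLam (hM : H.IsFullComodule lam rho) (hN : H.IsFullComodule lamN rhoN)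
    (m : M) (n : N) (a : A) :
    sliceR _ H.ε (tensorLam (H.comoduleBaseAction lam rho) (H.comoduleBaseAction lamN rhoN)
      lam lamN (proj _ _ (m ⊗ₜ[k] n) ⊗ₜ[k] a)) =
      proj (H.comoduleBaseAction lam rho) (H.comoduleBaseAction lamN rhoN)
        (m ⊗ₜ[k] (H.comoduleBaseAction lamN rhoN).right (n ⊗ₜ[k] H.piBarR' a)) := by
  rw [tensorLam_proj hM hN, sliceR_rTensor, leg13_leg23_tmul, ← hN.left_lam]
  generalize lamN (n ⊗ₜ[k] a) = z
  induction z with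
  | zero => simp
  | add x y hx hy => simp only [TensorProduct.tmul_add, map_add, hx, hy]
  | tmul n q =>
    rw [lamAt_tmul, sliceR_rTensor, ← epsAct_apply, ← hM.right_piBarR', LinearMap.flip_apply,
      TensorProduct.mk_apply, proj_right, tw_tmul, LinearMap.rTensor_tmul]

theorem sliceR_tensorRho (hM : H.IsFullComodule lam rho) (hN : H.IsFullComodule lamN rhoN)
    (m : M) (n : N) (a : A) :
    sliceR _ H.ε (tensorRho (H.comoduleBaseAction lam rho) (H.comoduleBaseAction lamN rhoN)
      rho rhoN (proj _ _ (m ⊗ₜ[k] n) ⊗ₜ[k] a)) =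
      proj (H.comoduleBaseAction lam rho) (H.comoduleBaseAction lamN rhoN)
        ((H.comoduleBaseAction lam rho).left (H.piR' a ⊗ₜ[k] m) ⊗ₜ[k] n) := by
  rw [tensorRho_proj hM hN, sliceR_rTensor, leg23_leg13_tmul, ← hM.right_rho]
  generalize rho (m ⊗ₜ[k] a) = z
  induction z with
  | zero => simp
  | add x y hx hy => simp only [TensorProduct.add_tmul, map_add, hx, hy]
  | tmul m q =>
    rw [rhoAt_tmul, sliceR_rTensor, ← epsAct_apply, ← hN.left_piR',
      TensorProduct.mk_apply, ← proj_right, LinearMap.lTensor_tmul]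

theorem isTensorBase_tensorLam (hM : H.IsFullComodule lam rho)
    (hN : H.IsFullComodule lamN rhoN) :
    IsTensorBase (H.comoduleBaseAction lam rho) (H.comoduleBaseAction lamN rhoN)
      (H.comoduleBaseAction
        (tensorLam (H.comoduleBaseAction lam rho) (H.comoduleBaseAction lamN rhoN) lam lamN)
        (tensorRho (H.comoduleBaseAction lam rho) (H.comoduleBaseAction lamN rhoN) rho rhoN)) where
  right m n r := by
    obtain ⟨a, rfl⟩ := H.exists_piBarR'_eq r
    rw [← sliceR_tensorLam hM hN]
    refine descend_apply (p := H.piBarR'.lTensor _)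
      (g := sliceR _ H.ε ∘ₗ tensorLam (H.comoduleBaseAction lam rho)
        (H.comoduleBaseAction lamN rhoN) lam lamN)
      (ker_lTensor_le fun c hc x => ?_) (proj _ _ (m ⊗ₜ[k] n) ⊗ₜ[k] a)
    obtain ⟨z, rfl⟩ := proj_surjective _ _ x
    induction z with
    | zero => simp
    | add x y hx hy => simp only [TensorProduct.add_tmul, map_add, hx, hy, add_zero]
    | tmul m n => rw [LinearMap.comp_apply, sliceR_tensorLam hM hN, hc]; simp
  left r m n := by
    obtain ⟨a, rfl⟩ := H.exists_piR'_eq r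
    rw [← sliceR_tensorRho hM hN]
    refine (descend_apply (p := H.piR'.rTensor _)
      (g := sliceR _ H.ε ∘ₗ tensorRho (H.comoduleBaseAction lam rho)
        (H.comoduleBaseAction lamN rhoN) rho rhoN ∘ₗ tw A _)
      (ker_rTensor_le fun c hc x => ?_) (a ⊗ₜ[k] proj _ _ (m ⊗ₜ[k] n))).trans ?_
    · obtain ⟨z, rfl⟩ := proj_surjective _ _ x
      induction z with
      | zero => simp
      | add x y hx hy => simp only [TensorProduct.tmul_add, map_add, hx, hy, add_zero]
      | tmul m n =>
        rw [LinearMap.comp_apply, LinearMap.comp_apply, tw_tmul, sliceR_tensorRho hM hN, hc]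
        simp
    · rw [LinearMap.comp_apply, LinearMap.comp_apply, tw_tmul]

theorem isLeftBalanced_tensor (hM : H.IsFullComodule lam rho)
    (hN : H.IsFullComodule lamN rhoN) :
    IsLeftBalanced
      (tensorRho (H.comoduleBaseAction lam rho) (H.comoduleBaseAction lamN rhoN) rho rhoN)
      (H.comoduleBaseAction
        (tensorLam (H.comoduleBaseAction lam rho) (H.comoduleBaseAction lamN rhoN) lam lamN)
        (tensorRho (H.comoduleBaseAction lam rho) (H.comoduleBaseAction lamN rhoN) rho rhoN)) := by
  intro x r a
  obtain ⟨z, rfl⟩ := proj_surjective _ _ x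
  induction z with
  | zero => simp
  | add x y hx hy => simp only [TensorProduct.tmul_add, TensorProduct.add_tmul, map_add, hx, hy]
  | tmul m n =>
    rw [(isTensorBase_tensorLam hM hN).left, tensorRho_proj hM hN, tensorRho_proj hM hN,
      leg23_leg13_tmul, leg23_leg13_tmul, hM.rho_left]

/-- `φ_{V, M ⊗_R N}` is induced by `(M ⊗ φ_{V,N})(φ_{V,M} ⊗ N)`. -/
theorem phi_tensorRho (hV : IsIdempotentNondegenerateModule act)
    (hM : H.IsFullComodule lam rho) (hN : H.IsFullComodule lamN rhoN) (v : V) (m : M) (n : N) :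
    phi act (tensorRho (H.comoduleBaseAction lam rho) (H.comoduleBaseAction lamN rhoN) rho rhoN)
        (v ⊗ₜ[k] proj (H.comoduleBaseAction lam rho) (H.comoduleBaseAction lamN rhoN)
          (m ⊗ₜ[k] n)) =
      (proj (H.comoduleBaseAction lam rho) (H.comoduleBaseAction lamN rhoN)).rTensor V
        ((TensorProduct.assoc k M N V).symm ((phi act rhoN).lTensor M
          (TensorProduct.assoc k M V N (phi act rho (v ⊗ₜ[k] m) ⊗ₜ[k] n)))) := by
  obtain ⟨x, rfl⟩ := hV.idempotent v
  induction x with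
  | zero => simp
  | add x y hx hy => simp only [TensorProduct.add_tmul, map_add, hx, hy]
  | tmul v a =>
    rw [phi_act hV (isCompatible_tensor hM hN), tensorRho_proj hM hN, ← rTensor_lTensor,
      leg23_leg13_tmul, phi_act hV hM.compat]
    congr 1
    generalize rho (m ⊗ₜ[k] a) = z
    induction z with
    | zero => simp
    | add x y hx hy => simp only [TensorProduct.add_tmul, map_add, hx, hy]
    | tmul m q =>
      rw [rhoAt_tmul, ← rTensor_lTensor, LinearMap.lTensor_tmul, TensorProduct.assoc_tmul,
        LinearMap.lTensor_tmul, orbit_apply, phi_act hV hN.compat]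
      generalize (LinearMap.lTensor N (orbit act v)) (rhoN (n ⊗ₜ[k] q)) = z
      induction z with
      | zero => simp
      | add x y hx hy => simp only [TensorProduct.tmul_add, map_add, hx, hy]
      | tmul n y => simp

end TensorComodules

end RegularWMB

end WMB

namespace WMB

namespace RegularWMB

/-! ### The monoidal units -/

section Units

variable {k : Type v} [Field k] {A : Type u} [NonUnitalRing A]
    [Module k A] [IsScalarTower k A A] [SMulCommClass k A A] (H : RegularWMB k A)
  {M : Type u} [AddCommGroup M] [Module k M]
  {V : Type u} [AddCommGroup V] [Module k V] {act : V ⊗[k] A →ₗ[k] V}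
  {lam rho : M ⊗[k] A →ₗ[k] M ⊗[k] A}

theorem piR'_right_eq_mul (a : A) (r : H.base) : (H.piR' (r.1.right a)).1 = H.piR a * r.1 := by
  obtain ⟨q, rfl⟩ := H.exists_piR'_eq r
  refine Multiplier.ext_left H.nondeg fun c => ?_
  rw [coe_piR', coe_piR', Multiplier.mul_left, piR_left, piR_left, piR_left, piR_right, piRl_piRr]

theorem piBarR'_left_eq_mul (r : H.base) (a : A) :
    (H.piBarR' (r.1.left a)).1 = r.1 * H.piBarR a := by
  obtain ⟨q, rfl⟩ := H.exists_piBarR'_eq r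
  refine Multiplier.ext_right H.nondeg fun c => ?_
  rw [coe_piBarR', coe_piBarR', Multiplier.mul_right, piBarR_left, piBarR_right, piBarR_right, piBarR_right,
    piBarRr_piBarRl]

/-- The multiplication of the base algebra. -/
noncomputable def baseMul (r s : H.base) : H.base :=
  ⟨r.1 * s.1, by
    obtain ⟨a, rfl⟩ := H.exists_piR'_eq r
    rw [coe_piR', ← piR'_right_eq_mul]
    exact Subtype.property _⟩

theorem baseMul_piR' (a : A) (r : H.base) : H.baseMul (H.piR' a) r = H.piR' (r.1.right a) :=
  Subtype.ext (H.piR'_right_eq_mul a r).symm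

theorem baseMul_piBarR' (r : H.base) (a : A) :
    H.baseMul r (H.piBarR' a) = H.piBarR' (r.1.left a) :=
  Subtype.ext (by rw [piBarR'_left_eq_mul, ← coe_piBarR']; rfl)

theorem baseMul_left (r s : H.base) (a : A) :
    (H.baseMul r s).1.left a = r.1.left (s.1.left a) := rfl

theorem baseMul_right (r s : H.base) (a : A) :
    (H.baseMul r s).1.right a = s.1.right (r.1.right a) := rfl

/-- The elements `r` of the base algebra are determined by the functionals `x ↦ ε(r x)`. -/
theorem eq_of_ε (hfull : H.RightFull) {r s : H.base}
    (h : ∀ x, H.ε (r.1.left x) = H.ε (s.1.left x)) : r = s := by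
  refine Subtype.ext (Multiplier.ext_left H.nondeg fun x => ?_)
  rw [← sub_eq_zero]
  obtain ⟨b, hb⟩ := H.isComodule_self.exists_epsAct_eq_self hfull (r.1.left x - s.1.left x)
  have e : H.ε ∘ₗ r.1.left = H.ε ∘ₗ s.1.left := LinearMap.ext h
  rw [← hb, map_sub, epsAct_apply, epsAct_apply, T₁_base, T₁_base, sliceR_lTensor, sliceR_lTensor,
    e, sub_self]

/-- `⊓ᴿ(⊓ᴿ(x)b) = ⊓ᴿ(x b)`, the associativity of the action on `R`. -/
theorem piR'_piRl (hfull : H.RightFull) (x b : A) : H.piR' (H.piRl x b) = H.piR' (x * b) :=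
  H.eq_of_ε hfull fun y => by
    rw [coe_piR', coe_piR', piR_left, piR_left, ε_piRl, ε_piRl, ← piR_left,
      ← Multiplier.left_mul H.nondeg, piR_left, ε_piRl, mul_assoc]

theorem baseAct_tmul (r : H.base) (a : A) : H.baseAct (r ⊗ₜ[k] a) = H.piR' (r.1.left a) := rfl

theorem isModule_baseAct (hfull : H.RightFull) :
    IsIdempotentNondegenerateModule H.baseAct where
  assoc r a b := by
    rw [baseAct_tmul, baseAct_tmul, baseAct_tmul, coe_piR', piR_left, piR'_piRl H hfull,
      Multiplier.left_mul H.nondeg]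
  idempotent r := by
    obtain ⟨a, rfl⟩ := H.exists_piR'_eq r
    obtain ⟨z, rfl⟩ := H.idempotent a
    induction z with
    | zero => exact ⟨0, by simp⟩
    | add x y hx hy =>
      obtain ⟨x', hx⟩ := hx
      obtain ⟨y', hy⟩ := hy
      exact ⟨x' + y', by simp only [map_add, hx, hy]⟩
    | tmul a b =>
      refine ⟨H.piR' a ⊗ₜ[k] b, ?_⟩
      rw [baseAct_tmul, coe_piR', piR_left, piR'_piRl H hfull, LinearMap.mul'_apply]
  nondegenerate r hr := by
    refine H.eq_of_ε hfull fun x => ?_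
    obtain ⟨z, rfl⟩ := H.idempotent x
    induction z with
    | zero => simp
    | add x y hx hy => simp only [map_add, hx, hy]
    | tmul a b =>
      have h : H.piRl (r.1.left a) = 0 := by
        rw [← piR_left, ← coe_piR', ← baseAct_tmul, hr]
        rfl
      rw [LinearMap.mul'_apply, Multiplier.left_mul H.nondeg, ← ε_piRl, h]
      exact (map_zero H.ε).trans (map_zero H.ε).symm

theorem moduleBaseAction_baseAct_right (hfull : H.RightFull) (s r : H.base) :
    (H.moduleBaseAction H.baseAct).right (s ⊗ₜ[k] r) = H.baseMul s r :=
  (H.isModule_baseAct hfull).eq_of_act fun a => by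
    rw [H.act_right (H.isModule_baseAct hfull)]
    rfl

theorem piRl_piBarLl (a b x : A) : H.piRl a (H.piBarLl b x) = H.piBarLl b (H.piRl a x) :=
  H.nondeg.eq_of_mul_left fun c => by
    rw [piR_compat, piBarL_compat, piBarL_compat, piR_compat, piBarLr_piRr]

theorem piRl_mul (a x y : A) : H.piRl a (x * y) = H.piRl a x * y := by
  rw [← piR_left, Multiplier.left_mul H.nondeg]

theorem piBarLl_mul (a x y : A) : H.piBarLl a (x * y) = H.piBarLl a x * y := by
  rw [← piBarL_left, Multiplier.left_mul H.nondeg]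

theorem ε_piBarLl (a x : A) : H.ε (H.piBarLl a x) = H.ε (a * x) :=
  (apply_sliceL_eq_apply_sliceR H.ε _).trans (congrArg H.ε (H.sliceR_T₂ a x))

/-- As `ε(s τ(r) x) = ε(τ(r) s x) = ε(r s x)`, the left action `s·τ(r)` on `R` is multiplication
by `r` on the left. -/
theorem moduleBaseAction_baseAct_left (hfull : H.RightFull) (r s : H.base) :
    (H.moduleBaseAction H.baseAct).left (r ⊗ₜ[k] s) = H.baseMul r s :=
  (H.isModule_baseAct hfull).eq_of_act fun a => by
    rw [H.act_left (H.isModule_baseAct hfull), baseAct_tmul, baseAct_tmul]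
    refine H.eq_of_ε hfull fun y => ?_
    rw [coe_piR', coe_piR', piR_left, piR_left, ε_piRl, ε_piRl, baseMul_left]
    obtain ⟨b, rfl⟩ := H.exists_piR'_eq r
    obtain ⟨c, rfl⟩ := H.exists_piR'_eq s
    rw [tau_piR', coe_piR', coe_piR', piBarL_left, piR_left, piR_left, piRl_piBarLl, ← piBarLl_mul,
      ε_piBarLl, ← H.piRl_mul b, ε_piRl]

/-- The evaluation `r ↦ c r`. -/
noncomputable def evalR (c : A) : H.base →ₗ[k] A :=
  (LinearMap.applyₗ (R := k) c ∘ₗ rightPart k A) ∘ₗ H.base.subtype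

/-- The evaluation `r ↦ r c`. -/
noncomputable def evalL (c : A) : H.base →ₗ[k] A :=
  (LinearMap.applyₗ (R := k) c ∘ₗ leftPart k A) ∘ₗ H.base.subtype

@[simp] theorem evalR_apply (c : A) (r : H.base) : H.evalR c r = r.1.right c := rfl

@[simp] theorem evalL_apply (c : A) (r : H.base) : H.evalL c r = r.1.left c := rfl

theorem evalR_comp_piR' (c : A) : H.evalR c ∘ₗ H.piR' = H.piRr.flip c :=
  LinearMap.ext fun x => by
    rw [LinearMap.comp_apply, evalR_apply, coe_piR', piR_right, LinearMap.flip_apply]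

theorem evalL_comp_piBarR' (c : A) : H.evalL c ∘ₗ H.piBarR' = H.piBarRl.flip c :=
  LinearMap.ext fun x => by
    rw [LinearMap.comp_apply, evalL_apply, coe_piBarR', piBarR_left, LinearMap.flip_apply]

theorem eq_of_evalR {z z' : H.base ⊗[k] M}
    (h : ∀ c, (H.evalR c).rTensor M z = (H.evalR c).rTensor M z') : z = z' :=
  eq_of_rTensor (fun c : A => H.evalR c)
    (fun _ hr => Subtype.ext (Multiplier.ext_right H.nondeg hr)) h

theorem evalRight_apply (z : H.base ⊗[k] A) (c : A) :
    H.evalRight z c = (H.evalR c).rTensor A z := by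
  induction z with
  | zero => simp
  | tmul r a => rfl
  | add x y hx hy => simp only [map_add, LinearMap.add_apply, hx, hy]

theorem evalLeft_apply (z : H.base ⊗[k] A) (c : A) :
    H.evalLeft z c = (H.evalL c).rTensor A z := by
  induction z with
  | zero => simp
  | tmul r a => rfl
  | add x y hx hy => simp only [map_add, LinearMap.add_apply, hx, hy]

/-- `ϱ(r ⊗ a) = (1 ⊗ a r)E`. -/
theorem evalR_baseRho (c : A) (r : H.base) (a : A) :
    (H.evalR c).rTensor A (H.baseRho (r ⊗ₜ[k] a)) = H.E.right (c ⊗ₜ[k] r.1.right a) := by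
  have h : LinearMap.range ((TensorProduct.curry H.E.right).flip ∘ₗ
      TensorProduct.lift (rightPart k A ∘ₗ H.base.subtype)) ≤ LinearMap.range H.evalRight := by
    rintro _ ⟨x, rfl⟩
    obtain ⟨z, hz⟩ := H.idempotent (TensorProduct.lift (rightPart k A ∘ₗ H.base.subtype) x)
    -- `(1 ⊗ a)E` lies in `R ⊗ A`, so the corestriction defining `ϱ` is genuine
    refine ⟨H.piR'.rTensor A (H.T₃ (tw A A z)), LinearMap.ext fun c => ?_⟩
    rw [evalRight_apply, ← LinearMap.rTensor_comp_apply, evalR_comp_piR', rTensor_piRr_T₃_tw, hz]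
    rfl
  rw [← evalRight_apply, baseRho, ← LinearMap.comp_apply, corestrict_comp h]
  rfl

/-- `λ(r ⊗ a) = E(1 ⊗ r a)`. -/
theorem evalL_baseLam (c : A) (r : H.base) (a : A) :
    (H.evalL c).rTensor A (H.baseLam (r ⊗ₜ[k] a)) = H.E.left (c ⊗ₜ[k] r.1.left a) := by
  have h : LinearMap.range ((TensorProduct.curry H.E.left).flip ∘ₗ
      TensorProduct.lift (leftPart k A ∘ₗ H.base.subtype)) ≤ LinearMap.range H.evalLeft := by
    rintro _ ⟨x, rfl⟩
    obtain ⟨z, hz⟩ := H.idempotent (TensorProduct.lift (leftPart k A ∘ₗ H.base.subtype) x)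
    -- `E(1 ⊗ a)` lies in `R ⊗ A`, so the corestriction defining `λ` is genuine
    refine ⟨H.piBarR'.rTensor A (H.T₁ z), LinearMap.ext fun c => ?_⟩
    rw [evalLeft_apply, ← LinearMap.rTensor_comp_apply, evalL_comp_piBarR', rTensor_piBarRl_T₁, hz]
    rfl
  rw [← evalLeft_apply, baseLam, ← LinearMap.comp_apply, corestrict_comp h]
  rfl

/-- `E` commutes with `1 ⊗ r`. -/
theorem E_left_lTensor_base (r : H.base) (b x : A) :
    H.E.left (b ⊗ₜ[k] r.1.left x) = r.1.left.lTensor A (H.E.left (b ⊗ₜ[k] x)) := by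
  obtain ⟨a, rfl⟩ := H.exists_piBarR'_eq r
  rw [coe_piBarR', piBarR_left, E_left_lTensor_piBarRl]

theorem isCompatible_base : IsCompatible H.baseLam H.baseRho := by
  intro r a b
  refine eq_of_rTensor (fun p : A × A => LinearMap.mulRight k p.2 ∘ₗ H.evalR p.1)
    (fun _ hr => Subtype.ext (Multiplier.ext_right H.nondeg fun c =>
      H.nondeg.left _ fun d => hr (c, d))) fun ⟨c, d⟩ => ?_
  have e : LinearMap.mulRight k d ∘ₗ H.evalR c = LinearMap.mulLeft k c ∘ₗ H.evalL d :=
    LinearMap.ext fun r => (r.1.compat c d).symm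
  dsimp only
  rw [rTensor_lTensor, rTensor_lTensor, e, LinearMap.rTensor_comp_apply,
    evalL_baseLam, ← tmul_mul_eq, E_left_lTensor_base, mul_lTensor_of_compat r.1.compat, ← e,
    LinearMap.rTensor_comp_apply, evalR_baseRho, ← mul_tmul_eq]
  exact H.E.compat _ _

theorem comoduleBaseAction_base_right (s r : H.base) :
    (H.comoduleBaseAction H.baseLam H.baseRho).right (s ⊗ₜ[k] r) = H.baseMul s r := by
  have h : ∀ (s : H.base) a, sliceR H.base H.ε (H.baseLam (s ⊗ₜ[k] a)) =
      H.baseMul s (H.piBarR' a) := fun s a => by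
    rw [baseMul_piBarR']
    refine Subtype.ext (Multiplier.ext_left H.nondeg fun c => ?_)
    rw [← evalL_apply, ← sliceR_rTensor, evalL_baseLam, coe_piBarR', piBarR_left]
    rfl
  obtain ⟨a, rfl⟩ := H.exists_piBarR'_eq r
  rw [← h]
  refine descend_apply (p := H.piBarR'.lTensor H.base) (g := sliceR H.base H.ε ∘ₗ H.baseLam)
    (ker_lTensor_le fun x hx s => ?_) (s ⊗ₜ[k] a)
  rw [LinearMap.comp_apply, h, hx]
  refine Subtype.ext (Multiplier.ext_left H.nondeg fun c => ?_)
  exact (congrArg s.1.left (rfl : (0 : Multiplier k A).left c = 0)).trans (map_zero s.1.left)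

theorem comoduleBaseAction_base_left (r s : H.base) :
    (H.comoduleBaseAction H.baseLam H.baseRho).left (r ⊗ₜ[k] s) = H.baseMul r s := by
  have h : ∀ (s : H.base) a, sliceR H.base H.ε (H.baseRho (s ⊗ₜ[k] a)) =
      H.baseMul (H.piR' a) s := fun s a => by
    rw [baseMul_piR']
    refine Subtype.ext (Multiplier.ext_right H.nondeg fun c => ?_)
    rw [← evalR_apply, ← sliceR_rTensor, evalR_baseRho, coe_piR', piR_right]
    rfl
  obtain ⟨a, rfl⟩ := H.exists_piR'_eq r
  rw [← h]
  refine (descend_apply (p := H.piR'.rTensor H.base)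
    (g := sliceR H.base H.ε ∘ₗ H.baseRho ∘ₗ tw A H.base)
    (ker_rTensor_le fun x hx s => ?_) (a ⊗ₜ[k] s)).trans ?_
  · rw [LinearMap.comp_apply, LinearMap.comp_apply, tw_tmul, h, hx]
    refine Subtype.ext (Multiplier.ext_right H.nondeg fun c => ?_)
    exact (congrArg s.1.right (rfl : (0 : Multiplier k A).right c = 0)).trans (map_zero s.1.right)
  · rw [LinearMap.comp_apply, LinearMap.comp_apply, tw_tmul]

theorem isLeftBalanced_base :
    IsLeftBalanced H.baseRho (H.comoduleBaseAction H.baseLam H.baseRho) := by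
  intro s r a
  refine H.eq_of_evalR fun c => ?_
  rw [comoduleBaseAction_base_left, evalR_baseRho, evalR_baseRho, baseMul_right]

variable {H}

/-- `ϱ(m ⊗ w a) = (1 ⊗ w)ϱ(m ⊗ a)`. -/
theorem IsComodule.rho_left_mul (hM : H.IsComodule lam rho) (m : M) (w : Multiplier k A) (a : A) :
    rho (m ⊗ₜ[k] w.left a) = w.left.lTensor M (rho (m ⊗ₜ[k] a)) :=
  H.nondeg.lTensor_left fun b => by
    rw [← hM.rho_mul, w.compat, hM.rho_mul, ← LinearMap.lTensor_comp_apply,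
      IsFullComodule.mulLeft_comp_left]

/-- The compatibility of `φ` with the monoidal unit of the category of modules. -/
theorem proj_phi_baseAct (hfull : H.RightFull) (hM : H.IsFullComodule lam rho) (r s : H.base)
    (m : M) :
    proj (H.comoduleBaseAction lam rho) (H.moduleBaseAction H.baseAct)
        (phi H.baseAct rho (r ⊗ₜ[k] (H.comoduleBaseAction lam rho).right (m ⊗ₜ[k] s))) =
      proj (H.comoduleBaseAction lam rho) (H.moduleBaseAction H.baseAct)
        ((H.comoduleBaseAction lam rho).left (r ⊗ₜ[k] m) ⊗ₜ[k] s) := by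
  have hR := H.isModule_baseAct hfull
  rw [phi_tmul_right hR hM]
  obtain ⟨x, rfl⟩ := hR.idempotent r
  induction x with
  | zero => simp
  | add x y hx hy => simp only [TensorProduct.add_tmul, map_add, hx, hy]
  | tmul t a =>
    have e : orbit H.baseAct t = H.piR' ∘ₗ t.1.left := LinearMap.ext fun a => rfl
    rw [phi_act hR hM.compat, e, LinearMap.lTensor_comp_apply M H.piR', ← hM.isComodule.rho_left_mul,
      baseAct_tmul, ← hM.right_rho]
    generalize (LinearMap.lTensor M H.piR') (rho (m ⊗ₜ[k] t.1.left a)) = z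
    induction z with
    | zero => simp
    | add x y hx hy => simp only [TensorProduct.add_tmul, map_add, hx, hy]
    | tmul n p =>
      rw [LinearMap.lTensor_tmul, proj_right, LinearMap.comp_apply, LinearMap.flip_apply,
        TensorProduct.mk_apply, H.moduleBaseAction_baseAct_right hfull,
        H.moduleBaseAction_baseAct_left hfull]

/-- The compatibility of `φ` with the monoidal unit of the category of comodules. -/
theorem proj_phi_baseRho (hV : IsIdempotentNondegenerateModule act) (v : V) (r s : H.base) :
    proj (H.comoduleBaseAction H.baseLam H.baseRho) (H.moduleBaseAction act)
        (phi act H.baseRho ((H.moduleBaseAction act).left (s ⊗ₜ[k] v) ⊗ₜ[k] r)) =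
      proj (H.comoduleBaseAction H.baseLam H.baseRho) (H.moduleBaseAction act)
        (s ⊗ₜ[k] (H.moduleBaseAction act).right (v ⊗ₜ[k] r)) := by
  obtain ⟨x, rfl⟩ := hV.idempotent v
  induction x with
  | zero => simp
  | add x y hx hy => simp only [TensorProduct.add_tmul, TensorProduct.tmul_add, map_add, hx, hy]
  | tmul v a =>
    rw [H.left_act hV, H.right_act hV, phi_act hV H.isCompatible_base]
    obtain ⟨z, hz⟩ := H.idempotent (r.1.right a)
    let L : H.base →ₗ[k] H.base := (H.comoduleBaseAction H.baseLam H.baseRho).right ∘ₗ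
      TensorProduct.mk k H.base H.base s
    -- with `a r` a sum of products `b c`, the element `(1 ⊗ a τ(s) r)E = (s ⊗ 1)(1 ⊗ b c)E` is `s ⊓ᴿ(c₁) ⊗ b c₂`
    have e : H.baseRho (r ⊗ₜ[k] (H.tau s).right a) =
        (L ∘ₗ H.piR').rTensor A (H.T₃ (tw A A z)) := by
      refine H.eq_of_evalR fun c => ?_
      have e₁ : H.evalR c ∘ₗ L ∘ₗ H.piR' = H.piRr.flip (s.1.right c) := by
        refine LinearMap.ext fun x => ?_
        rw [← evalR_comp_piR']
        change (L (H.piR' x)).1.right c = (H.piR' x).1.right (s.1.right c)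
        rw [← baseMul_right, ← comoduleBaseAction_base_right]
        rfl
      rw [evalR_baseRho, ← LinearMap.rTensor_comp_apply, e₁, rTensor_piRr_T₃_tw, hz, E_right_right]
      congr 2
      obtain ⟨b, rfl⟩ := H.exists_piR'_eq s
      obtain ⟨d, rfl⟩ := H.exists_piR'_eq r
      rw [coe_piR', tau_piR', piR_right, piBarL_right, piBarLr_piRr]
    rw [e, ← hz]
    clear e hz
    induction z with
    | zero => simp
    | add x y hx hy => simp only [TensorProduct.tmul_add, map_add, hx, hy]
    | tmul b c =>
      rw [tw_tmul, LinearMap.mul'_apply, ← H.lift_piBarLr_T₃]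
      generalize H.T₃ (c ⊗ₜ[k] b) = t
      induction t with
      | zero => simp
      | add x y hx hy => simp only [TensorProduct.tmul_add, map_add, hx, hy]
      | tmul p q =>
        rw [LinearMap.rTensor_tmul, LinearMap.lTensor_tmul, LinearMap.comp_apply,
          LinearMap.comp_apply, TensorProduct.mk_apply, proj_right, orbit_apply, H.left_act hV,
          tau_piR', piBarL_right, TensorProduct.lift.tmul]

end Units

end RegularWMB

end WMB

namespace WMB

namespace RegularWMB

section YetterDrinfeld

variable {k : Type v} [Field k] {A : Type u} [NonUnitalRing A]
    [Module k A] [IsScalarTower k A A] [SMulCommClass k A A] {H : RegularWMB k A}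
  {X : Type u} [AddCommGroup X] [Module k X]
  {act : X ⊗[k] A →ₗ[k] X} {lam rho : X ⊗[k] A →ₗ[k] X ⊗[k] A}
  {M : Type u} [AddCommGroup M] [Module k M] {lamM rhoM : M ⊗[k] A →ₗ[k] M ⊗[k] A}
  {V : Type u} [AddCommGroup V] [Module k V] {actV : V ⊗[k] A →ₗ[k] V}
  {W : Type u} [AddCommGroup W] [Module k W] {actW : W ⊗[k] A →ₗ[k] W}
  {V' : Type u} [AddCommGroup V'] [Module k V'] {actV' : V' ⊗[k] A →ₗ[k] V'}
  {W' : Type u} [AddCommGroup W'] [Module k W'] {actW' : W' ⊗[k] A →ₗ[k] W'}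

/-! ### The coincidence of the two actions of the base algebra -/

/-- Linear maps on a full comodule are determined by their values on the first leg of `ϱ`. -/
theorem IsFullComodule.ext_of_rho (h : H.IsFullComodule lam rho) {f g : X →ₗ[k] V}
    (hfg : ∀ x a, f.rTensor A (rho (x ⊗ₜ[k] a)) = g.rTensor A (rho (x ⊗ₜ[k] a))) : f = g := by
  have hfg' : ∀ x a, f.rTensor A (lam (x ⊗ₜ[k] a)) = g.rTensor A (lam (x ⊗ₜ[k] a)) :=
    fun x a => H.nondeg.lTensor_left fun c => by
      rw [← rTensor_lTensor, ← rTensor_lTensor, h.compat, rTensor_lTensor, rTensor_lTensor, hfg]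
  rcases h.full with hs | hs
  · refine LinearMap.ext_on hs ?_
    rintro _ ⟨ω, x, a, rfl⟩
    rw [← sliceR_rTensor, ← sliceR_rTensor, hfg']
  · refine LinearMap.ext_on hs ?_
    rintro _ ⟨ω, x, a, rfl⟩
    rw [← sliceR_rTensor, ← sliceR_rTensor, hfg]

/-- The hypotheses `E₂ϱ = ϱ = ϱE₂²¹` identify the `R`-actions of the module `X` and of the comodule
`X`: the first one the right actions, by `E(⊓̄ᴿ(p) ⊗ 1) = E(1 ⊗ ⊓ᴸ(p))`, and the second one the
left actions, by `(r ⊗ 1)E = (1 ⊗ τ(r))E`. -/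
theorem comoduleBaseAction_eq_moduleBaseAction (hmod : IsIdempotentNondegenerateModule act)
    (hcomod : H.IsFullComodule lam rho)
    (h₁ : H.E₂ act (LinearMap.mul' k A) ∘ₗ rho = rho)
    (h₂ : rho ∘ₗ (tw A X ∘ₗ H.E₂ (LinearMap.mul' k A) act ∘ₗ tw X A) = rho) :
    H.comoduleBaseAction lam rho = H.moduleBaseAction act := by
  have hA := H.isModule_mul'
  -- with `ϱ(x ⊗ a) = x₀ ⊗ a x₁`, the elements `x₀ r` and `x₀·r` are compared after the action of `c`
  -- on the first leg and the multiplication by `q` on the second one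
  have hr : (H.comoduleBaseAction lam rho).right = (H.moduleBaseAction act).right := by
    refine TensorProduct.ext' fun x r => ?_
    suffices h : (H.comoduleBaseAction lam rho).right ∘ₗ (TensorProduct.mk k X H.base).flip r =
        (H.moduleBaseAction act).right ∘ₗ (TensorProduct.mk k X H.base).flip r from
      LinearMap.congr_fun h x
    refine hcomod.ext_of_rho fun x a => ?_
    obtain ⟨p, rfl⟩ := H.exists_piBarR'_eq r
    have e : (H.comoduleBaseAction lam rho).right ∘ₗ
        (TensorProduct.mk k X H.base).flip (H.piBarR' p) = H.epsAct lam p :=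
      LinearMap.ext fun x => hcomod.right_piBarR' x p
    refine eq_of_lTensor (fun q : A => LinearMap.mulRight k q)
      (fun y hy => H.nondeg.left y hy) fun q => ?_
    refine eq_of_rTensor (fun c : A => actBy act c) (fun v hv => hmod.nondegenerate v hv)
      fun c => ?_
    have e₁ : actBy act c ∘ₗ (H.moduleBaseAction act).right ∘ₗ
        (TensorProduct.mk k X H.base).flip (H.piBarR' p) = actBy act (H.piBarRl p c) :=
      LinearMap.ext fun x => by
        rw [← piBarR_left, ← coe_piBarR']
        exact H.act_right hmod x (H.piBarR' p) c
    have key : ∀ (z : X ⊗[k] A) c q, externalAction act (LinearMap.mul' k A) (z ⊗ₜ[k]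
        (c ⊗ₜ[k] q)) = (actBy act c).rTensor A ((LinearMap.mulRight k q).lTensor X z) :=
      fun z c q => by
        induction z with
        | zero => simp
        | add x y hx hy => simp only [TensorProduct.add_tmul, map_add, hx, hy]
        | tmul x a => simp
    have h₁' : H.E₂ act (LinearMap.mul' k A) (rho (x ⊗ₜ[k] a)) = rho (x ⊗ₜ[k] a) :=
      LinearMap.congr_fun h₁ (x ⊗ₜ[k] a)
    rw [← rTensor_lTensor, ← rTensor_lTensor, e, ← LinearMap.rTensor_comp_apply _ (actBy act c)
      ((H.moduleBaseAction act).right ∘ₗ _), e₁, ← key, ← hcomod.compat, rTensor_lTensor,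
      hcomod.isComodule.rTensor_epsAct, hcomod.compat, ← key, ← h₁',
      H.externalAction_E₂ hmod hA, H.externalAction_E₂ hmod hA, E_left_piBarRl]
  have hl : (H.comoduleBaseAction lam rho).left = (H.moduleBaseAction act).left := by
    refine TensorProduct.ext' fun r x => hcomod.eq_of_rho fun a => ?_
    have h₂' : ∀ x a, rho (tw A X (H.E₂ (LinearMap.mul' k A) act (a ⊗ₜ[k] x))) =
        rho (x ⊗ₜ[k] a) := fun x a => LinearMap.congr_fun h₂ (x ⊗ₜ[k] a)
    rw [hcomod.rho_left, ← h₂', ← h₂']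
    congr 2
    obtain ⟨y, rfl⟩ := hmod.idempotent x
    obtain ⟨z, rfl⟩ := H.idempotent a
    induction y with
    | zero => simp
    | add x y hx hy => simp only [TensorProduct.tmul_add, map_add, hx, hy]
    | tmul x q =>
      induction z with
      | zero => simp
      | add x y hx hy => simp only [TensorProduct.add_tmul, map_add, hx, hy]
      | tmul b c =>
        have e : r.1.right (LinearMap.mul' k A (b ⊗ₜ[k] c)) =
            LinearMap.mul' k A (b ⊗ₜ[k] r.1.right c) := by
          rw [LinearMap.mul'_apply, LinearMap.mul'_apply, Multiplier.right_mul H.nondeg]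
        rw [e, H.left_act hmod, ← externalAction_tmul, ← externalAction_tmul,
          H.E₂_externalAction hA hmod, H.E₂_externalAction hA hmod, E_right_right]
  cases hc : H.comoduleBaseAction lam rho
  cases hm : H.moduleBaseAction act
  rw [hc, hm] at hr hl
  dsimp only at hr hl
  rw [hr, hl]

/-! ### Compatible modules and comodules -/

theorem isModuleMap_orbit (hV : IsIdempotentNondegenerateModule actV) (v : V) :
    IsModuleMap (LinearMap.mul' k A) actV (orbit actV v) :=
  fun a b => hV.assoc v a b

/-- Module maps `f` and `g` induce a map `f ⊗ g` compatible with the diagonal actions. -/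
theorem diagonalAction_map (hV : IsIdempotentNondegenerateModule actV)
    (hW : IsIdempotentNondegenerateModule actW) (hV' : IsIdempotentNondegenerateModule actV')
    (hW' : IsIdempotentNondegenerateModule actW') {f : V →ₗ[k] V'} {g : W →ₗ[k] W'}
    (hf : IsModuleMap actV actV' f) (hg : IsModuleMap actW actW' g) (z : V ⊗[k] W) (c : A) :
    TensorProduct.map f g (H.diagonalAction actV actW (z ⊗ₜ[k] c)) =
      H.diagonalAction actV' actW' (TensorProduct.map f g z ⊗ₜ[k] c) := by
  refine (isIdempotentNondegenerateModule_externalAction hV hW).map_multiplierAction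
    (isIdempotentNondegenerateModule_externalAction hV' hW') (fun z y => ?_) z (H.Δ c)
  induction z with
  | zero => simp
  | add x y hx hy => simp only [TensorProduct.add_tmul, map_add, hx, hy]
  | tmul v w =>
    induction y with
    | zero => simp
    | add x y hx hy => simp only [TensorProduct.tmul_add, map_add, hx, hy]
    | tmul a b => simp [hf v a, hg w b]

theorem IsComodule.phi_mul'_tmul (hM : H.IsComodule lamM rhoM) (a : A) (m : M) :
    phi (LinearMap.mul' k A) rhoM (a ⊗ₜ[k] m) = rhoM (m ⊗ₜ[k] a) := by
  obtain ⟨z, rfl⟩ := H.idempotent a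
  induction z with
  | zero => simp
  | add x y hx hy => simp only [TensorProduct.add_tmul, TensorProduct.tmul_add, map_add, hx, hy]
  | tmul a b =>
    rw [phi_act H.isModule_mul' hM.compat, LinearMap.mul'_apply, hM.rho_mul]
    rfl

theorem IsComodule.phi_mul' (hM : H.IsComodule lamM rhoM) (z : A ⊗[k] M) :
    phi (LinearMap.mul' k A) rhoM z = rhoM (tw A M z) := by
  induction z with
  | zero => simp
  | add x y hx hy => simp only [map_add, hx, hy]
  | tmul a m => rw [hM.phi_mul'_tmul, tw_tmul]

/-- If `ϱ` is compatible with the diagonal actions of `X ⊗ A` and `A ⊗ X`, then `φ_{V,X}` is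
compatible with those of `V ⊗ X` and `X ⊗ V`, as the orbit maps `A → V` cover `V`. -/
theorem phi_diagonalAction (hmod : IsIdempotentNondegenerateModule act)
    (hcomod : H.IsFullComodule lam rho) (hV : IsIdempotentNondegenerateModule actV)
    (he : ∀ (x : X) (a b : A),
        rho (H.diagonalActionOp act (LinearMap.mul' k A) ((x ⊗ₜ[k] a) ⊗ₜ[k] b)) =
          H.diagonalAction act (LinearMap.mul' k A) (rho (x ⊗ₜ[k] a) ⊗ₜ[k] b))
    (z : V ⊗[k] X) (c : A) :
    phi actV rho (H.diagonalAction actV act (z ⊗ₜ[k] c)) =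
      H.diagonalAction act actV (phi actV rho z ⊗ₜ[k] c) := by
  have hA := H.isModule_mul'
  induction z with
  | zero => simp
  | add x y hx hy => simp only [TensorProduct.add_tmul, map_add, hx, hy]
  | tmul v x =>
    obtain ⟨y, rfl⟩ := hV.idempotent v
    induction y with
    | zero => simp
    | add x y hx hy => simp only [TensorProduct.add_tmul, map_add, hx, hy]
    | tmul v a =>
      have hid : IsModuleMap act act LinearMap.id := fun _ _ => rfl
      have hv := isModuleMap_orbit hV v
      have hphi : ∀ z : A ⊗[k] X, phi actV rho (TensorProduct.map (orbit actV v) LinearMap.id z) =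
          TensorProduct.map LinearMap.id (orbit actV v) (rho (tw A X z)) := fun z => by
        induction z with
        | zero => simp
        | add x y hx hy => simp only [map_add, hx, hy]
        | tmul a x =>
          rw [TensorProduct.map_tmul, phi_map_left hA hV hcomod.compat hv,
            hcomod.isComodule.phi_mul'_tmul]
          rfl
      have e : actV (v ⊗ₜ[k] a) ⊗ₜ[k] x =
        TensorProduct.map (orbit actV v) LinearMap.id (a ⊗ₜ[k] x) := rfl
      have he' : rho (tw A X (H.diagonalAction (LinearMap.mul' k A) act
          ((a ⊗ₜ[k] x) ⊗ₜ[k] c))) =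
          H.diagonalAction act (LinearMap.mul' k A) (rho (x ⊗ₜ[k] a) ⊗ₜ[k] c) := by
        rw [← he]
        simp [diagonalActionOp]
      rw [e, ← diagonalAction_map hA hmod hV hmod hv hid, hphi, he', hphi, tw_tmul,
        diagonalAction_map hmod hA hmod hV hid hv]

/-- The comultiplicative form of the compatibility: `Δ(m)` acts on `v ⊗ w·a` by
`m₁ ⊗ a m₂ = T₃(m ⊗ a)`. -/
theorem diagonalAction_act (hV : IsIdempotentNondegenerateModule actV)
    (hW : IsIdempotentNondegenerateModule actW) (v : V) (w : W) (a m : A) :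
    H.diagonalAction actV actW ((v ⊗ₜ[k] actW (w ⊗ₜ[k] a)) ⊗ₜ[k] m) =
      TensorProduct.map (orbit actV v) (orbit actW w) (H.T₃ (m ⊗ₜ[k] a)) := by
  obtain ⟨y, rfl⟩ := hV.idempotent v
  induction y with
  | zero => simp
  | add x y hx hy => simp only [TensorProduct.add_tmul, map_add, hx, hy, TensorProduct.map_add_left,
      LinearMap.add_apply]
  | tmul v b =>
    have e : orbit actV (actV (v ⊗ₜ[k] b)) = orbit actV v ∘ₗ LinearMap.mulLeft k b :=
      LinearMap.ext fun c => (hV.assoc v b c).symm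
    rw [← externalAction_tmul, H.diagonalAction_externalAction hV hW, Δ_right_tmul',
      externalAction_eq, e, ← LinearMap.comp_apply, ← LinearMap.comp_apply, LinearMap.rTensor,
      ← TensorProduct.map_comp]
    rfl

theorem diagonalAction_mul' (hV : IsIdempotentNondegenerateModule actV) (v : V) (a m : A) :
    H.diagonalAction actV (LinearMap.mul' k A) ((v ⊗ₜ[k] a) ⊗ₜ[k] m) =
      (orbit actV v).rTensor A (H.T₃ (m ⊗ₜ[k] a)) := by
  obtain ⟨z, rfl⟩ := H.idempotent a
  induction z with
  | zero => simp
  | add x y hx hy => simp only [TensorProduct.add_tmul, TensorProduct.tmul_add, map_add, hx, hy]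
  | tmul a b =>
    rw [diagonalAction_act hV H.isModule_mul', LinearMap.mul'_apply, H.isComodule_self.rho_mul]
    generalize H.T₃ (m ⊗ₜ[k] b) = t
    induction t with
    | zero => simp
    | add x y hx hy => simp only [map_add, hx, hy]
    | tmul p q => simp

/-! ### The maps `φ̂` as comodule maps -/

theorem assoc_symm_assocMap {B P Q S : Type*} [AddCommGroup B] [Module k B] [AddCommGroup P]
    [Module k P] [AddCommGroup Q] [Module k Q] [AddCommGroup S] [Module k S]
    (f : P →ₗ[k] Q ⊗[k] S) (y : P ⊗[k] B) :
    (TensorProduct.assoc k Q S B).symm (assocMap f LinearMap.id y) = f.rTensor B y := by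
  rw [assocMap, LinearMap.comp_apply, LinearEquiv.coe_coe, LinearEquiv.symm_apply_apply]
  rfl

/-- `(1 ⊗ 1 ⊗ c)(φ_{X,M} ⊗ A)λ_{X ⊗ M}(x ⊗ m ⊗ a)`, computed from `ϱ(x ⊗ c)`. -/
theorem mulLeft_phi_lamAt (hc : IsCompatible lam rho) (hM : H.IsComodule lamM rhoM)
    (x : X) (m : M) (a c : A) :
    (LinearMap.mulLeft k c).lTensor (M ⊗[k] X)
        ((phi act rhoM).rTensor A (lamAt M lam x (lamM (m ⊗ₜ[k] a)))) =
      (LinearMap.mulRight k a).lTensor (M ⊗[k] X) ((TensorProduct.assoc k M X A).symm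
        (phi₂ act (LinearMap.mul' k A) rhoM (rho (x ⊗ₜ[k] c) ⊗ₜ[k] m))) := by
  rw [← rTensor_lTensor, mulLeft_lamAt hc]
  generalize rho (x ⊗ₜ[k] c) = y
  induction y with
  | zero => simp
  | add x y hx hy => simp only [TensorProduct.add_tmul, map_add, hx, hy]
  | tmul x p =>
    have e : mulLegs X M ((x ⊗ₜ[k] p) ⊗ₜ[k] lamM (m ⊗ₜ[k] a)) =
        (TensorProduct.mk k X M x).rTensor A
          ((LinearMap.mulLeft k p).lTensor M (lamM (m ⊗ₜ[k] a))) := by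
      generalize lamM (m ⊗ₜ[k] a) = z
      induction z with
      | zero => simp
      | add x y hx hy => simp only [TensorProduct.tmul_add, map_add, hx, hy]
      | tmul m q => simp [mulLegs]
    rw [e, hM.compat, rTensor_lTensor, rTensor_lTensor, phi₂_tmul, assoc_symm_assocMap,
      hM.phi_mul'_tmul, ← LinearMap.rTensor_comp_apply]

/-- `(1 ⊗ 1 ⊗ c)λ_{M ⊗ X}(φ_{X,M}(x ⊗ m) ⊗ a)`, computed from `ϱ_M`. -/
theorem mulLeft_lamAt_phi (hc : IsCompatible lam rho) (hM : H.IsComodule lamM rhoM)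
    (x : X) (m : M) (a c : A) :
    (LinearMap.mulLeft k c).lTensor (M ⊗[k] X)
        (leg13 X lamM (leg23 M lam (phi act rhoM (x ⊗ₜ[k] m) ⊗ₜ[k] a))) =
      (LinearMap.mulRight k a).lTensor (M ⊗[k] X) ((TensorProduct.assoc k M X A).symm
        ((rho ∘ₗ tw A X).lTensor M
          (phi₂ (LinearMap.mul' k A) act rhoM ((c ⊗ₜ[k] x) ⊗ₜ[k] m)))) := by
  rw [phi₂_tmul]
  generalize phi act rhoM (x ⊗ₜ[k] m) = z
  induction z with
  | zero => simp
  | add x y hx hy => simp only [TensorProduct.add_tmul, map_add, hx, hy]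
  | tmul m x =>
    have e : ∀ z : M ⊗[k] A, (TensorProduct.assoc k M X A).symm ((rho ∘ₗ tw A X).lTensor M
        (TensorProduct.assoc k M A X (z ⊗ₜ[k] x))) = rhoAt M rho x z := fun z => by
      induction z with
      | zero => simp
      | add x y hx hy => simp only [TensorProduct.add_tmul, map_add, hx, hy]
      | tmul m p =>
        rw [rhoAt_tmul, TensorProduct.assoc_tmul, LinearMap.lTensor_tmul, LinearMap.comp_apply,
          tw_tmul]
        generalize rho (x ⊗ₜ[k] p) = y
        induction y with
        | zero => simp
        | add x y hx hy => simp only [TensorProduct.tmul_add, map_add, hx, hy]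
        | tmul x q => simp
    rw [assocMap_tmul, LinearMap.id_apply, e, leg13_leg23_tmul, mulLeft_lamAt hM.compat,
      ← mulRight_rhoAt hc, LinearMap.comp_apply, TensorProduct.mk_apply, hM.phi_mul'_tmul]

/-- `φ̂_{X,M}` is a comodule map if and only if `φ₂(ϱ(x ⊗ c) ⊗ m) = (M ⊗ ϱ)φ₂(x ⊗ c ⊗ m)`
modulo the balancing relations. -/
theorem isComoduleMap_phiHat_iff (hmod : IsIdempotentNondegenerateModule act)
    (hcomod : H.IsFullComodule lam rho)
    (hb : H.comoduleBaseAction lam rho = H.moduleBaseAction act)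
    (hM : H.IsFullComodule lamM rhoM) :
    IsComoduleMap
        (tensorLam (H.comoduleBaseAction lam rho) (H.comoduleBaseAction lamM rhoM) lam lamM)
        (tensorLam (H.comoduleBaseAction lamM rhoM) (H.comoduleBaseAction lam rho) lamM lam)
        (phiHat act rhoM (H.comoduleBaseAction lam rho) (H.comoduleBaseAction lamM rhoM)) ↔
      ∀ x c m, (proj (H.comoduleBaseAction lamM rhoM) (H.comoduleBaseAction lam rho)).rTensor A
          ((TensorProduct.assoc k M X A).symm
            (phi₂ act (LinearMap.mul' k A) rhoM (rho (x ⊗ₜ[k] c) ⊗ₜ[k] m))) =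
        (proj (H.comoduleBaseAction lamM rhoM) (H.comoduleBaseAction lam rho)).rTensor A
          ((TensorProduct.assoc k M X A).symm ((rho ∘ₗ tw A X).lTensor M
            (phi₂ (LinearMap.mul' k A) act rhoM ((c ⊗ₜ[k] x) ⊗ₜ[k] m)))) := by
  set bX := H.comoduleBaseAction lam rho with hbX
  set bM := H.comoduleBaseAction lamM rhoM with hbM
  have hbal : IsLeftBalanced rhoM bM := hM.rho_left
  have hl : ∀ x m a, (phiHat act rhoM bX bM).rTensor A
      (tensorLam bX bM lam lamM (proj bX bM (x ⊗ₜ[k] m) ⊗ₜ[k] a)) =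
      (proj bM bX).rTensor A
        ((phi act rhoM).rTensor A (lamAt M lam x (lamM (m ⊗ₜ[k] a)))) := fun x m a => by
    have e : phiHat act rhoM bX bM ∘ₗ proj bX bM = proj bM bX ∘ₗ phi act rhoM :=
      LinearMap.ext fun z => phiHat_proj hmod hM.compat hb hbal z
    rw [tensorLam_proj hcomod hM, leg13_leg23_tmul, ← LinearMap.rTensor_comp_apply, e,
      LinearMap.rTensor_comp_apply]
  have hr : ∀ x m a, tensorLam bM bX lamM lam
      (phiHat act rhoM bX bM (proj bX bM (x ⊗ₜ[k] m)) ⊗ₜ[k] a) =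
      (proj bM bX).rTensor A
        (leg13 X lamM (leg23 M lam (phi act rhoM (x ⊗ₜ[k] m) ⊗ₜ[k] a))) := fun x m a => by
    rw [phiHat_proj hmod hM.compat hb hbal, tensorLam_proj hM hcomod]
  have key : ∀ x m a, ((phiHat act rhoM bX bM).rTensor A
      (tensorLam bX bM lam lamM (proj bX bM (x ⊗ₜ[k] m) ⊗ₜ[k] a)) =
        tensorLam bM bX lamM lam (phiHat act rhoM bX bM (proj bX bM (x ⊗ₜ[k] m)) ⊗ₜ[k] a)) ↔
      ∀ c, (LinearMap.mulRight k a).lTensor _ ((proj bM bX).rTensor A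
          ((TensorProduct.assoc k M X A).symm
            (phi₂ act (LinearMap.mul' k A) rhoM (rho (x ⊗ₜ[k] c) ⊗ₜ[k] m)))) =
        (LinearMap.mulRight k a).lTensor _ ((proj bM bX).rTensor A
          ((TensorProduct.assoc k M X A).symm ((rho ∘ₗ tw A X).lTensor M
            (phi₂ (LinearMap.mul' k A) act rhoM ((c ⊗ₜ[k] x) ⊗ₜ[k] m))))) := fun x m a => by
    rw [hl, hr]
    have hc : ∀ c, (LinearMap.mulLeft k c).lTensor _ ((proj bM bX).rTensor A
        ((phi act rhoM).rTensor A (lamAt M lam x (lamM (m ⊗ₜ[k] a))))) =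
        (LinearMap.mulRight k a).lTensor _ ((proj bM bX).rTensor A
          ((TensorProduct.assoc k M X A).symm
            (phi₂ act (LinearMap.mul' k A) rhoM (rho (x ⊗ₜ[k] c) ⊗ₜ[k] m)))) := fun c => by
      rw [← rTensor_lTensor, mulLeft_phi_lamAt hcomod.compat hM.isComodule, rTensor_lTensor]
    have hc' : ∀ c, (LinearMap.mulLeft k c).lTensor _ ((proj bM bX).rTensor A
        (leg13 X lamM (leg23 M lam (phi act rhoM (x ⊗ₜ[k] m) ⊗ₜ[k] a)))) =
        (LinearMap.mulRight k a).lTensor _ ((proj bM bX).rTensor A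
          ((TensorProduct.assoc k M X A).symm ((rho ∘ₗ tw A X).lTensor M
            (phi₂ (LinearMap.mul' k A) act rhoM ((c ⊗ₜ[k] x) ⊗ₜ[k] m))))) := fun c => by
      rw [← rTensor_lTensor, mulLeft_lamAt_phi hcomod.compat hM.isComodule, rTensor_lTensor]
    exact ⟨fun h c => by rw [← hc, h, hc'],
      fun h => H.nondeg.lTensor_left fun c => by rw [hc, h, hc']⟩
  constructor
  · intro h x c m
    exact H.nondeg.lTensor_right fun a =>
      (key x m a).1 (LinearMap.congr_fun h (proj bX bM (x ⊗ₜ[k] m) ⊗ₜ[k] a)) c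
  · intro h
    refine TensorProduct.ext' fun y a => ?_
    obtain ⟨z, rfl⟩ := proj_surjective _ _ y
    rw [LinearMap.comp_apply, LinearMap.comp_apply, LinearMap.rTensor_tmul]
    induction z with
    | zero => simp
    | add x y hx hy => simp only [TensorProduct.add_tmul, map_add, hx, hy]
    | tmul x m => exact (key x m a).2 fun c => by rw [h]

/-- The compatibility of `ϱ` with the diagonal actions implies that the maps `φ̂_{X,M}` are comodule
maps: by `ϱE₂²¹ = ϱ` it is enough to consider elements `z·g` of `A ⊗ X`, and there both sides are
`m₀ ⊗ ϱ(z)Δ(g m₁)`. -/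
theorem phi₂_rho (hmod : IsIdempotentNondegenerateModule act)
    (h₂ : rho ∘ₗ (tw A X ∘ₗ H.E₂ (LinearMap.mul' k A) act ∘ₗ tw X A) = rho)
    (he : ∀ (x : X) (a b : A),
        rho (H.diagonalActionOp act (LinearMap.mul' k A) ((x ⊗ₜ[k] a) ⊗ₜ[k] b)) =
          H.diagonalAction act (LinearMap.mul' k A) (rho (x ⊗ₜ[k] a) ⊗ₜ[k] b))
    (hM : H.IsComodule lamM rhoM) (z : A ⊗[k] X) (m : M) :
    phi₂ act (LinearMap.mul' k A) rhoM (rho (tw A X z) ⊗ₜ[k] m) =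
      (rho ∘ₗ tw A X).lTensor M (phi₂ (LinearMap.mul' k A) act rhoM (z ⊗ₜ[k] m)) := by
  have hA := H.isModule_mul'
  have h₂' : rho (tw A X z) = rho (tw A X (H.E₂ (LinearMap.mul' k A) act z)) := by
    have h := LinearMap.congr_fun h₂ (tw A X z)
    simp only [LinearMap.comp_apply, tw_tw] at h
    exact h.symm
  have he' : ∀ (z : A ⊗[k] X) (b : A),
      rho (tw A X (H.diagonalAction (LinearMap.mul' k A) act (z ⊗ₜ[k] b))) =
        H.diagonalAction act (LinearMap.mul' k A) (rho (tw A X z) ⊗ₜ[k] b) := fun z b => by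
    induction z with
    | zero => simp
    | add x y hx hy => simp only [TensorProduct.add_tmul, map_add, hx, hy]
    | tmul a x =>
      rw [tw_tmul, ← he]
      simp [diagonalActionOp]
  rw [h₂', ← phi₂_E₂ hA hmod hM]
  refine H.E₂_induction hA hmod (p := fun z =>
    phi₂ act (LinearMap.mul' k A) rhoM (rho (tw A X z) ⊗ₜ[k] m) =
      (rho ∘ₗ tw A X).lTensor M (phi₂ (LinearMap.mul' k A) act rhoM (z ⊗ₜ[k] m))) ?_ ?_ ?_ ?_ z
  · simp
  · intro x y hx hy
    simp only [TensorProduct.add_tmul, map_add, hx, hy]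
  · intro c x hx
    simp only [map_smul, ← TensorProduct.smul_tmul', hx]
  · intro z g
    have e : (rho ∘ₗ tw A X) ∘ₗ orbit (H.diagonalAction (LinearMap.mul' k A) act) z =
        orbit (H.diagonalAction act (LinearMap.mul' k A)) (rho (tw A X z)) :=
      LinearMap.ext fun b => he' z b
    rw [he', phi₂_diagonalAction hmod hA hM, phi₂_diagonalAction hA hmod hM,
      ← LinearMap.lTensor_comp_apply, e]

/-- If `φ̂_{X,A}` is a comodule map, then `ϱ` is compatible with the diagonal actions: apply the
map `A ⊗_R X → X`, `b ⊗_R x ↦ ⊓ᴿ(b)x` to the identity of `isComoduleMap_phiHat_iff`. -/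
theorem rho_diagonalActionOp (hfull : H.RightFull) (hmod : IsIdempotentNondegenerateModule act)
    (hcomod : H.IsFullComodule lam rho)
    (hb : H.comoduleBaseAction lam rho = H.moduleBaseAction act)
    (h : ∀ x c m, (proj (H.comoduleBaseAction H.T₁ H.T₃) (H.comoduleBaseAction lam rho)).rTensor A
          ((TensorProduct.assoc k A X A).symm
            (phi₂ act (LinearMap.mul' k A) H.T₃ (rho (x ⊗ₜ[k] c) ⊗ₜ[k] m))) =
        (proj (H.comoduleBaseAction H.T₁ H.T₃) (H.comoduleBaseAction lam rho)).rTensor A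
          ((TensorProduct.assoc k A X A).symm ((rho ∘ₗ tw A X).lTensor A
            (phi₂ (LinearMap.mul' k A) act H.T₃ ((c ⊗ₜ[k] x) ⊗ₜ[k] m)))))
    (x : X) (a b : A) :
    rho (H.diagonalActionOp act (LinearMap.mul' k A) ((x ⊗ₜ[k] a) ⊗ₜ[k] b)) =
      H.diagonalAction act (LinearMap.mul' k A) (rho (x ⊗ₜ[k] a) ⊗ₜ[k] b) := by
  have hA := H.isModule_mul'
  have hAc := H.isComodule_self
  have hAf := RightFull.isFullComodule H hfull
  -- the map `b ⊗ x ↦ ⊓ᴿ(b)x`, which factors through `A ⊗_R X`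
  let f : A ⊗[k] X →ₗ[k] X := (H.comoduleBaseAction lam rho).left ∘ₗ H.piR'.rTensor X
  have hf : ∀ b x, f (b ⊗ₜ[k] x) = (H.comoduleBaseAction lam rho).left (H.piR' b ⊗ₜ[k] x) :=
    fun _ _ => rfl
  have hk : LinearMap.ker (proj (H.comoduleBaseAction H.T₁ H.T₃) (H.comoduleBaseAction lam rho)) ≤
      LinearMap.ker f := by
    refine ker_proj_le fun b r x => hcomod.eq_of_rho fun a => ?_
    obtain ⟨c, rfl⟩ := H.exists_piBarR'_eq r
    rw [hf, hf, hcomod.rho_left, hcomod.rho_left, hcomod.rho_left, hAf.right_piBarR']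
    have e : H.epsAct H.T₁ c b = (H.piBarR' c).1.right b := by
      rw [coe_piBarR', piBarR_right]
      rfl
    rw [e, ← baseMul_piR', baseMul_right]
  set g := descend (proj (H.comoduleBaseAction H.T₁ H.T₃) (H.comoduleBaseAction lam rho)) f
  have hg : g ∘ₗ proj (H.comoduleBaseAction H.T₁ H.T₃) (H.comoduleBaseAction lam rho) = f :=
    descend_comp hk
  -- `f φ_{X,A}(x ⊗ m) = x·m`
  have hfphi : ∀ x m, f (phi act H.T₃ (x ⊗ₜ[k] m)) = act (x ⊗ₜ[k] m) := fun x m => by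
    obtain ⟨y, rfl⟩ := hmod.idempotent x
    induction y with
    | zero => simp
    | add x y hx hy => simp only [TensorProduct.add_tmul, map_add, hx, hy]
    | tmul x a =>
      rw [phi_act hmod hAc.compat, ← hmod.assoc, ← H.lift_piBarLr_T₃]
      generalize H.T₃ (m ⊗ₜ[k] a) = t
      induction t with
      | zero => simp
      | add x y hx hy => simp only [TensorProduct.tmul_add, map_add, hx, hy]
      | tmul p q =>
        rw [LinearMap.lTensor_tmul, orbit_apply, hf, hb, H.left_act hmod, tau_piR', piBarL_right,
          TensorProduct.lift.tmul]
  have key := congrArg (g.rTensor A) (h x a b)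
  rw [← LinearMap.rTensor_comp_apply, ← LinearMap.rTensor_comp_apply, hg] at key
  have hl : ∀ z : X ⊗[k] A, f.rTensor A ((TensorProduct.assoc k A X A).symm
      (phi₂ act (LinearMap.mul' k A) H.T₃ (z ⊗ₜ[k] b))) =
      H.diagonalAction act (LinearMap.mul' k A) (z ⊗ₜ[k] b) := fun z => by
    induction z with
    | zero => simp
    | add x y hx hy => simp only [TensorProduct.add_tmul, map_add, hx, hy]
    | tmul x p =>
      have e : f ∘ₗ phi act H.T₃ ∘ₗ TensorProduct.mk k X A x = orbit act x :=
        LinearMap.ext fun m => hfphi x m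
      rw [phi₂_tmul, assoc_symm_assocMap, ← LinearMap.rTensor_comp_apply, e,
        hAc.phi_mul'_tmul, diagonalAction_mul' hmod]
  rw [hl] at key
  rw [key]
  -- `f(m₁ ⊗ ϱ(x ⊗ a m₂))` is `ϱ(x ⊗ a m)`, by `⊓ᴿ(p)x₀ ⊗ q x₁ = x₀ ⊗ q ⊓̄ᴸ(p)x₁` and `m₂⊓̄ᴸ(m₁) = m`
  have hr : ∀ (m : A) (x : X), f.rTensor A ((TensorProduct.assoc k A X A).symm
      ((rho ∘ₗ tw A X).lTensor A (TensorProduct.assoc k A A X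
        (H.T₃ (m ⊗ₜ[k] a) ⊗ₜ[k] x)))) = rho (x ⊗ₜ[k] (a * m)) := fun m x => by
    rw [← H.lift_piBarLr_T₃]
    generalize H.T₃ (m ⊗ₜ[k] a) = t
    induction t with
    | zero => simp
    | add x y hx hy => simp only [TensorProduct.tmul_add, TensorProduct.add_tmul, map_add, hx, hy]
    | tmul p q =>
      rw [TensorProduct.assoc_tmul, LinearMap.lTensor_tmul, LinearMap.comp_apply, tw_tmul,
        TensorProduct.lift.tmul, ← piBarL_right, ← tau_piR', ← hcomod.rTensor_left_rho]
      generalize rho (x ⊗ₜ[k] q) = y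
      induction y with
      | zero => simp
      | add x y hx hy => simp only [TensorProduct.tmul_add, map_add, hx, hy]
      | tmul x c => simp [hf]
  rw [phi₂_tmul]
  simp only [diagonalActionOp, LinearMap.comp_apply, LinearMap.rTensor_tmul, tw_tmul]
  obtain ⟨y, rfl⟩ := hmod.idempotent x
  clear key
  induction y with
  | zero => simp
  | add x y hx hy => simp only [TensorProduct.add_tmul, TensorProduct.tmul_add, map_add, hx, hy]
  | tmul x q =>
    rw [diagonalAction_act hA hmod, phi_act hmod hAc.compat]
    generalize H.T₃ (b ⊗ₜ[k] q) = t
    induction t with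
    | zero => simp
    | add x y hx hy => simp only [map_add, hx, hy]
    | tmul p q =>
      rw [TensorProduct.map_tmul, tw_tmul, orbit_apply, orbit_apply, LinearMap.lTensor_tmul,
        assocMap_tmul, LinearMap.id_apply, LinearMap.comp_apply, TensorProduct.mk_apply,
        hAc.phi_mul'_tmul, hr]
      rfl

end YetterDrinfeld

end RegularWMB

end WMB

namespace WMB

namespace RegularWMB

/-! ### The weak centers -/

section WeakCenters

variable {k : Type v} [Field k] {A : Type u} [NonUnitalRing A] [Module k A] [IsScalarTower k A A]
  [SMulCommClass k A A] {H : RegularWMB k A}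
  {V : Type u} [AddCommGroup V] [Module k V] {W : Type u} [AddCommGroup W] [Module k W]
  {M : Type u} [AddCommGroup M] [Module k M] {N : Type u} [AddCommGroup N] [Module k N]
  {act : V ⊗[k] A →ₗ[k] V} {actW : W ⊗[k] A →ₗ[k] W}
  {lam rho : M ⊗[k] A →ₗ[k] M ⊗[k] A} {lamN rhoN : N ⊗[k] A →ₗ[k] N ⊗[k] A}

/-- `φ̂` is natural in the comodule. -/
theorem phiHat_map_right (hV : IsIdempotentNondegenerateModule act) {bV : H.BaseAction V}
    (hbV : bV = H.moduleBaseAction act) (hM : H.IsFullComodule lam rho)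
    (hN : H.IsFullComodule lamN rhoN) {f : M →ₗ[k] N} (hf : IsComoduleMap lam lamN f) :
    phiHat act rhoN bV (H.comoduleBaseAction lamN rhoN) ∘ₗ
        mapR bV (H.comoduleBaseAction lam rho) bV (H.comoduleBaseAction lamN rhoN) LinearMap.id f =
      mapR (H.comoduleBaseAction lam rho) bV (H.comoduleBaseAction lamN rhoN) bV f LinearMap.id ∘ₗ
        phiHat act rho bV (H.comoduleBaseAction lam rho) := by
  refine LinearMap.ext fun x => ?_
  obtain ⟨z, rfl⟩ := proj_surjective _ _ x
  rw [LinearMap.comp_apply, LinearMap.comp_apply,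
    mapR_proj (fun _ _ => rfl) (fun r m => hM.map_left hN hf m r),
    phiHat_proj hV hN.compat hbV hN.rho_left, phiHat_proj hV hM.compat hbV hM.rho_left,
    mapR_proj (fun m r => hM.map_right hN hf m r) (fun _ _ => rfl)]
  congr 1
  induction z with
  | zero => simp
  | add x y hx hy => simp only [map_add, hx, hy]
  | tmul v m => exact phi_map_right hV hM.compat hN.compat hf v m

/-- `φ̂` is natural in the module. -/
theorem phiHat_map_left (hV : IsIdempotentNondegenerateModule act)
    (hW : IsIdempotentNondegenerateModule actW) {bM : H.BaseAction M}
    (hbM : bM = H.comoduleBaseAction lam rho) (hM : H.IsFullComodule lam rho)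
    {g : V →ₗ[k] W} (hg : IsModuleMap act actW g) :
    phiHat actW rho (H.moduleBaseAction actW) bM ∘ₗ
        mapR (H.moduleBaseAction act) bM (H.moduleBaseAction actW) bM g LinearMap.id =
      mapR bM (H.moduleBaseAction act) bM (H.moduleBaseAction actW) LinearMap.id g ∘ₗ
        phiHat act rho (H.moduleBaseAction act) bM := by
  subst hbM
  have hb : IsLeftBalanced rho (H.comoduleBaseAction lam rho) := hM.rho_left
  have hr : ∀ v r, g ((H.moduleBaseAction act).right (v ⊗ₜ[k] r)) =
      (H.moduleBaseAction actW).right (g v ⊗ₜ[k] r) := fun v r =>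
    hV.map_multiplierAction hW hg v r.1
  have hl : ∀ r v, g ((H.moduleBaseAction act).left (r ⊗ₜ[k] v)) =
      (H.moduleBaseAction actW).left (r ⊗ₜ[k] g v) := fun r v => by
    have h := hV.map_multiplierAction hW hg v (H.tau r)
    simpa [moduleBaseAction] using h
  refine LinearMap.ext fun x => ?_
  obtain ⟨z, rfl⟩ := proj_surjective _ _ x
  rw [LinearMap.comp_apply, LinearMap.comp_apply, mapR_proj hr (fun _ _ => rfl),
    phiHat_proj hW hM.compat rfl hb, phiHat_proj hV hM.compat rfl hb,
    mapR_proj (fun _ _ => rfl) hl]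
  congr 1
  induction z with
  | zero => simp
  | add x y hx hy => simp only [map_add, hx, hy]
  | tmul v m => exact phi_map_left hV hW hM.compat hg v m

/-- `φ̂_{V, M ⊗_R N} = (M ⊗_R φ̂_{V,N})(φ̂_{V,M} ⊗_R N)`. The `R`-actions on `V ⊗_R M` and the like
are left arbitrary, since in the weak center they come from comodule structures. -/
theorem phiHat_tensorRho (hV : IsIdempotentNondegenerateModule act) {bV : H.BaseAction V}
    (hbV : bV = H.moduleBaseAction act) {bM : H.BaseAction M}
    (hbM : bM = H.comoduleBaseAction lam rho) {bN : H.BaseAction N}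
    (hbN : bN = H.comoduleBaseAction lamN rhoN) (hM : H.IsFullComodule lam rho)
    (hN : H.IsFullComodule lamN rhoN) {bMN : H.BaseAction (TensorR bM bN)}
    (hbMN : bMN = H.comoduleBaseAction (tensorLam bM bN lam lamN) (tensorRho bM bN rho rhoN))
    {bVM : H.BaseAction (TensorR bV bM)} {bMV : H.BaseAction (TensorR bM bV)}
    {bVN : H.BaseAction (TensorR bV bN)} {bNV : H.BaseAction (TensorR bN bV)}
    (hVM : IsTensorBase bV bM bVM) (hMV : IsTensorBase bM bV bMV)
    (hVN : IsTensorBase bV bN bVN) (hNV : IsTensorBase bN bV bNV) :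
    phiHat act (tensorRho bM bN rho rhoN) bV bMN =
      assocRInv bM bN bV bMN bNV ∘ₗ
        mapR bM bVN bM bNV LinearMap.id (phiHat act rhoN bV bN) ∘ₗ
        assocR bM bV bN bMV bVN ∘ₗ
        mapR bVM bN bMV bN (phiHat act rho bV bM) LinearMap.id ∘ₗ
        assocRInv bV bM bN bVM bMN := by
  have hMN : IsTensorBase bM bN bMN := by
    subst hbM hbN hbMN
    exact isTensorBase_tensorLam hM hN
  have hcMN : IsCompatible (tensorLam bM bN lam lamN) (tensorRho bM bN rho rhoN) := by
    subst hbM hbN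
    exact isCompatible_tensor hM hN
  have hlMN : IsLeftBalanced (tensorRho bM bN rho rhoN) bMN := by
    subst hbM hbN hbMN
    exact isLeftBalanced_tensor hM hN
  have hlM : IsLeftBalanced rho bM := hbM ▸ hM.rho_left
  have hlN : IsLeftBalanced rhoN bN := hbN ▸ hN.rho_left
  have hphi : ∀ v m n, phi act (tensorRho bM bN rho rhoN) (v ⊗ₜ[k] proj bM bN (m ⊗ₜ[k] n)) =
      (proj bM bN).rTensor V ((TensorProduct.assoc k M N V).symm ((phi act rhoN).lTensor M
          (TensorProduct.assoc k M V N (phi act rho (v ⊗ₜ[k] m) ⊗ₜ[k] n)))) := by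
    subst hbM hbN
    exact phi_tensorRho hV hM hN
  refine LinearMap.ext fun x => ?_
  obtain ⟨z, rfl⟩ := proj_surjective _ _ x
  induction z with
  | zero => simp
  | add x y hx hy => simp only [map_add, hx, hy]
  | tmul v y =>
    obtain ⟨y, rfl⟩ := proj_surjective _ _ y
    induction y with
    | zero => simp
    | add x y hx hy => simp only [TensorProduct.tmul_add, map_add, hx, hy]
    | tmul m n =>
      have e : assocRInv bV bM bN bVM bMN (proj bV bMN (v ⊗ₜ[k] proj bM bN (m ⊗ₜ[k] n))) =
          proj bVM bN (proj bV bM (v ⊗ₜ[k] m) ⊗ₜ[k] n) :=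
        assocRInv_proj hVM hMN (v ⊗ₜ[k] (m ⊗ₜ[k] n))
      simp only [LinearMap.comp_apply]
      rw [phiHat_proj hV hcMN hbV hlMN, hphi, e,
        mapR_proj (fun x r => phiHat_right hV hM hbV hbM hVM hMV x r) (fun _ _ => rfl),
        TensorProduct.map_tmul, LinearMap.id_apply, phiHat_proj hV hM.compat hbV hlM,
        ← LinearMap.rTensor_tmul N (proj bM bV), assocR_proj hMV hVN,
        mapR_proj (fun _ _ => rfl) (fun r x => phiHat_left hV hN hbV hbN hVN hNV r x)]
      have e' : phiHat act rhoN bV bN ∘ₗ proj bV bN = proj bN bV ∘ₗ phi act rhoN :=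
        LinearMap.ext fun z => phiHat_proj hV hN.compat hbV hlN z
      change _ = assocRInv bM bN bV bMN bNV (proj bM bNV ((phiHat act rhoN bV bN).lTensor M _))
      rw [← LinearMap.lTensor_comp_apply, e', LinearMap.lTensor_comp_apply,
        assocRInv_proj hMN hNV]

/-- `φ̂_{V ⊗_R W, M} = (φ̂_{V,M} ⊗_R W)(V ⊗_R φ̂_{W,M})`. -/
theorem phiHat_tensorAct (hM : H.IsFullComodule lam rho) {bM : H.BaseAction M}
    (hbM : bM = H.comoduleBaseAction lam rho) (hV : IsIdempotentNondegenerateModule act)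
    (hW : IsIdempotentNondegenerateModule actW) {bV : H.BaseAction V}
    (hbV : bV = H.moduleBaseAction act) {bW : H.BaseAction W}
    (hbW : bW = H.moduleBaseAction actW) {bVW : H.BaseAction (TensorR bV bW)}
    (hbVW : bVW = H.moduleBaseAction (tensorAct bV bW act actW))
    {bVM : H.BaseAction (TensorR bV bM)} {bMV : H.BaseAction (TensorR bM bV)}
    {bWM : H.BaseAction (TensorR bW bM)} {bMW : H.BaseAction (TensorR bM bW)}
    (hVM : IsTensorBase bV bM bVM) (hMV : IsTensorBase bM bV bMV)
    (hWM : IsTensorBase bW bM bWM) (hMW : IsTensorBase bM bW bMW) :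
    phiHat (tensorAct bV bW act actW) rho bVW bM =
      assocR bM bV bW bMV bVW ∘ₗ
        mapR bVM bW bMV bW (phiHat act rho bV bM) LinearMap.id ∘ₗ
        assocRInv bV bM bW bVM bMW ∘ₗ
        mapR bV bWM bV bMW LinearMap.id (phiHat actW rho bW bM) ∘ₗ
        assocR bV bW bM bVW bWM := by
  have hVW : IsTensorBase bV bW bVW := by
    subst hbV hbW hbVW
    exact H.isTensorBase_tensorAct hV hW
  have hmVW : IsIdempotentNondegenerateModule (tensorAct bV bW act actW) := by
    subst hbV hbW
    exact H.isModule_tensorAct hV hW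
  have hl : IsLeftBalanced rho bM := hbM ▸ hM.rho_left
  have hphi : ∀ z m, phi (tensorAct bV bW act actW) rho (proj bV bW z ⊗ₜ[k] m) =
      (proj bV bW).lTensor M (phi₂ act actW rho (z ⊗ₜ[k] m)) := by
    subst hbV hbW
    exact phi_tensorAct hV hW hM.isComodule
  refine LinearMap.ext fun x => ?_
  obtain ⟨z, rfl⟩ := proj_surjective _ _ x
  induction z with
  | zero => simp
  | add x y hx hy => simp only [map_add, hx, hy]
  | tmul y m =>
    obtain ⟨y, rfl⟩ := proj_surjective _ _ y
    induction y with
    | zero => simp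
    | add x y hx hy => simp only [TensorProduct.add_tmul, map_add, hx, hy]
    | tmul v w =>
      have e : assocR bV bW bM bVW bWM (proj bVW bM (proj bV bW (v ⊗ₜ[k] w) ⊗ₜ[k] m)) =
          proj bV bWM (v ⊗ₜ[k] proj bW bM (w ⊗ₜ[k] m)) :=
        assocR_proj hVW hWM ((v ⊗ₜ[k] w) ⊗ₜ[k] m)
      simp only [LinearMap.comp_apply]
      rw [phiHat_proj hmVW hM.compat hbVW hl, hphi, e,
        mapR_proj (fun _ _ => rfl) (fun r x => phiHat_left hW hM hbW hbM hWM hMW r x),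
        TensorProduct.map_tmul, LinearMap.id_apply, phiHat_proj hW hM.compat hbW hl,
        ← LinearMap.lTensor_tmul, assocRInv_proj hVM hMW,
        mapR_proj (fun x r => phiHat_right hV hM hbV hbM hVM hMV x r) (fun _ _ => rfl)]
      have e' : phiHat act rho bV bM ∘ₗ proj bV bM = proj bM bV ∘ₗ phi act rho :=
        LinearMap.ext fun z => phiHat_proj hV hM.compat hbV hl z
      change _ = assocR bM bV bW bMV bVW (proj bMV bW ((phiHat act rho bV bM).rTensor W _))
      rw [← LinearMap.rTensor_comp_apply, e', LinearMap.rTensor_comp_apply,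
        assocR_proj hMV hVW]
      rfl

variable {X : Type u} [AddCommGroup X] [Module k X] {actX : X ⊗[k] A →ₗ[k] X}
  {lamX rhoX : X ⊗[k] A →ₗ[k] X ⊗[k] A}

/-- If the maps `φ̂_{X,M}` are comodule maps, they make `X` an object of the left weak center. -/
theorem isLeftWeakCenterObject_phiHat (hmod : IsIdempotentNondegenerateModule actX)
    (hcomod : H.IsFullComodule lamX rhoX)
    (hb : H.comoduleBaseAction lamX rhoX = H.moduleBaseAction actX)
    (h : ∀ M : ComoduleData k A, M.IsObject H →
        IsComoduleMap
          ((ComoduleData.mk X lamX rhoX).tensor H M).lam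
          (M.tensor H (ComoduleData.mk X lamX rhoX)).lam
          (phiHat actX M.rho (H.comoduleBaseAction lamX rhoX) (M.base H))) :
    IsLeftWeakCenterObject H (ComoduleData.mk X lamX rhoX)
      (fun M => phiHat actX M.rho (H.comoduleBaseAction lamX rhoX) (M.base H)) where
  isObject := hcomod
  isMap := h
  natural M N hM hN f hf := phiHat_map_right hmod hb hM hN hf
  unit q r s := by
    refine (phiHat_proj hmod H.isCompatible_base hb H.isLeftBalanced_base _).trans ?_
    have e := proj_phi_baseRho (H := H) hmod q r s
    rw [← hb] at e
    exact e
  tensor M N hM hN := phiHat_tensorRho hmod hb rfl rfl hM hN rfl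
    (isTensorBase_tensorLam hcomod hM) (isTensorBase_tensorLam hM hcomod)
    (isTensorBase_tensorLam hcomod hN) (isTensorBase_tensorLam hN hcomod)

/-- If the maps `φ̂_{V,X}` are module maps, they make `X` an object of the right weak center. -/
theorem isRightWeakCenterObject_phiHat (hfull : H.RightFull)
    (hmod : IsIdempotentNondegenerateModule actX) (hcomod : H.IsFullComodule lamX rhoX)
    (hb : H.comoduleBaseAction lamX rhoX = H.moduleBaseAction actX)
    (h : ∀ V : ModuleData k A, V.IsObject →
        IsModuleMap
          (V.tensor H (ModuleData.mk X actX)).act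
          ((ModuleData.mk X actX).tensor H V).act
          (phiHat V.act rhoX (V.base H) (H.moduleBaseAction actX))) :
    IsRightWeakCenterObject H (ModuleData.mk X actX)
      (fun V => phiHat V.act rhoX (V.base H) (H.moduleBaseAction actX)) where
  isObject := hmod
  isMap := h
  natural V W hV hW g hg := phiHat_map_left hV hW hb.symm hcomod hg
  unit p r s := by
    have hl : IsLeftBalanced rhoX (H.moduleBaseAction actX) := hb ▸ hcomod.rho_left
    refine (phiHat_proj (H.isModule_baseAct hfull) hcomod.compat rfl hl _).trans ?_
    have e := proj_phi_baseAct hfull hcomod r s p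
    rw [hb] at e
    exact e
  tensor V W hV hW := phiHat_tensorAct hcomod hb.symm hV hW rfl rfl rfl
    (H.isTensorBase_tensorAct hV hmod) (H.isTensorBase_tensorAct hmod hV)
    (H.isTensorBase_tensorAct hW hmod) (H.isTensorBase_tensorAct hmod hW)

end WeakCenters

end RegularWMB

end WMB

open WMB RegularWMB in
theorem mainTheorem1 {k : Type v} [Field k] {A : Type u} [NonUnitalRing A] [Module k A]
    [IsScalarTower k A A] [SMulCommClass k A A] (H : RegularWMB k A) (hfull : H.RightFull)
    {X : Type u} [AddCommGroup X] [Module k X]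
    (act : X ⊗[k] A →ₗ[k] X) (lam rho : X ⊗[k] A →ₗ[k] X ⊗[k] A)
    (hmod : IsIdempotentNondegenerateModule act) (hcomod : H.IsFullComodule lam rho)
    (h₁ : H.E₂ act (LinearMap.mul' k A) ∘ₗ rho = rho)
    (h₂ : rho ∘ₗ (tw A X ∘ₗ H.E₂ (LinearMap.mul' k A) act ∘ₗ tw X A) = rho) :
    List.TFAE [
      ∀ M : ComoduleData k A, M.IsObject H →
        IsComoduleMap
          ((ComoduleData.mk X lam rho).tensor H M).lam
          (M.tensor H (ComoduleData.mk X lam rho)).lam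
          (phiHat act M.rho (H.comoduleBaseAction lam rho) (M.base H)),
      IsLeftWeakCenterObject H (ComoduleData.mk X lam rho)
        (fun M => phiHat act M.rho (H.comoduleBaseAction lam rho) (M.base H)),
      ∀ V : ModuleData k A, V.IsObject →
        IsModuleMap
          (V.tensor H (ModuleData.mk X act)).act
          ((ModuleData.mk X act).tensor H V).act
          (phiHat V.act rho (V.base H) (H.moduleBaseAction act)),
      IsRightWeakCenterObject H (ModuleData.mk X act)
        (fun V => phiHat V.act rho (V.base H) (H.moduleBaseAction act)),
      ∀ (x : X) (a b : A),
        rho (H.diagonalActionOp act (LinearMap.mul' k A) ((x ⊗ₜ[k] a) ⊗ₜ[k] b)) =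
          H.diagonalAction act (LinearMap.mul' k A) (rho (x ⊗ₜ[k] a) ⊗ₜ[k] b)] := by
  have hb := comoduleBaseAction_eq_moduleBaseAction hmod hcomod h₁ h₂
  have hl : IsLeftBalanced rho (H.moduleBaseAction act) := hb ▸ hcomod.rho_left
  have hA := H.isModule_mul'
  tfae_have 1 → 2 := isLeftWeakCenterObject_phiHat hmod hcomod hb
  tfae_have 2 → 1 := fun h => h.isMap
  tfae_have 3 → 4 := isRightWeakCenterObject_phiHat hfull hmod hcomod hb
  tfae_have 4 → 3 := fun h => h.isMap
  tfae_have 5 → 1 := fun he M hM => by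
    refine (isComoduleMap_phiHat_iff hmod hcomod hb hM).2 fun x c m => ?_
    have e := phi₂_rho hmod h₂ he hM.isComodule (c ⊗ₜ[k] x) m
    rw [tw_tmul] at e
    rw [e]
  tfae_have 1 → 5 := fun h => rho_diagonalActionOp hfull hmod hcomod hb
    ((isComoduleMap_phiHat_iff hmod hcomod hb (RightFull.isFullComodule H hfull)).1
      (h (ComoduleData.mk A H.T₁ H.T₃) (RightFull.isFullComodule H hfull)))
  tfae_have 5 → 3 := fun he V hV y c => by
    obtain ⟨z, rfl⟩ := proj_surjective _ _ y
    refine (congrArg _ (H.tensorAct_proj hV hmod z c)).trans ?_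
    rw [phiHat_proj hV hcomod.compat rfl hl, phiHat_proj hV hcomod.compat rfl hl,
      phi_diagonalAction hmod hcomod hV he]
    exact (H.tensorAct_proj hmod hV _ c).symm
  tfae_have 3 → 5 := fun h x a b => by
    -- the case `V = A`, where `φ` is `ϱ` up to the flip
    have hphi := hcomod.isComodule.phi_mul'
    have e := h (ModuleData.mk A (LinearMap.mul' k A)) hA
      (proj (H.moduleBaseAction (LinearMap.mul' k A)) (H.moduleBaseAction act) (a ⊗ₜ[k] x)) b
    rw [phiHat_proj hA hcomod.compat rfl hl] at e
    replace e := ((congrArg _ (H.tensorAct_proj hA hmod (a ⊗ₜ[k] x) b)).symm.trans e).trans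
      (H.tensorAct_proj hmod hA _ b)
    rw [phiHat_proj hA hcomod.compat rfl hl, H.proj_eq_iff hmod hA, H.E₂_diagonalAction hmod hA,
      hphi, hphi, ← LinearMap.comp_apply (H.E₂ act _), h₁, tw_tmul] at e
    rw [← e]
    simp [diagonalActionOp]
  tfae_finish
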